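/- **Setting.** Let $d\ge 1$, let $\Omega\subset\mathbb R^d$ be a bounded open set, $T>0$, $Q=\Omega\times(0,T]$, $\bm g\in\mathbb R^d$. Let $\|\cdot\|$ and $(\cdot,\cdot)$ be the norm and inner product of $L^2(\Omega)$, $H^1_0(\Omega)$ the closure of $C_c^\infty(\Omega)$ in the $H^1$ norm, $H^{-1}(\Omega)$ its dual, $[\zeta]_+=\max\{\zeta,0\}$, and $\mathcal W=\{w\in L^2(0,T;H^1_0(\Omega)):\partial_t w\in L^2(0,T;H^{-1}(\Omega))\}\subset C([0,T];L^2(\Omega))$. Assume: 1. $p_c^{(i)},p_c^{(d)}:(0,1]\to\mathbb R$ are continuous, $C^1$ on $(0,1)$ with negative derivatives; $p_c^{(i)}<p_c^{(d)}$ on $(0,1)$; $p_c^{(i)}(1)=p_c^{(d)}(1)=:p_c(1)$; and $p_c^{(j)}(S)\to\infty$ as $S\searrow0$, $-{p_c^{(j)}}'(S)\to\infty$ as $S\nearrow1$ for $j\in\{i,d\}$. 2. $k\in C^1(\mathbb R)$, $k(S)=k(0)\ge0$ for $S\le0$, $k(S)=k(1)$ for $S\ge1$, $k(0)<k(S)<k(1)$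 for $0<S<1$; and either $k(0)>0$, or $k(0)=0$ and $\bm g=0$. 3. $b\in C^1(\mathbb R)$ is nondecreasing, $b'$ is bounded, $b(0)=0$ and $0<b'(p_c^{(j)}(S))<-1/{p_c^{(j)}}'(S)$ for $0<S<1$, $j\in\{i,d\}$. 4. $S_0\in H^1(\Omega)$, $p_0\in H^1_0(\Omega)$, and for some $\epsilon>0$, $\epsilon\le S_0\le1-\epsilon$ and $p_c^{(i)}(S_0)\le p_0\le p_c^{(d)}(S_0)$ a.e. in $\Omega$. Put $U_M=V_m=\lim_{p\to\infty}b(p)$, $U_m=b(p_c(1))$, $V_M=1+U_m$. For $j\in\{i,d\}$ let $\rho^{(j)}$ be, on $(V_m,V_M)$, the inverse of the function $u\mapsto (p_c^{(j)})^{-1}(b^{-1}(u))+u$ on $(U_m,U_M)$ (where $b^{-1}$ takes values in $[p_c(1),\infty)$), and let $\rho^{(j)}(v)=U_M$ for $v\le V_m$, $\rho^{(j)}(v)=U_m$ for $v\ge V_M$. For $\tau>0$ let $$\Phi_\tau(u,v)=\frac1\tau\begin{cases}\rho^{(d)}(v)-u & u>\rho^{(d)}(v),\\ 0 & \rho^{(i)}(v)\le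 u\le\rho^{(d)}(v),\\ \rho^{(i)}(v)-u & u<\rho^{(i)}(v).\end{cases}$$ A pair $(S,p)$ of functions on $Q$ is a *weak EPH solution* for $\tau>0$ if $p\in\mathcal W$, $S-S_0\in\mathcal W$, $S\in[0,1]$ a.e. in $Q$, $p(0)=p_0$, $S(0)=S_0$, $\partial_t(S+b(p))\in L^2(Q)$, and for all $\phi\in L^2(0,T;H_0^1(\Omega))$ and $\xi\in L^2(Q)$ $$\int_0^T\langle\partial_tS,\phi\rangle=\int_0^T(k(S)[\nabla p-\bm g],\nabla\phi),\qquad \int_0^T(\partial_t(S+b(p)),\xi)=\int_0^T(\Phi_\tau(b(p),S+b(p)),\xi).$$ **Proposition (bounds as $\tau\to0$).** (i) There is a constant $C>0$, independent of $\tau$, such that for every $\tau>0$ and every weak EPH solution $(S_\tau,p_\tau)$ for $\tau$, with $u_\tau=b(p_\tau)$ and $v_\tau=S_\tau+u_\tau$, the functions $[u_\tau-\rho^{(d)}(v_\tau)]_+$ and $[\rho^{(i)}(v_\tau)-u_\tau]_+$ belong to $L^2(Q)$ and $$\int_0^T\big\|[u_\tau-\rho^{(d)}(v_\tau)]_+\big\|^2+\int_0^T\big\|[\rho^{(i)}(v_\tau)-u_\tau]_+\big\|^2<C\tau.$$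 (ii) Let $\tau_n>0$, $\tau_n\to0$, and let $(S_n,p_n)$ be weak EPH solutions for $\tau_n$, $u_n=b(p_n)$, $v_n=S_n+u_n$. If $u_n\to u$ and $v_n\to v$ in measure on $Q$, then $\rho^{(i)}(v)\le u\le\rho^{(d)}(v)$ a.e. in $Q$. If $S_n\to S$ and $p_n\to p$ in measure on $Q$, then a.e. in $Q$: $0<S\le1$, $p\le p_c^{(d)}(S)$, and $p_c^{(i)}(S)\le p$ holds wherever $S<1$; wherever $S=1$ one has $b(p)=b(p_c(1))$ (so that $p=p_c(1)$ if $b$ is injective). If $\bm g=0$, then $p_c^{(i)}(S)\le p\le p_c^{(d)}(S)$ a.e. in $Q$. -/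

import Mathlib

open MeasureTheory Set Filter Topology
open scoped ContDiff

namespace EPH

noncomputable section

/-! ### Hysteresis curves -/

/-- Properties of the imbibition curve `pci` and the drainage curve `pcd`, as functions on `(0, 1]`
(values elsewhere are irrelevant). -/
structure CapillaryCurves (pci pcd : ℝ → ℝ) : Prop where
  contDiff_i : ContDiffOn ℝ 1 pci (Ioo 0 1)
  contDiff_d : ContDiffOn ℝ 1 pcd (Ioo 0 1)
  cont_i : ContinuousOn pci (Ioc 0 1)
  cont_d : ContinuousOn pcd (Ioc 0 1)
  deriv_neg_i : ∀ s ∈ Ioo (0 : ℝ) 1, deriv pci s < 0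
  deriv_neg_d : ∀ s ∈ Ioo (0 : ℝ) 1, deriv pcd s < 0
  lt : ∀ s ∈ Ioo (0 : ℝ) 1, pci s < pcd s
  eq_one : pci 1 = pcd 1
  tendsto_i : Tendsto pci (𝓝[>] 0) atTop
  tendsto_d : Tendsto pcd (𝓝[>] 0) atTop
  tendsto_deriv_i : Tendsto (fun s => -deriv pci s) (𝓝[<] 1) atTop
  tendsto_deriv_d : Tendsto (fun s => -deriv pcd s) (𝓝[<] 1) atTop

/-- Properties of the relative permeability. -/
structure Permeability (k : ℝ → ℝ) : Prop where
  contDiff : ContDiff ℝ 1 k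
  nonneg : 0 ≤ k 0
  eq_left : ∀ s ≤ 0, k s = k 0
  eq_right : ∀ s, 1 ≤ s → k s = k 1
  mid : ∀ s ∈ Ioo (0 : ℝ) 1, k 0 < k s ∧ k s < k 1

/-- Properties of the function `b` whose scanning curves are `S + b(p) = constant`. The two-sided
bound only concerns pressures above the common end value `pci 1 = pcd 1`; below that value `b` is
merely nondecreasing (for instance constant). -/
structure ScanningFunction (pci pcd b : ℝ → ℝ) : Prop where
  contDiff : ContDiff ℝ 1 b
  zero : b 0 = 0
  bound_i : ∀ s ∈ Ioo (0 : ℝ) 1, 0 < deriv b (pci s) ∧ deriv b (pci s) < -1 / deriv pci s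
  bound_d : ∀ s ∈ Ioo (0 : ℝ) 1, 0 < deriv b (pcd s) ∧ deriv b (pcd s) < -1 / deriv pcd s
  mono : Monotone b
  deriv_bdd : ∃ B : ℝ, ∀ q, deriv b q ≤ B

/-- `U_M = V_m = b(∞)`. -/
def UM (b : ℝ → ℝ) : ℝ := limUnder atTop b

/-- `U_m = b(p_c(1))`. -/
def Um (pc b : ℝ → ℝ) : ℝ := b (pc 1)

/-- `V_M = 1 + U_m`. -/
def VM (pc b : ℝ → ℝ) : ℝ := 1 + Um pc b

/-- `u ↦ p_c⁻¹(b⁻¹(u)) + u`: the curve `p = p_c(S)` written as `v = S + b(p)` in terms of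
`u = b(p)`. -/
def vCurve (pc b : ℝ → ℝ) (u : ℝ) : ℝ :=
  Function.invFunOn pc (Ioc 0 1) (Function.invFunOn b (Ici (pc 1)) u) + u

/-- The curve `ρ = (p_c⁻¹ ∘ b⁻¹ + id)⁻¹` on `(V_m, V_M)`, extended to `ℝ` by the constants
`U_M` (for `v ≤ V_m = U_M`) and `U_m` (for `v ≥ V_M`). -/
def rho (pc b : ℝ → ℝ) (v : ℝ) : ℝ :=
  open Classical in
  if v ≤ UM b then UM b
  else if VM pc b ≤ v then Um pc b
  else Function.invFunOn (vCurve pc b) (Ioo (Um pc b) (UM b)) v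

/-- The regularised hysteresis relation `∂ₜ v = Φ_τ(u, v)`. -/
def Phi (pci pcd b : ℝ → ℝ) (τ u v : ℝ) : ℝ :=
  open Classical in
  1 / τ * (if rho pcd b v < u then rho pcd b v - u
    else if u < rho pci b v then rho pci b v - u
    else 0)

/-! ### Function spaces -/

variable {d : ℕ}

/-- Test functions on `Ω`. -/
def IsTest (Ω : Set (EuclideanSpace ℝ (Fin d))) (φ : EuclideanSpace ℝ (Fin d) → ℝ) : Prop :=
  ContDiff ℝ ∞ φ ∧ HasCompactSupport φ ∧ tsupport φ ⊆ Ω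

/-- Pairs (function, vector field) in `L²(Ω) × L²(Ω; ℝᵈ)`, with the Hilbert norm. -/
abbrev Pairs (Ω : Set (EuclideanSpace ℝ (Fin d))) : Type :=
  WithLp 2 (Lp ℝ 2 (volume.restrict Ω) × Lp (EuclideanSpace ℝ (Fin d)) 2 (volume.restrict Ω))

/-- `f ∈ H¹(Ω)`: square integrable with a square integrable weak gradient. -/
def MemH1 (Ω : Set (EuclideanSpace ℝ (Fin d))) (f : EuclideanSpace ℝ (Fin d) → ℝ) : Prop :=
  MemLp f 2 (volume.restrict Ω) ∧
  ∃ G : EuclideanSpace ℝ (Fin d) → EuclideanSpace ℝ (Fin d), MemLp G 2 (volume.restrict Ω) ∧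
    ∀ φ, IsTest Ω φ → ∀ i : Fin d,
      ∫ x in Ω, f x * gradient φ x i = -∫ x in Ω, G x i * φ x

/-- `H¹₀(Ω)`, the closure of the test functions in the `H¹` norm. An element is the pair
`(f, ∇f)`, so that the norm is the `H¹` norm. -/
def H10 (Ω : Set (EuclideanSpace ℝ (Fin d))) : Submodule ℝ (Pairs Ω) :=
  (Submodule.span ℝ {w : Pairs Ω | ∃ φ, IsTest Ω φ ∧
    (w.fst : EuclideanSpace ℝ (Fin d) → ℝ) =ᵐ[volume.restrict Ω] φ ∧
    (w.snd : EuclideanSpace ℝ (Fin d) → EuclideanSpace ℝ (Fin d))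
      =ᵐ[volume.restrict Ω] gradient φ}).topologicalClosure

/-- `f ∈ H¹₀(Ω)`. -/
def MemH10 (Ω : Set (EuclideanSpace ℝ (Fin d))) (f : EuclideanSpace ℝ (Fin d) → ℝ) : Prop :=
  ∃ w ∈ H10 Ω, (w.fst : EuclideanSpace ℝ (Fin d) → ℝ) =ᵐ[volume.restrict Ω] f

/-- `H⁻¹(Ω)`, the dual of `H¹₀(Ω)`. -/
abbrev Hneg (Ω : Set (EuclideanSpace ℝ (Fin d))) : Type := StrongDual ℝ (H10 Ω)

/-- The space-time cylinder `Q = Ω × (0, T]`. -/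
def Q (Ω : Set (EuclideanSpace ℝ (Fin d))) (T : ℝ) : Set (EuclideanSpace ℝ (Fin d) × ℝ) :=
  Ω ×ˢ Ioc 0 T

/-- `w : Q → ℝ` belongs to
`𝓦 = {w ∈ L²(0,T; H¹₀(Ω)) : ∂ₜ w ∈ L²(0,T; H⁻¹(Ω))}`; here `W t` is `w(·,t)` as an element of
`H¹₀(Ω)`, and `W' = ∂ₜ w`. -/
structure IsW (Ω : Set (EuclideanSpace ℝ (Fin d))) (T : ℝ)
    (w : EuclideanSpace ℝ (Fin d) × ℝ → ℝ) (W : ℝ → H10 Ω) (W' : ℝ → Hneg Ω) : Prop where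
  meas : AEStronglyMeasurable w (volume.restrict (Q Ω T))
  memLp : MemLp W 2 (volume.restrict (Ioc 0 T))
  repr : ∀ᵐ t ∂(volume.restrict (Ioc 0 T)),
    ((W t : Pairs Ω).fst : EuclideanSpace ℝ (Fin d) → ℝ)
      =ᵐ[volume.restrict Ω] fun x => w (x, t)
  memLp' : MemLp W' 2 (volume.restrict (Ioc 0 T))
  deriv_eq : ∀ η : ℝ → ℝ, ContDiff ℝ ∞ η → HasCompactSupport η → tsupport η ⊆ Ioo 0 T →
    ∀ φ : H10 Ω,
      ∫ t in Ioc 0 T, η t * W' t φ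
        = -∫ t in Ioc 0 T, deriv η t * inner ℝ (W t : Pairs Ω).fst (φ : Pairs Ω).fst

/-- The initial value, i.e. the value at `t = 0` of the representative in `C([0,T]; L²(Ω))`,
of an element of `𝓦` is `w₀`. -/
def HasInitial (Ω : Set (EuclideanSpace ℝ (Fin d))) (T : ℝ) (W : ℝ → H10 Ω)
    (w₀ : EuclideanSpace ℝ (Fin d) → ℝ) : Prop :=
  ∃ c : ℝ → Lp ℝ 2 (volume.restrict Ω), ContinuousOn c (Icc 0 T) ∧
    (∀ᵐ t ∂(volume.restrict (Ioc 0 T)), c t = (W t : Pairs Ω).fst) ∧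
    (c 0 : EuclideanSpace ℝ (Fin d) → ℝ) =ᵐ[volume.restrict Ω] w₀

/-- `v'` is square integrable on `Q` and is the weak time derivative of `v` on `Q`. -/
def HasWeakTimeDeriv (Ω : Set (EuclideanSpace ℝ (Fin d))) (T : ℝ)
    (v v' : EuclideanSpace ℝ (Fin d) × ℝ → ℝ) : Prop :=
  MemLp v' 2 (volume.restrict (Q Ω T)) ∧
  ∀ ψ : EuclideanSpace ℝ (Fin d) × ℝ → ℝ, ContDiff ℝ ∞ ψ → HasCompactSupport ψ →
    tsupport ψ ⊆ Ω ×ˢ Ioo 0 T →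
    ∫ z in Q Ω T, v z * fderiv ℝ ψ z (0, 1) = -∫ z in Q Ω T, v' z * ψ z

/-! ### The initial data and the weak solutions -/

/-- Properties of the initial data. -/
structure InitialData (Ω : Set (EuclideanSpace ℝ (Fin d))) (pci pcd : ℝ → ℝ)
    (S₀ p₀ : EuclideanSpace ℝ (Fin d) → ℝ) : Prop where
  memH1 : MemH1 Ω S₀
  memH10 : MemH10 Ω p₀
  bounds : ∃ ε > 0, ∀ᵐ x ∂(volume.restrict Ω), ε ≤ S₀ x ∧ S₀ x ≤ 1 - ε
  between : ∀ᵐ x ∂(volume.restrict Ω), pci (S₀ x) ≤ p₀ x ∧ p₀ x ≤ pcd (S₀ x)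

/-- `(S, p)` is a weak solution of the regularised EPH model with parameter `τ`:
`p ∈ 𝓦`, `S - S₀ ∈ 𝓦`, `S ∈ [0,1]` a.e. in `Q`, `p(0) = p₀`, `S(0) = S₀`, and both weak equations
hold. Below `P`, `R` are `p`, `S - S₀` as curves in `H¹₀(Ω)`, `P'`, `R'` their time derivatives
(so `R' = ∂ₜ S`), and `v' = ∂ₜ (S + b(p))`. -/
def IsWeakSolution (Ω : Set (EuclideanSpace ℝ (Fin d))) (T : ℝ) (pci pcd b k : ℝ → ℝ)
    (g : EuclideanSpace ℝ (Fin d)) (S₀ p₀ : EuclideanSpace ℝ (Fin d) → ℝ) (τ : ℝ)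
    (S p : EuclideanSpace ℝ (Fin d) × ℝ → ℝ) : Prop :=
  ∃ (P R : ℝ → H10 Ω) (P' R' : ℝ → Hneg Ω) (v' : EuclideanSpace ℝ (Fin d) × ℝ → ℝ),
    IsW Ω T p P P' ∧
    IsW Ω T (fun z => S z - S₀ z.1) R R' ∧
    (∀ᵐ z ∂(volume.restrict (Q Ω T)), S z ∈ Icc (0 : ℝ) 1) ∧
    HasInitial Ω T P p₀ ∧
    HasInitial Ω T R 0 ∧
    HasWeakTimeDeriv Ω T (fun z => S z + b (p z)) v' ∧
    (∀ φ : ℝ → H10 Ω, MemLp φ 2 (volume.restrict (Ioc 0 T)) →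
      ∫ t in Ioc 0 T, R' t (φ t)
        = ∫ t in Ioc 0 T, ∫ x in Ω,
            inner ℝ (k (S (x, t)) • ((P t : Pairs Ω).snd x - g)) ((φ t : Pairs Ω).snd x)) ∧
    (∀ ξ : EuclideanSpace ℝ (Fin d) × ℝ → ℝ, MemLp ξ 2 (volume.restrict (Q Ω T)) →
      ∫ z in Q Ω T, v' z * ξ z
        = ∫ z in Q Ω T, Phi pci pcd b τ (b (p z)) (S z + b (p z)) * ξ z)

/-- `[ζ]₊`. -/
def posPart (ζ : ℝ) : ℝ := max ζ 0

end

end EPH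

/-! Write D = [u − ρ^(d)(v)]₊ and I = [ρ^(i)(v) − u]₊. As ρ^(i) ≤ ρ^(d), the hysteresis equation
reads ∂ₜv = (I − D)/τ. Let P(v) be the pressure on the imbibition curve at v and B a Lipschitz
constant of b. Then b(p) − ρ^(i)(v) = b(p) − b(P(v)) gives D² ≤ B·D(p − P(v)) and I² ≤ B·I(P(v) −
p), so D² + I² ≤ −Bτ ∂ₜv (p − P(v)) (`dissipation_le`). It remains to bound ∫∂ₜv p from below and
∫∂ₜv P(v) from above, independently of τ.

For the first, split ∂ₜv = ∂ₜS + ∂ₜb(p). The flux equation tested with p gives at least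
−k(1)|g|²|Ω|T, and ∂ₜb(p) p is the derivative of a nonnegative energy
(`SolutionData.neg_le_integral_mul`). For the second, P is decreasing, so −P(v)∂ₜv is the derivative
of a convex entropy of v, and v stays in an interval of length one
(`SolutionData.integral_mul_curveP_le`).

P blows up as v decreases to U_M, so it is truncated at a level M. The truncation error vanishes as
M → ∞ because v > U_M a.e. (`SolutionData.UM_lt`): where v ≤ U_M both curves lie above b(p), so v
would be increasing there, while it starts above U_M.

As ∂ₜS is only a functional on H¹₀, all chain rules in time are inequalities obtained from
`sub_le_integral_of_subgradient`, proved by averaging over time shifts.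

For the limits, D and I tend to zero in measure. An a.e. convergent subsequence and continuity of ρ
give the relation in (u, v), and monotonicity of b and of the curves translates it to (S, p). The
lower bound for p is lost only at S = 1, since b may be flat below p_c(1). Without gravity it is
restored by a minimum principle (`SolutionData.pc_one_le`): test with a cutoff of p below p_c(1),
observe that S = 1 and hence k(S) > 0 there, and apply Poincaré. -/

namespace EPH

/-! ### A single hysteresis curve -/

/-- The properties of one capillary pressure curve `pc` together with the scanning function `b`. -/
structure IsScanCurve (pc b : ℝ → ℝ) : Prop where
  contDiff_pc : ContDiffOn ℝ 1 pc (Ioo 0 1)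
  cont_pc : ContinuousOn pc (Ioc 0 1)
  deriv_neg : ∀ s ∈ Ioo (0 : ℝ) 1, deriv pc s < 0
  tendsto_pc : Tendsto pc (𝓝[>] 0) atTop
  contDiff_b : ContDiff ℝ 1 b
  mono : Monotone b
  bound : ∀ s ∈ Ioo (0 : ℝ) 1, 0 < deriv b (pc s) ∧ deriv b (pc s) < -1 / deriv pc s

theorem CapillaryCurves.isScanCurve_i {pci pcd b : ℝ → ℝ} (h : CapillaryCurves pci pcd)
    (hb : ScanningFunction pci pcd b) : IsScanCurve pci b :=
  ⟨h.contDiff_i, h.cont_i, h.deriv_neg_i, h.tendsto_i, hb.contDiff, hb.mono, hb.bound_i⟩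

theorem CapillaryCurves.isScanCurve_d {pci pcd b : ℝ → ℝ} (h : CapillaryCurves pci pcd)
    (hb : ScanningFunction pci pcd b) : IsScanCurve pcd b :=
  ⟨h.contDiff_d, h.cont_d, h.deriv_neg_d, h.tendsto_d, hb.contDiff, hb.mono, hb.bound_d⟩

/-- The curve `s ↦ b (pc s)` extended from `(0, 1)` by the constants `U_M` and `U_m`. -/
noncomputable def curveU (pc b : ℝ → ℝ) (s : ℝ) : ℝ :=
  if s ≤ 0 then UM b else if 1 ≤ s then Um pc b else b (pc s)

/-- The curve `s ↦ s + b (pc s)`, extended to a bijection of `ℝ`. -/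
noncomputable def curveV (pc b : ℝ → ℝ) (s : ℝ) : ℝ := s + curveU pc b s

namespace IsScanCurve

variable {pc b : ℝ → ℝ}

theorem pc_strictAnti (h : IsScanCurve pc b) : StrictAntiOn pc (Ioc 0 1) :=
  strictAntiOn_of_deriv_neg (convex_Ioc 0 1) h.cont_pc (by simpa using h.deriv_neg)

theorem pc_one_le (h : IsScanCurve pc b) {s : ℝ} (hs : s ∈ Ioc (0 : ℝ) 1) : pc 1 ≤ pc s :=
  h.pc_strictAnti.antitoneOn hs ⟨one_pos, le_rfl⟩ hs.2

theorem pc_one_lt (h : IsScanCurve pc b) {s : ℝ} (hs : s ∈ Ioo (0 : ℝ) 1) : pc 1 < pc s :=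
  h.pc_strictAnti ⟨hs.1, hs.2.le⟩ ⟨one_pos, le_rfl⟩ hs.2

theorem exists_pc_eq (h : IsScanCurve pc b) {q : ℝ} (hq : pc 1 ≤ q) :
    ∃ s ∈ Ioc (0 : ℝ) 1, pc s = q := by
  obtain ⟨s₀, h1, h2⟩ := ((h.tendsto_pc.eventually (eventually_ge_atTop q)).and
    (Ioo_mem_nhdsGT (one_pos : (0 : ℝ) < 1))).exists
  obtain ⟨s, hs, rfl⟩ := intermediate_value_Icc' h2.2.le
    (h.cont_pc.mono fun x hx => ⟨h2.1.trans_le hx.1, hx.2⟩) ⟨hq, h1⟩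
  exact ⟨s, ⟨h2.1.trans_le hs.1, hs.2⟩, rfl⟩

theorem exists_pc_eq_of_lt (h : IsScanCurve pc b) {q : ℝ} (hq : pc 1 < q) :
    ∃ s ∈ Ioo (0 : ℝ) 1, pc s = q := by
  obtain ⟨s, hs, rfl⟩ := h.exists_pc_eq hq.le
  refine ⟨s, ⟨hs.1, lt_of_le_of_ne hs.2 ?_⟩, rfl⟩
  rintro rfl
  exact hq.false

/-- Every pressure above `pc 1` is `pc s` with s in (0, 1), which is where `deriv b` is assumed
positive. -/
theorem b_strictMono (h : IsScanCurve pc b) : StrictMonoOn b (Ici (pc 1)) := by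
  refine strictMonoOn_of_deriv_pos (convex_Ici _) h.contDiff_b.continuous.continuousOn ?_
  intro q hq
  rw [interior_Ici] at hq
  obtain ⟨s, hs, rfl⟩ := h.exists_pc_eq_of_lt hq
  exact (h.bound s hs).1

/-- The derivative 1 + b'(pc s) pc'(s) is positive precisely by the upper bound on b'. This is what
makes v a coordinate along the curve. -/
theorem add_strictMono (h : IsScanCurve pc b) :
    StrictMonoOn (fun s => s + b (pc s)) (Ioc 0 1) := by
  refine strictMonoOn_of_deriv_pos (convex_Ioc 0 1)
    (continuousOn_id.add (h.contDiff_b.continuous.comp_continuousOn h.cont_pc)) ?_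
  intro s hs
  rw [interior_Ioc] at hs
  have h1 : HasDerivAt pc (deriv pc s) s :=
    (((h.contDiff_pc.differentiableOn one_ne_zero) s hs).differentiableAt
      (isOpen_Ioo.mem_nhds hs)).hasDerivAt
  have h2 : HasDerivAt b (deriv b (pc s)) (pc s) :=
    ((h.contDiff_b.differentiable one_ne_zero) _).hasDerivAt
  have h3 := (hasDerivAt_id s).add (h2.comp s h1)
  have h4 := h.bound s hs
  have h5 := h.deriv_neg s hs
  have h6 : deriv (fun s => s + b (pc s)) s = 1 + deriv b (pc s) * deriv pc s := h3.deriv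
  rw [h6]
  have h7 := h4.2
  rw [lt_div_iff_of_neg h5] at h7
  linarith

/-- Along the curve s + b(pc s) never exceeds its value at s = 1, and `pc` attains all high
pressures, so `b` is bounded above. Thus the `limUnder` in `UM` is a genuine limit. -/
theorem tendsto_b (h : IsScanCurve pc b) : Tendsto b atTop (𝓝 (UM b)) := by
  rcases tendsto_atTop_of_monotone h.mono with h1 | ⟨l, hl⟩
  · exfalso
    obtain ⟨q, hq1, hq2⟩ := ((h1.eventually (eventually_gt_atTop (1 + b (pc 1)))).and
      (eventually_ge_atTop (pc 1))).exists
    obtain ⟨s, hs, rfl⟩ := h.exists_pc_eq hq2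
    have := h.add_strictMono.monotoneOn hs ⟨one_pos, le_rfl⟩ hs.2
    linarith [hs.1]
  · rw [UM, hl.limUnder_eq]
    exact hl

theorem b_lt_UM (h : IsScanCurve pc b) (q : ℝ) : b q < UM b := by
  have h1 : b (max q (pc 1) + 1) ≤ UM b := h.mono.ge_of_tendsto h.tendsto_b _
  have h2 : b (max q (pc 1)) < b (max q (pc 1) + 1) :=
    h.b_strictMono (mem_Ici.2 (le_max_right _ _))
      (mem_Ici.2 ((le_max_right q (pc 1)).trans (by linarith))) (by linarith)
  linarith [h.mono (le_max_left q (pc 1))]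

theorem tendsto_add (h : IsScanCurve pc b) :
    Tendsto (fun s => s + b (pc s)) (𝓝[>] 0) (𝓝 (UM b)) := by
  have h1 : Tendsto (fun s : ℝ => s) (𝓝[>] 0) (𝓝 0) := tendsto_id.mono_left nhdsWithin_le_nhds
  simpa using h1.add (h.tendsto_b.comp h.tendsto_pc)

theorem UM_lt_add (h : IsScanCurve pc b) {s : ℝ} (hs : s ∈ Ioc (0 : ℝ) 1) :
    UM b < s + b (pc s) := by
  -- The limit at 0 gives only a weak inequality; comparing at s/2 first makes it strict at s.
  have hs2 : s / 2 ∈ Ioc (0 : ℝ) 1 := ⟨by linarith [hs.1], by linarith [hs.1, hs.2]⟩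
  have h1 : UM b ≤ s / 2 + b (pc (s / 2)) := by
    refine le_of_tendsto h.tendsto_add ?_
    filter_upwards [Ioo_mem_nhdsGT hs2.1] with t ht
    exact h.add_strictMono.monotoneOn ⟨ht.1, ht.2.le.trans hs2.2⟩ hs2 ht.2.le
  exact h1.trans_lt (h.add_strictMono hs2 hs (by linarith [hs.1]))

theorem UM_lt_VM (h : IsScanCurve pc b) : UM b < VM pc b := h.UM_lt_add ⟨one_pos, le_rfl⟩

theorem Um_lt_UM (h : IsScanCurve pc b) : Um pc b < UM b := h.b_lt_UM _

theorem Um_lt_b (h : IsScanCurve pc b) {q : ℝ} (hq : pc 1 < q) : Um pc b < b q :=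
  h.b_strictMono (mem_Ici.2 le_rfl) hq.le hq

theorem curveU_antitone (h : IsScanCurve pc b) : Antitone (curveU pc b) := by
  intro s t hst
  unfold curveU
  split_ifs with h1 h2 h3 h4 h5 h6 h7
  all_goals first | exact le_rfl | exact absurd hst (by linarith) | skip
  · exact h.Um_lt_UM.le
  · exact h.mono (h.pc_one_le ⟨by linarith, by linarith⟩)
  · exact (h.b_lt_UM _).le
  · exact h.mono (h.pc_strictAnti.antitoneOn ⟨by linarith, by linarith⟩
      ⟨by linarith, by linarith⟩ hst)

theorem curveV_strictMono (h : IsScanCurve pc b) : StrictMono (curveV pc b) := by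
  intro s t hst
  unfold curveV curveU
  split_ifs with h1 h2 h3 h4 h5 h6 h7
  all_goals first | linarith | skip
  · have := h.UM_lt_VM
    unfold VM at this
    linarith
  · have := h.UM_lt_add (s := t) ⟨by linarith, by linarith⟩
    linarith
  · have := @IsScanCurve.add_strictMono _ _ h s ⟨by linarith, by linarith⟩ 1
      ⟨one_pos, le_rfl⟩ (by linarith)
    simp only at this
    unfold Um
    linarith
  · exact h.add_strictMono ⟨by linarith, by linarith⟩ ⟨by linarith, by linarith⟩ hst

theorem curveV_surjective (h : IsScanCurve pc b) : Function.Surjective (curveV pc b) := by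
  intro v
  rcases le_or_gt v (UM b) with h1 | h1
  · exact ⟨v - UM b, by simp [curveV, curveU, h1]⟩
  rcases le_or_gt (VM pc b) v with h2 | h2
  · refine ⟨v - Um pc b, ?_⟩
    unfold VM at h2
    have : ¬ (v - Um pc b ≤ 0) := by linarith
    have h3 : 1 ≤ v - Um pc b := by linarith
    simp only [curveV, curveU, this, h3, if_true, if_false]
    ring
  obtain ⟨s₀, h3, h4⟩ := ((h.tendsto_add.eventually (eventually_lt_nhds h1)).and
    (Ioo_mem_nhdsGT (one_pos : (0 : ℝ) < 1))).exists
  obtain ⟨s, hs, hsv⟩ := intermediate_value_Ioo h4.2.le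
    ((continuousOn_id.add (h.contDiff_b.continuous.comp_continuousOn h.cont_pc)).mono
      fun x hx => ⟨h4.1.trans_le hx.1, hx.2⟩) (⟨h3, h2⟩ : v ∈ Ioo _ _)
  refine ⟨s, ?_⟩
  have h5 : ¬ s ≤ 0 := not_le.2 (h4.1.trans hs.1)
  simp only [curveV, curveU, h5, not_le.2 hs.2, if_false]
  exact hsv

theorem vCurve_eq (h : IsScanCurve pc b) {s : ℝ} (hs : s ∈ Ioc (0 : ℝ) 1) :
    vCurve pc b (b (pc s)) = s + b (pc s) := by
  have h1 : Function.invFunOn b (Ici (pc 1)) (b (pc s)) = pc s :=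
    h.b_strictMono.injOn.leftInvOn_invFunOn (h.pc_one_le hs)
  rw [vCurve, h1, h.pc_strictAnti.injOn.leftInvOn_invFunOn hs]

/-- Replaces the nested inverses in `rho` by the explicit parametrisation of the curve by
saturation. In the middle range the value of the outer inverse is located as b(pc t), and
injectivity of s + b(pc s) forces t = s. -/
theorem rho_curveV (h : IsScanCurve pc b) (s : ℝ) : rho pc b (curveV pc b s) = curveU pc b s := by
  unfold rho
  rcases le_or_gt s 0 with h1 | h1
  · simp [curveV, curveU, h1]
  have h1' := not_le.2 h1
  rcases le_or_gt 1 s with h2 | h2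
  · have h3 : VM pc b ≤ s + Um pc b := by unfold VM; linarith
    have h4 : ¬ s + Um pc b ≤ UM b := by linarith [h.UM_lt_VM]
    simp [curveV, curveU, h1', h2, h3, h4]
  have hs : s ∈ Ioo (0 : ℝ) 1 := ⟨h1, h2⟩
  have hs' : s ∈ Ioc (0 : ℝ) 1 := ⟨h1, h2.le⟩
  have h3 : ¬ s + b (pc s) ≤ UM b := not_le.2 (h.UM_lt_add hs')
  have h4 : ¬ VM pc b ≤ s + b (pc s) := not_le.2 (h.add_strictMono hs' ⟨one_pos, le_rfl⟩ h2)
  simp only [curveV, curveU, h1', not_le.2 h2, if_false, h3, h4]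
  have hex : ∃ u ∈ Ioo (Um pc b) (UM b), vCurve pc b u = s + b (pc s) :=
    ⟨b (pc s), ⟨h.Um_lt_b (h.pc_one_lt hs), h.b_lt_UM _⟩, h.vCurve_eq hs'⟩
  have h5 := Function.invFunOn_mem hex
  have h6 := Function.invFunOn_eq hex
  set u := Function.invFunOn (vCurve pc b) (Ioo (Um pc b) (UM b)) (s + b (pc s))
  obtain ⟨q₁, hq₁⟩ := (h.tendsto_b.eventually (eventually_gt_nhds h5.2)).exists
  have hq₁' : pc 1 < q₁ := by
    by_contra hcon
    have := h.mono (not_lt.1 hcon)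
    have h7 := h5.1
    unfold Um at h7
    linarith
  obtain ⟨q, hq, hqu⟩ := intermediate_value_Ioo hq₁'.le h.contDiff_b.continuous.continuousOn
    (⟨h5.1, hq₁⟩ : u ∈ Ioo _ _)
  obtain ⟨t, ht, rfl⟩ := h.exists_pc_eq_of_lt hq.1
  have ht' : t ∈ Ioc (0 : ℝ) 1 := ⟨ht.1, ht.2.le⟩
  rw [← hqu, h.vCurve_eq ht'] at h6
  rw [← hqu, h.add_strictMono.injOn ht' hs' h6]

theorem sub_rho_curveV (h : IsScanCurve pc b) (s : ℝ) :
    curveV pc b s - rho pc b (curveV pc b s) = s := by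
  rw [h.rho_curveV, curveV]
  ring

theorem sub_rho_strictMono (h : IsScanCurve pc b) : StrictMono fun v => v - rho pc b v := by
  intro v w hvw
  obtain ⟨s, rfl⟩ := h.curveV_surjective v
  obtain ⟨t, rfl⟩ := h.curveV_surjective w
  simp only [h.sub_rho_curveV]
  exact h.curveV_strictMono.lt_iff_lt.1 hvw

/-- The function v − ρ(v) returns the saturation parameter, so it is monotone and onto ℝ, and a
monotone surjection has no jumps. -/
theorem rho_continuous (h : IsScanCurve pc b) : Continuous (rho pc b) := by
  have h1 : Continuous fun v => v - rho pc b v :=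
    h.sub_rho_strictMono.monotone.continuous_of_surjective
      fun s => ⟨curveV pc b s, h.sub_rho_curveV s⟩
  have h2 : rho pc b = fun v => v - (v - rho pc b v) := by ext v; ring
  rw [h2]
  exact continuous_id.sub h1

theorem rho_antitone (h : IsScanCurve pc b) : Antitone (rho pc b) := by
  intro v w hvw
  obtain ⟨s, rfl⟩ := h.curveV_surjective v
  obtain ⟨t, rfl⟩ := h.curveV_surjective w
  simp only [h.rho_curveV]
  exact h.curveU_antitone (h.curveV_strictMono.le_iff_le.1 hvw)

theorem rho_le (h : IsScanCurve pc b) (v : ℝ) : rho pc b v ≤ UM b := by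
  obtain ⟨s, rfl⟩ := h.curveV_surjective v
  rw [h.rho_curveV]
  unfold curveU
  split_ifs
  exacts [le_rfl, h.Um_lt_UM.le, (h.b_lt_UM _).le]

theorem le_rho (h : IsScanCurve pc b) (v : ℝ) : Um pc b ≤ rho pc b v := by
  obtain ⟨s, rfl⟩ := h.curveV_surjective v
  rw [h.rho_curveV]
  unfold curveU
  split_ifs with h1 h2
  exacts [h.Um_lt_UM.le, le_rfl, h.mono (h.pc_one_le ⟨by linarith, by linarith⟩)]

theorem rho_of_le (v : ℝ) (hv : v ≤ UM b) : rho pc b v = UM b := by simp [rho, hv]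

theorem rho_of_ge (h : IsScanCurve pc b) {v : ℝ} (hv : VM pc b ≤ v) : rho pc b v = Um pc b := by
  simp [rho, hv, not_le.2 (h.UM_lt_VM.trans_le hv)]

theorem rho_add_of_mem (h : IsScanCurve pc b) {s : ℝ} (hs : s ∈ Ioc (0 : ℝ) 1) :
    rho pc b (s + b (pc s)) = b (pc s) := by
  have h1 := h.rho_curveV s
  have h2 : curveU pc b s = b (pc s) := by
    rcases hs.2.lt_or_eq with h2 | rfl
    · simp [curveU, not_le.2 hs.1, not_le.2 h2]
    · simp [curveU, Um]
  rwa [curveV, h2] at h1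

theorem exists_of_UM_lt (h : IsScanCurve pc b) {v : ℝ} (hv : UM b < v) (hv' : v ≤ VM pc b) :
    ∃ s ∈ Ioc (0 : ℝ) 1, s + b (pc s) = v ∧ rho pc b v = b (pc s) := by
  obtain ⟨s, rfl⟩ := h.curveV_surjective v
  have h0 : 0 < s := by
    by_contra hs
    have hs := not_lt.1 hs
    simp only [curveV, curveU, hs, if_true] at hv
    linarith
  have h1 : s ≤ 1 := by
    by_contra hs
    have hs := not_le.1 hs
    simp only [curveV, curveU, not_le.2 h0, hs.le, if_true, if_false, VM] at hv'
    linarith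
  have h2 : curveV pc b s = s + b (pc s) := by
    rcases h1.lt_or_eq with h2 | rfl
    · simp [curveV, curveU, not_le.2 h0, not_le.2 h2]
    · simp [curveV, curveU, Um]
  exact ⟨s, ⟨h0, h1⟩, h2.symm, by rw [h2, h.rho_add_of_mem ⟨h0, h1⟩]⟩

/-- Below the curve in terms of `u = b p` means below the curve in terms of `p`. -/
theorem le_pc_of_le_rho (h : IsScanCurve pc b) {s q : ℝ} (hs : s ∈ Ioc (0 : ℝ) 1)
    (hq : b q ≤ rho pc b (s + b q)) : q ≤ pc s := by
  by_contra hcon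
  have h1 := h.b_strictMono (h.pc_one_le hs) ((h.pc_one_le hs).trans (not_le.1 hcon).le)
    (not_le.1 hcon)
  have h2 := h.rho_antitone (show s + b (pc s) ≤ s + b q by linarith)
  rw [h.rho_add_of_mem hs] at h2
  linarith

theorem b_pc_le_of_rho_le (h : IsScanCurve pc b) {s q : ℝ} (hs : s ∈ Ioc (0 : ℝ) 1)
    (hq : rho pc b (s + b q) ≤ b q) : b (pc s) ≤ b q := by
  by_contra hcon
  have h2 := h.rho_antitone (show s + b q ≤ s + b (pc s) by linarith [not_le.1 hcon])
  rw [h.rho_add_of_mem hs] at h2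
  linarith

/-- For s < 1 the value b(pc s) lies strictly above b(pc 1), which excludes q ≤ pc 1. At s = 1 this
fails, because `b` may be flat below `pc 1`. -/
theorem pc_le_of_rho_le (h : IsScanCurve pc b) {s q : ℝ} (hs : s ∈ Ioo (0 : ℝ) 1)
    (hq : rho pc b (s + b q) ≤ b q) : pc s ≤ q := by
  have h1 := h.b_pc_le_of_rho_le ⟨hs.1, hs.2.le⟩ hq
  by_contra hcon
  have hcon := not_le.1 hcon
  rcases le_or_gt (pc 1) q with h3 | h3
  · linarith [h.b_strictMono h3 (h3.trans hcon.le) hcon]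
  · linarith [h.mono h3.le, h.b_strictMono (mem_Ici.2 le_rfl) (h.pc_one_lt hs).le (h.pc_one_lt hs)]

/-- At s = 0 one has v = b q < U_M, where ρ equals U_M and exceeds every value of b. -/
theorem saturation_pos (h : IsScanCurve pc b) {s q : ℝ} (hs : 0 ≤ s)
    (hq : rho pc b (s + b q) ≤ b q) : 0 < s := by
  rcases hs.lt_or_eq with h1 | rfl
  · exact h1
  · rw [rho_of_le _ (by linarith [h.b_lt_UM q])] at hq
    linarith [h.b_lt_UM q]

end IsScanCurve

/-- On each curve ρ(v) is v minus the saturation. The drainage curve has the larger v at equal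
saturation, so it reaches a given v at a smaller saturation. -/
theorem rho_i_le_rho_d {pci pcd b : ℝ → ℝ} (hpc : CapillaryCurves pci pcd)
    (hb : ScanningFunction pci pcd b) (v : ℝ) : rho pci b v ≤ rho pcd b v := by
  have hi := hpc.isScanCurve_i hb
  have hd := hpc.isScanCurve_d hb
  have hVM : VM pcd b = VM pci b := by simp [VM, Um, hpc.eq_one]
  have hUm : Um pcd b = Um pci b := by simp [Um, hpc.eq_one]
  rcases le_or_gt v (UM b) with h1 | h1
  · rw [IsScanCurve.rho_of_le v h1, IsScanCurve.rho_of_le v h1]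
  rcases le_or_gt (VM pci b) v with h2 | h2
  · rw [hi.rho_of_ge h2, hd.rho_of_ge (hVM ▸ h2), hUm]
  obtain ⟨s, hs, rfl, h3⟩ := hi.exists_of_UM_lt h1 h2.le
  have h4 : s + b (pci s) ≤ s + b (pcd s) := by
    rcases hs.2.lt_or_eq with h5 | rfl
    · linarith [hb.mono (hpc.lt s ⟨hs.1, h5⟩).le]
    · rw [hpc.eq_one]
  obtain ⟨t, ht, h6, h7⟩ := hd.exists_of_UM_lt h1 (hVM ▸ h2.le)
  have h8 : t ≤ s := by
    by_contra hcon
    have := hd.add_strictMono hs ht (not_le.1 hcon)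
    simp only at this
    linarith
  rw [h3, h7]
  linarith

end EPH

namespace EPH

/-! ### Curves in Hilbert spaces with square integrable weak derivative -/

section Abstract

variable {H : Type*} [NormedAddCommGroup H] [InnerProductSpace ℝ H]
  {X : Type*} [NormedAddCommGroup X] [NormedSpace ℝ X]

theorem aestronglyMeasurable_dual_apply {α : Type*} [MeasurableSpace α] {μ : Measure α}
    {U : α → StrongDual ℝ X} {W : α → X} (hU : AEStronglyMeasurable U μ)
    (hW : AEStronglyMeasurable W μ) : AEStronglyMeasurable (fun a => U a (W a)) μ :=
  isBoundedBilinearMap_apply.continuous.comp_aestronglyMeasurable (hU.prodMk hW)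

theorem integrable_dual_apply {α : Type*} [MeasurableSpace α] {μ : Measure α}
    {U : α → StrongDual ℝ X} {W : α → X} (hU : MemLp U 2 μ)
    (hW : MemLp W 2 μ) : Integrable (fun a => U a (W a)) μ := by
  refine Integrable.mono' (hU.norm.integrable_mul hW.norm)
    (aestronglyMeasurable_dual_apply hU.1 hW.1) (Eventually.of_forall fun a => ?_)
  exact (U a).le_opNorm (W a)

/-- The pairing of a square integrable function with a translate of another one is continuous in
the translation. -/
theorem tendsto_integral_dual_translate {U : ℝ → StrongDual ℝ X} {W : ℝ → X}
    (hU : MemLp U 2 volume) (hW : MemLp W 2 volume) :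
    Tendsto (fun s => ∫ r, U r (W (s + r))) (𝓝 0) (𝓝 (∫ r, U r (W r))) := by
  have hmp : ∀ s : ℝ, MeasurePreserving (fun r : ℝ => s + r) volume volume :=
    fun s => measurePreserving_add_left volume s
  let g : ℝ → C(ℝ, ℝ) := (ContinuousMap.mk (fun z : ℝ × ℝ => z.1 + z.2) (by fun_prop)).curry
  have hg : Continuous g := ContinuousMap.continuous _
  have h1 : Continuous fun s : ℝ => Lp.compMeasurePreserving (g s) (hmp s) (hW.toLp W) :=
    continuous_const.compMeasurePreservingLp hg hmp (by norm_num)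
  let B : StrongDual ℝ X →L[ℝ] X →L[ℝ] ℝ := ContinuousLinearMap.id ℝ (StrongDual ℝ X)
  have h2 : Continuous fun s : ℝ => B.lpPairing volume 2 2 (hU.toLp U)
      (Lp.compMeasurePreserving (g s) (hmp s) (hW.toLp W)) := by fun_prop
  have h3 : ∀ s : ℝ, B.lpPairing volume 2 2 (hU.toLp U)
      (Lp.compMeasurePreserving (g s) (hmp s) (hW.toLp W)) = ∫ r, U r (W (s + r)) := by
    intro s
    rw [ContinuousLinearMap.lpPairing_eq_integral]
    refine integral_congr_ae ?_
    filter_upwards [hU.coeFn_toLp, Lp.coeFn_compMeasurePreserving (hW.toLp W) (hmp s),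
      (hmp s).quasiMeasurePreserving.ae_eq_comp hW.coeFn_toLp] with r hr1 hr2 hr3
    have h5 : (Lp.compMeasurePreserving (g s) (hmp s) (hW.toLp W) : ℝ → X) r = W (s + r) :=
      hr2.trans hr3
    rw [hr1, h5]
    rfl
  simp only [h3] at h2
  simpa using h2.tendsto 0

theorem integrable_dual_translate {U : ℝ → StrongDual ℝ X} {W : ℝ → X}
    (hU : MemLp U 2 volume) (hW : MemLp W 2 volume) (h : ℝ) :
    Integrable (fun z : ℝ × ℝ => U (-z.1 + z.2) (W z.2))
      ((volume.restrict (Ioc 0 h)).prod volume) := by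
  have hmp := measurePreserving_prod_neg_add (volume.restrict (Ioc 0 h)) (volume : Measure ℝ)
  have h1 : Integrable (fun z : ℝ × ℝ => ‖U (-z.1 + z.2)‖ ^ 2)
      ((volume.restrict (Ioc 0 h)).prod volume) :=
    hmp.integrable_comp_of_integrable (hU.norm.integrable_sq.comp_snd (volume.restrict (Ioc 0 h)))
  have h2 : Integrable (fun z : ℝ × ℝ => ‖W z.2‖ ^ 2)
      ((volume.restrict (Ioc 0 h)).prod volume) :=
    hW.norm.integrable_sq.comp_snd (volume.restrict (Ioc 0 h))
  refine Integrable.mono' (h1.add h2) (aestronglyMeasurable_dual_apply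
    (hU.1.comp_snd.comp_measurePreserving hmp) hW.1.comp_snd) (Eventually.of_forall fun z => ?_)
  refine ((U (-z.1 + z.2)).le_opNorm (W z.2)).trans ?_
  simp only [Pi.add_apply]
  nlinarith [sq_nonneg (‖U (-z.1 + z.2)‖ - ‖W z.2‖), sq_nonneg ‖U (-z.1 + z.2)‖, sq_nonneg ‖W z.2‖]

/-- The substitution t = s + r moves the shift from W to U. After Fubini the inner integral has W t
frozen, so it becomes an increment of the primitive of U. -/
theorem integral_dual_translate {U : ℝ → StrongDual ℝ X} {W : ℝ → X}
    (hU : MemLp U 2 volume) (hW : MemLp W 2 volume) (h : ℝ) :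
    IntegrableOn (fun s => ∫ r, U r (W (s + r))) (Ioc 0 h) ∧
    ∫ s in Ioc 0 h, ∫ r, U r (W (s + r)) = ∫ t, ∫ s in Ioc 0 h, U (-s + t) (W t) := by
  have h1 : ∀ s : ℝ, ∫ r, U r (W (s + r)) = ∫ t, U (-s + t) (W t) := by
    intro s
    rw [← integral_add_left_eq_self (fun t => U (-s + t) (W t)) s]
    simp only [neg_add_cancel_left]
  simp only [h1]
  exact ⟨(integrable_dual_translate hU hW h).integral_prod_left,
    integral_integral_swap (integrable_dual_translate hU hW h)⟩

set_option maxHeartbeats 2000000 in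
theorem exists_memLp_extension {F : Type*} [NormedAddCommGroup F] {T : ℝ} {f : ℝ → F}
    (hf : MemLp f 2 (volume.restrict (Ioc 0 T))) :
    ∃ f' : ℝ → F, MemLp f' 2 volume ∧ (∀ r ∈ Ioc 0 T, f' r = f r) ∧ ∀ r ∉ Ioc 0 T, f' r = 0 :=
  ⟨(Ioc 0 T).indicator f, (memLp_indicator_iff_restrict measurableSet_Ioc).2 hf,
    fun _ hr => indicator_of_mem hr f, fun _ hr => indicator_of_notMem hr f⟩

/-- If a functional `J` along a curve `y` satisfies a subgradient inequality with subgradient `q`,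
then the integral of the derivative of `y` paired with `q` controls the increment of `J`. -/
theorem sub_le_integral_of_subgradient {T : ℝ} (hT : 0 < T) (ι : X →L[ℝ] H)
    {y : ℝ → H} (hy : ContinuousOn y (Icc 0 T))
    {U : ℝ → StrongDual ℝ X} (hU : MemLp U 2 (volume.restrict (Ioc 0 T)))
    (hyU : ∀ φ, ∀ t ∈ Icc 0 T, inner ℝ (y t - y 0) (ι φ) = ∫ r in Ioc 0 t, U r φ)
    {W : ℝ → X} (hW : MemLp W 2 (volume.restrict (Ioc 0 T)))
    {q : ℝ → H} {K : ℝ} (hq : ∀ t ∈ Icc 0 T, ‖q t‖ ≤ K)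
    (hWq : ∀ᵐ t ∂(volume.restrict (Ioc 0 T)), ι (W t) = q t)
    {J : ℝ → ℝ} (hJ : ∀ s ∈ Icc 0 T, ∀ t ∈ Icc 0 T, J t - J s ≤ inner ℝ (y t - y s) (q t))
    {m : ℝ} (hm : ∀ᵐ t ∂(volume.restrict (Ioc 0 T)), m ≤ J t) :
    m - J 0 ≤ ∫ t in Ioc 0 T, U t (W t) := by
  -- The subgradient inequality in both directions bounds |J t − J s| by K‖y t − y s‖.
  have hJc : ContinuousOn J (Icc 0 T) := by
    intro s hs
    rw [ContinuousWithinAt, tendsto_iff_dist_tendsto_zero]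
    have h1 : Tendsto (fun t => K * dist (y t) (y s)) (𝓝[Icc 0 T] s) (𝓝 0) := by
      simpa using ((tendsto_iff_dist_tendsto_zero.1 (hy s hs)).const_mul K)
    refine squeeze_zero' (Eventually.of_forall fun _ => dist_nonneg) ?_ h1
    filter_upwards [self_mem_nhdsWithin] with t ht
    rw [Real.dist_eq, dist_eq_norm, abs_le]
    have h2 : ∀ a ∈ Icc 0 T, ∀ c ∈ Icc 0 T, J c - J a ≤ K * ‖y c - y a‖ := fun a ha c hc =>
      (hJ a ha c hc).trans ((real_inner_le_norm _ _).trans (by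
        rw [mul_comm]; gcongr; exact hq c hc))
    have h3 := h2 t ht s hs
    rw [norm_sub_rev] at h3
    exact ⟨by linarith, h2 s hs t ht⟩
  -- J is continued by constants so that the shift t − h makes sense for t < h; U and W are
  -- continued by zero.
  let Jt : ℝ → ℝ := fun x => J (max 0 (min T x))
  have hJt : Continuous Jt :=
    hJc.comp_continuous (by fun_prop) fun x => ⟨le_max_left _ _, max_le hT.le (min_le_left _ _)⟩
  have hJt_eq : ∀ t ∈ Icc 0 T, Jt t = J t := fun t ht => by simp [Jt, ht.1, ht.2]
  obtain ⟨U', hU', hUin, hUout⟩ := exists_memLp_extension hU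
  obtain ⟨W', hW', hWin, hWout⟩ := exists_memLp_extension hW
  have hlim := tendsto_integral_dual_translate hU' hW'
  have hω0 : ∫ r, U' r (W' r) = ∫ t in Ioc 0 T, U t (W t) := by
    rw [← setIntegral_eq_integral_of_forall_compl_eq_zero (s := Ioc 0 T)
      fun r hr => by rw [hUout r hr]; rfl]
    exact setIntegral_congr_fun measurableSet_Ioc fun r hr => by
      simp only [hUin r hr, hWin r hr]
  rw [hω0] at hlim
  have hUint : ∀ φ, Integrable (fun r => U' r φ) := by
    intro φ
    have h1 : IntegrableOn (fun r => U r φ) (Ioc 0 T) :=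
      integrable_dual_apply hU (memLp_const φ)
    refine IntegrableOn.integrable_of_forall_notMem_eq_zero (s := Ioc 0 T) ?_
      fun r hr => by rw [hUout r hr]; rfl
    exact h1.congr_fun (fun r hr => by simp only [hUin r hr]) measurableSet_Ioc
  have hprim : ∀ φ, ∀ x ≤ T, ∫ r in (0 : ℝ)..x, U' r φ = inner ℝ (y (max x 0) - y 0) (ι φ) := by
    intro φ x hx
    rcases le_total x 0 with h0 | h0
    · rw [max_eq_right h0, sub_self, inner_zero_left, intervalIntegral.integral_symm,
        intervalIntegral.integral_of_le h0, setIntegral_eq_zero_of_forall_eq_zero, neg_zero]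
      intro r hr
      rw [hUout r fun h => absurd h.1 (not_lt.2 hr.2)]
      rfl
    · rw [max_eq_left h0, hyU φ x ⟨h0, hx⟩, intervalIntegral.integral_of_le h0]
      refine setIntegral_congr_fun measurableSet_Ioc fun r hr => ?_
      simp only [hUin r ⟨hr.1, hr.2.trans hx⟩]
  -- The right side is ∫⟨y t − y(t − h), q t⟩ dt, at least ∫(J t − J(t − h)) dt by the subgradient
  -- inequality. This telescopes to the integral of J over the last window of length h minus h J 0.
  have key : ∀ h ∈ Ioo 0 T, (m - J 0) * h ≤ ∫ s in Ioc 0 h, ∫ r, U' r (W' (s + r)) := by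
    intro h hh
    rw [(integral_dual_translate hU' hW' h).2]
    have hint : Integrable (fun t => ∫ s in Ioc 0 h, U' (-s + t) (W' t)) :=
      (integrable_dual_translate hU' hW' h).integral_prod_right
    have h1 : ∫ t, ∫ s in Ioc 0 h, U' (-s + t) (W' t)
        = ∫ t in Ioc 0 T, ∫ s in Ioc 0 h, U' (-s + t) (W' t) := by
      refine (setIntegral_eq_integral_of_forall_compl_eq_zero fun t ht => ?_).symm
      simp [hWout t ht]
    have h2 : ∀ᵐ t ∂(volume.restrict (Ioc 0 T)),
        Jt t - Jt (t - h) ≤ ∫ s in Ioc 0 h, U' (-s + t) (W' t) := by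
      filter_upwards [hWq, ae_restrict_mem measurableSet_Ioc] with t ht htm
      have hWt : W' t = W t := hWin t htm
      have h3 : ∫ s in Ioc 0 h, U' (-s + t) (W' t) = ∫ r in (t - h)..t, U' r (W t) := by
        rw [← intervalIntegral.integral_of_le hh.1.le, hWt]
        have := intervalIntegral.integral_comp_sub_left (a := 0) (b := h)
          (fun r => U' r (W t)) t
        simp only [sub_zero] at this
        rw [← this]
        refine intervalIntegral.integral_congr fun s _ => ?_
        simp only [neg_add_eq_sub]
      rw [h3, ← intervalIntegral.integral_interval_sub_left (a := 0)
        (hUint _).intervalIntegrable (hUint _).intervalIntegrable, hprim _ t htm.2,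
        hprim _ (t - h) (by linarith [htm.2, hh.1]), ← inner_sub_left, ht, max_eq_left htm.1.le]
      have h4 : max (t - h) 0 ∈ Icc 0 T :=
        ⟨le_max_right _ _, max_le (by linarith [htm.2, hh.1]) hT.le⟩
      have h5 := hJ _ h4 t ⟨htm.1.le, htm.2⟩
      rw [hJt_eq t ⟨htm.1.le, htm.2⟩]
      have h6 : Jt (t - h) = J (max (t - h) 0) := by
        simp only [Jt]
        rw [min_eq_right (by linarith [htm.2, hh.1]), max_comm]
      rw [h6]
      convert h5 using 2
      abel
    have h3 : ∫ t in Ioc 0 T, (Jt t - Jt (t - h)) ≤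
        ∫ t in Ioc 0 T, ∫ s in Ioc 0 h, U' (-s + t) (W' t) := by
      refine setIntegral_mono_ae_restrict ?_ hint.integrableOn h2
      exact (Continuous.integrableOn_Ioc (by fun_prop))
    rw [h1]
    refine le_trans ?_ h3
    rw [← intervalIntegral.integral_of_le hT.le, intervalIntegral.integral_sub
      (hJt.intervalIntegrable _ _) ((by fun_prop : Continuous fun t => Jt (t - h)).intervalIntegrable _ _),
      intervalIntegral.integral_comp_sub_right Jt h,
      intervalIntegral.integral_interval_sub_interval_comm' (hJt.intervalIntegrable _ _)
        (hJt.intervalIntegrable _ _) (hJt.intervalIntegrable _ _)]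
    have h4 : ∫ x in (0 - h)..0, Jt x = h * J 0 := by
      rw [intervalIntegral.integral_congr (g := fun _ => J 0)]
      · simp
      · intro x hx
        rw [uIcc_of_le (by linarith [hh.1])] at hx
        simp only [Jt]
        rw [min_eq_right (by linarith [hx.2]), max_eq_left hx.2]
    have h5 : m * h ≤ ∫ x in (T - h)..T, Jt x := by
      have h6 : ∫ x in (T - h)..T, m = m * h := by simp [mul_comm]
      rw [← h6]
      refine intervalIntegral.integral_mono_ae_restrict (by linarith [hh.1]) (by simp)
        (hJt.intervalIntegrable _ _) ?_
      rw [← Ioc_ae_eq_Icc |> Measure.restrict_congr_set]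
      filter_upwards [ae_restrict_of_ae_restrict_of_subset
        (Ioc_subset_Ioc_left (by linarith [hh.2] : 0 ≤ T - h)) hm,
        ae_restrict_mem measurableSet_Ioc] with t ht htm
      rw [hJt_eq t ⟨by linarith [htm.1, hh.2], htm.2⟩]
      exact ht
    linarith
  -- Otherwise continuity of translation at s = 0 keeps the pairing below some c < m − J 0 for all
  -- small s, contradicting `key`.
  by_contra hcon
  obtain ⟨c, hc1, hc2⟩ := exists_between (not_le.1 hcon)
  obtain ⟨δ, hδ, hδ'⟩ := Metric.eventually_nhds_iff.1 (hlim.eventually (eventually_lt_nhds hc1))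
  let h := min (δ / 2) (T / 2)
  have hh : h ∈ Ioo 0 T := ⟨by positivity, (min_le_right _ _).trans_lt (by linarith)⟩
  have h1 := key h hh
  have h2 : ∫ s in Ioc 0 h, ∫ r, U' r (W' (s + r)) ≤ ∫ s in Ioc 0 h, c := by
    refine setIntegral_mono_on (integral_dual_translate hU' hW' h).1 (by simp)
      measurableSet_Ioc fun s hs => (hδ' ?_).le
    rw [Real.dist_eq, sub_zero, abs_of_pos hs.1]
    exact (hs.2.trans (min_le_left _ _)).trans_lt (by linarith)
  have h3 : ∫ s in Ioc 0 h, c = c * h := by simp [hh.1.le, mul_comm]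
  nlinarith [hh.1]

end Abstract

end EPH

namespace EPH

/-! ### The fundamental theorem of calculus for weak derivatives -/

theorem smoothTransition_deriv_nonneg (x : ℝ) : 0 ≤ deriv Real.smoothTransition x :=
  Real.smoothTransition.monotone.deriv_nonneg

theorem smoothTransition_deriv_of_nonpos {x : ℝ} (hx : x ≤ 0) :
    deriv Real.smoothTransition x = 0 := by
  refine IsLocalMin.deriv_eq_zero (Eventually.of_forall fun z => ?_)
  rw [Real.smoothTransition.zero_of_nonpos hx]
  exact Real.smoothTransition.nonneg z

theorem smoothTransition_deriv_of_one_le {x : ℝ} (hx : 1 ≤ x) :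
    deriv Real.smoothTransition x = 0 := by
  refine IsLocalMax.deriv_eq_zero (Eventually.of_forall fun z => ?_)
  rw [Real.smoothTransition.one_of_one_le hx]
  exact Real.smoothTransition.le_one z

theorem smoothTransition_hasDerivAt (x : ℝ) :
    HasDerivAt Real.smoothTransition (deriv Real.smoothTransition x) x :=
  ((Real.smoothTransition.contDiff (n := 1)).differentiable one_ne_zero x).hasDerivAt

theorem smoothTransition_scaled_hasDerivAt (a ε r : ℝ) :
    HasDerivAt (fun r => Real.smoothTransition ((r - a) / ε))
      (deriv Real.smoothTransition ((r - a) / ε) * (1 / ε)) r :=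
  (smoothTransition_hasDerivAt _).comp r (((hasDerivAt_id r).sub_const a).div_const ε)

theorem continuous_smoothTransition_deriv_scaled (a ε : ℝ) :
    Continuous fun r : ℝ => deriv Real.smoothTransition ((r - a) / ε) * (1 / ε) :=
  (((Real.smoothTransition.contDiff (n := 1)).continuous_deriv le_rfl).comp
    (by fun_prop)).mul continuous_const

/-- The rescaled derivative is a nonnegative bump of mass one vanishing outside [a, a + ε], hence an
approximate identity at a. -/
theorem tendsto_integral_smoothTransition_deriv {T a : ℝ} (ha : a ∈ Ioo 0 T) {y : ℝ → ℝ}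
    (hy : ContinuousOn y (Icc 0 T)) :
    Tendsto (fun ε => ∫ r in Ioc 0 T, deriv Real.smoothTransition ((r - a) / ε) * (1 / ε) * y r)
      (𝓝[>] 0) (𝓝 (y a)) := by
  rw [Metric.tendsto_nhds]
  intro δ hδ
  have hya : ContinuousAt y a := hy.continuousAt (Icc_mem_nhds ha.1 ha.2)
  obtain ⟨ρ, hρ, hρ'⟩ := Metric.continuousAt_iff.1 hya (δ / 2) (by positivity)
  filter_upwards [Ioo_mem_nhdsGT (show 0 < min ρ (T - a) from lt_min hρ (by linarith [ha.2]))]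
    with ε hε
  have hε0 : 0 < ε := hε.1
  have hε1 : ε < ρ := hε.2.trans_le (min_le_left _ _)
  have hε2 : ε < T - a := hε.2.trans_le (min_le_right _ _)
  have h1 : ∫ r in Ioc 0 T, deriv Real.smoothTransition ((r - a) / ε) * (1 / ε) * y r
      = ∫ r in Ioc a (a + ε), deriv Real.smoothTransition ((r - a) / ε) * (1 / ε) * y r := by
    refine setIntegral_eq_of_subset_of_forall_sdiff_eq_zero measurableSet_Ioc
      (Ioc_subset_Ioc ha.1.le (by linarith)) fun r hr => ?_
    have h2 : deriv Real.smoothTransition ((r - a) / ε) = 0 := by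
      rcases le_or_gt r a with h3 | h3
      · exact smoothTransition_deriv_of_nonpos (div_nonpos_of_nonpos_of_nonneg (by linarith) hε0.le)
      · refine smoothTransition_deriv_of_one_le ?_
        rw [le_div_iff₀ hε0]
        have : ¬ r ≤ a + ε := fun h4 => hr.2 ⟨h3, h4⟩
        linarith
    rw [h2]
    simp
  have hsub : Icc a (a + ε) ⊆ Icc 0 T := Icc_subset_Icc ha.1.le (by linarith)
  have hc := continuous_smoothTransition_deriv_scaled a ε
  have h2 : ∫ r in Ioc a (a + ε), deriv Real.smoothTransition ((r - a) / ε) * (1 / ε) = 1 := by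
    rw [← intervalIntegral.integral_of_le (by linarith),
      intervalIntegral.integral_eq_sub_of_hasDerivAt
        (fun r _ => smoothTransition_scaled_hasDerivAt a ε r) (hc.intervalIntegrable _ _)]
    simp [hε0.ne']
  have hi1 : IntegrableOn (fun r => deriv Real.smoothTransition ((r - a) / ε) * (1 / ε) * y r)
      (Ioc a (a + ε)) :=
    ((hc.continuousOn.mul (hy.mono hsub)).integrableOn_Icc).mono_set Ioc_subset_Icc_self
  have hi2 : IntegrableOn (fun r => deriv Real.smoothTransition ((r - a) / ε) * (1 / ε))
      (Ioc a (a + ε)) := hc.integrableOn_Ioc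
  have h3 : (∫ r in Ioc 0 T, deriv Real.smoothTransition ((r - a) / ε) * (1 / ε) * y r) - y a
      = ∫ r in Ioc a (a + ε), deriv Real.smoothTransition ((r - a) / ε) * (1 / ε) * (y r - y a) := by
    simp only [mul_sub]
    rw [h1, integral_sub hi1 (hi2.mul_const _), integral_mul_const, h2, one_mul]
  rw [Real.dist_eq, h3, ← Real.norm_eq_abs]
  have h4 : ∫ r in Ioc a (a + ε), deriv Real.smoothTransition ((r - a) / ε) * (1 / ε) * (δ / 2)
      = δ / 2 := by rw [integral_mul_const, h2, one_mul]
  refine lt_of_le_of_lt (norm_integral_le_of_norm_le (hi2.mul_const (δ / 2)) ?_)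
    (h4.trans_lt (by linarith))
  filter_upwards [ae_restrict_mem measurableSet_Ioc] with r hr
  have h5 : 0 ≤ deriv Real.smoothTransition ((r - a) / ε) * (1 / ε) :=
    mul_nonneg (smoothTransition_deriv_nonneg _) (by positivity)
  rw [norm_mul, Real.norm_of_nonneg h5]
  refine mul_le_mul_of_nonneg_left ?_ h5
  have h6 : dist r a < ρ := by
    rw [Real.dist_eq, abs_of_pos (by linarith [hr.1])]
    linarith [hr.2]
  simpa [Real.dist_eq] using (hρ' h6).le

theorem tendsto_smoothTransition_scaled (r a : ℝ) :
    Tendsto (fun ε => Real.smoothTransition ((r - a) / ε)) (𝓝[>] 0)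
      (𝓝 ((Ioi a).indicator (fun _ => (1 : ℝ)) r)) := by
  by_cases hr : a < r
  · rw [indicator_of_mem (mem_Ioi.2 hr)]
    refine tendsto_const_nhds.congr' ?_
    filter_upwards [Ioo_mem_nhdsGT (sub_pos.2 hr)] with ε hε
    exact (Real.smoothTransition.one_of_one_le ((le_div_iff₀ hε.1).2 (by linarith [hε.2]))).symm
  · rw [indicator_of_notMem (by simpa using hr)]
    refine tendsto_const_nhds.congr' ?_
    filter_upwards [self_mem_nhdsWithin] with ε hε
    exact (Real.smoothTransition.zero_of_nonpos (div_nonpos_of_nonpos_of_nonneg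
      (by linarith [not_lt.1 hr]) (le_of_lt hε))).symm

/-- The test functions are differences of two rescaled smooth steps, starting at s and t: they
converge to the indicator of (s, t], while their derivatives converge to evaluation at s minus
evaluation at t. The endpoints 0 and T follow by continuity. -/
theorem sub_eq_integral_of_weakDeriv {T : ℝ} (hT : 0 < T) {y f : ℝ → ℝ}
    (hy : ContinuousOn y (Icc 0 T)) (hf : IntegrableOn f (Ioc 0 T))
    (h : ∀ η : ℝ → ℝ, ContDiff ℝ ∞ η → HasCompactSupport η → tsupport η ⊆ Ioo 0 T →
      ∫ t in Ioc 0 T, η t * f t = -∫ t in Ioc 0 T, deriv η t * y t) :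
    ∀ t ∈ Icc 0 T, y t - y 0 = ∫ r in Ioc 0 t, f r := by
  have key : ∀ s ∈ Ioo 0 T, ∀ t ∈ Ioo 0 T, s < t → y t - y s = ∫ r in Ioc s t, f r := by
    intro s hs t ht hst
    have h1 : Tendsto (fun ε => ∫ r in Ioc 0 T, (Real.smoothTransition ((r - s) / ε)
        - Real.smoothTransition ((r - t) / ε)) * f r) (𝓝[>] 0)
        (𝓝 (∫ r in Ioc 0 T, (Ioc s t).indicator f r)) := by
      refine tendsto_integral_filter_of_dominated_convergence (fun r => ‖f r‖) ?_ ?_ hf.norm ?_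
      · refine Eventually.of_forall fun ε => AEStronglyMeasurable.mul ?_ hf.1
        exact (Continuous.sub (Real.smoothTransition.continuous.comp (by fun_prop))
          (Real.smoothTransition.continuous.comp (by fun_prop))).aestronglyMeasurable
      · refine Eventually.of_forall fun ε => Eventually.of_forall fun r => ?_
        rw [norm_mul]
        refine mul_le_of_le_one_left (norm_nonneg _) ?_
        rw [Real.norm_eq_abs, abs_le]
        constructor <;> linarith [Real.smoothTransition.nonneg ((r - s) / ε),
          Real.smoothTransition.nonneg ((r - t) / ε), Real.smoothTransition.le_one ((r - s) / ε),
          Real.smoothTransition.le_one ((r - t) / ε)]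
      · refine Eventually.of_forall fun r => ?_
        convert ((tendsto_smoothTransition_scaled r s).sub
          (tendsto_smoothTransition_scaled r t)).mul_const (f r) using 2
        by_cases h2 : s < r <;> by_cases h3 : t < r
        · simp [h2, h3]
        · simp [h2, h3, not_lt.1 h3]
        · exact absurd (hst.trans h3) h2
        · simp [h2, h3]
    have h2 := ((tendsto_integral_smoothTransition_deriv hs hy).sub
      (tendsto_integral_smoothTransition_deriv ht hy)).neg
    have h3 : ∀ᶠ ε in 𝓝[>] (0 : ℝ), ∫ r in Ioc 0 T, (Real.smoothTransition ((r - s) / ε)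
        - Real.smoothTransition ((r - t) / ε)) * f r =
        -((∫ r in Ioc 0 T, deriv Real.smoothTransition ((r - s) / ε) * (1 / ε) * y r)
        - ∫ r in Ioc 0 T, deriv Real.smoothTransition ((r - t) / ε) * (1 / ε) * y r) := by
      filter_upwards [Ioo_mem_nhdsGT (sub_pos.2 ht.2)] with ε hε
      have hsupp : Function.support (fun r => Real.smoothTransition ((r - s) / ε)
          - Real.smoothTransition ((r - t) / ε)) ⊆ Icc s (t + ε) := by
        intro r hr
        by_contra hcon
        refine hr ?_
        simp only
        rcases lt_or_ge r s with h4 | h4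
        · rw [Real.smoothTransition.zero_of_nonpos, Real.smoothTransition.zero_of_nonpos, sub_self]
          · exact div_nonpos_of_nonpos_of_nonneg (by linarith) hε.1.le
          · exact div_nonpos_of_nonpos_of_nonneg (by linarith) hε.1.le
        · have h5 : t + ε < r := not_le.1 fun h5 => hcon ⟨h4, h5⟩
          rw [Real.smoothTransition.one_of_one_le, Real.smoothTransition.one_of_one_le, sub_self]
          · exact (le_div_iff₀ hε.1).2 (by linarith)
          · exact (le_div_iff₀ hε.1).2 (by linarith)
      have hts : tsupport (fun r => Real.smoothTransition ((r - s) / ε)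
          - Real.smoothTransition ((r - t) / ε)) ⊆ Icc s (t + ε) :=
        closure_minimal hsupp isClosed_Icc
      have hd : deriv (fun r => Real.smoothTransition ((r - s) / ε)
          - Real.smoothTransition ((r - t) / ε)) = fun r =>
          deriv Real.smoothTransition ((r - s) / ε) * (1 / ε)
          - deriv Real.smoothTransition ((r - t) / ε) * (1 / ε) := by
        ext r
        exact ((smoothTransition_scaled_hasDerivAt s ε r).sub
          (smoothTransition_scaled_hasDerivAt t ε r)).deriv
      rw [h _ ?_ ?_ ?_, hd, ← integral_sub]
      · simp only [sub_mul]
      · exact ((continuous_smoothTransition_deriv_scaled s ε).continuousOn.mul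
          hy).integrableOn_Icc.mono_set Ioc_subset_Icc_self
      · exact ((continuous_smoothTransition_deriv_scaled t ε).continuousOn.mul
          hy).integrableOn_Icc.mono_set Ioc_subset_Icc_self
      · exact (Real.smoothTransition.contDiff.comp (by fun_prop)).sub
          (Real.smoothTransition.contDiff.comp (by fun_prop))
      · exact HasCompactSupport.of_support_subset_isCompact isCompact_Icc hsupp
      · exact hts.trans fun r hr => ⟨hs.1.trans_le hr.1, hr.2.trans_lt (by linarith [hε.2])⟩
    have h4 := tendsto_nhds_unique (h1.congr' h3) h2
    rw [integral_indicator measurableSet_Ioc, Measure.restrict_restrict measurableSet_Ioc,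
      inter_eq_self_of_subset_left (Ioc_subset_Ioc hs.1.le ht.2.le)] at h4
    linarith
  have hfi : IntervalIntegrable f volume 0 T := (intervalIntegrable_iff_integrableOn_Ioc_of_le hT.le).2 hf
  have hfi' : ∀ t ∈ Icc 0 T, IntervalIntegrable f volume 0 t := fun t ht =>
    hfi.mono_set (by rw [uIcc_of_le hT.le, uIcc_of_le ht.1]; exact Icc_subset_Icc_right ht.2)
  have hG : ContinuousOn (fun t => ∫ r in (0 : ℝ)..t, f r) (Icc 0 T) := by
    have := intervalIntegral.continuousOn_primitive_interval (μ := volume) (a := (0 : ℝ)) (b := T) (f := f)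
      (by rw [uIcc_of_le hT.le, integrableOn_Icc_iff_integrableOn_Ioc]; exact hf)
    rwa [uIcc_of_le hT.le] at this
  have hc : T / 2 ∈ Ioo 0 T := ⟨by linarith, by linarith⟩
  have h1 : EqOn (fun t => y t - ∫ r in (0 : ℝ)..t, f r)
      (fun _ => y (T / 2) - ∫ r in (0 : ℝ)..(T / 2), f r) (Ioo 0 T) := by
    have h2 : ∀ s ∈ Ioo 0 T, ∀ t ∈ Ioo 0 T, s < t →
        y t - ∫ r in (0 : ℝ)..t, f r = y s - ∫ r in (0 : ℝ)..s, f r := by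
      intro s hs t ht hst
      have h3 := key s hs t ht hst
      rw [← intervalIntegral.integral_of_le hst.le,
        ← intervalIntegral.integral_interval_sub_left (hfi' t ⟨ht.1.le, ht.2.le⟩)
        (hfi' s ⟨hs.1.le, hs.2.le⟩)] at h3
      linarith
    intro t ht
    rcases lt_trichotomy t (T / 2) with h3 | h3 | h3
    · exact (h2 t ht _ hc h3).symm
    · simp [h3]
    · exact h2 _ hc t ht h3
  have h2 := h1.of_subset_closure (hy.sub hG) continuousOn_const Ioo_subset_Icc_self
    (by rw [closure_Ioo hT.ne])
  intro t ht
  have h3 := h2 ht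
  have h4 := h2 (left_mem_Icc.2 hT.le)
  simp only [intervalIntegral.integral_same] at h3 h4
  rw [← intervalIntegral.integral_of_le ht.1]
  linarith

end EPH

namespace EPH

/-! ### Square integrable functions on a product as curves in `L²` -/

section Curves

/-- Distinct orthonormal vectors are at distance √2, so the set is discrete. -/
theorem countable_of_orthonormal {H : Type*} [NormedAddCommGroup H] [InnerProductSpace ℝ H]
    [SecondCountableTopology H] {w : Set H} (hw : Orthonormal ℝ ((↑) : w → H)) : Countable w := by
  have h1 : DiscreteTopology w := by
    refine DiscreteTopology.of_forall_le_dist one_pos fun x y hxy => ?_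
    have h2 : dist x y ^ 2 = 2 := by
      rw [Subtype.dist_eq, dist_eq_norm, norm_sub_sq_real, hw.1 x, hw.1 y, hw.2 hxy]
      norm_num
    nlinarith [dist_nonneg (x := x) (y := y)]
  exact countable_of_Lindelof_of_discrete

/-- A weakly measurable function into a separable Hilbert space is strongly measurable. -/
theorem aestronglyMeasurable_of_forall_inner {α : Type*} [MeasurableSpace α] {μ : Measure α}
    {H : Type*} [NormedAddCommGroup H] [InnerProductSpace ℝ H] [CompleteSpace H]
    [SecondCountableTopology H] {f : α → H}
    (hf : ∀ e : H, AEStronglyMeasurable (fun a => inner ℝ e (f a)) μ) :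
    AEStronglyMeasurable f μ := by
  obtain ⟨w, B, hB⟩ := exists_hilbertBasis ℝ H
  -- Countability makes `atTop` on finite sets of indices countably generated, as needed for the
  -- limit of the partial expansions to be measurable.
  have : Countable w := countable_of_orthonormal (hB ▸ B.orthonormal)
  refine aestronglyMeasurable_of_tendsto_ae atTop
    (f := fun (s : Finset w) a => ∑ i ∈ s, (inner ℝ (B i) (f a) : ℝ) • B i) (fun s => ?_)
    (Eventually.of_forall fun a => ?_)
  · exact Finset.aestronglyMeasurable_fun_sum s fun i _ => (hf (B i)).smul_const (B i)
  · have := B.hasSum_repr (f a)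
    simp only [B.repr_apply_apply] at this
    exact this

variable {α β : Type*} [MeasurableSpace α] [MeasurableSpace β] {μ : Measure α} {ν : Measure β}

instance secondCountable_L2 {E : Type*} [NormedAddCommGroup E] [TopologicalSpace.SeparableSpace E]
    [IsSeparable μ] : SecondCountableTopology (Lp E 2 μ) :=
  haveI : Fact ((2 : ENNReal) ≠ ⊤) := ⟨by norm_num⟩
  Lp.SecondCountableTopology

theorem inner_L2_eq (f g : Lp ℝ 2 μ) : inner ℝ f g = ∫ x, f x * g x ∂μ := by
  rw [L2.inner_def]
  exact integral_congr_ae (Eventually.of_forall fun x => by simp [mul_comm])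

theorem integrable_L2_mul (f g : Lp ℝ 2 μ) : Integrable (fun x => f x * g x) μ :=
  (Lp.memLp f).integrable_mul (Lp.memLp g)

theorem norm_L2_sq (f : Lp ℝ 2 μ) : ‖f‖ ^ 2 = ∫ x, f x ^ 2 ∂μ := by
  rw [← real_inner_self_eq_norm_sq, inner_L2_eq]
  simp only [sq]

variable [SFinite μ] [SFinite ν]

theorem ae_prod_right {p : α × β → Prop} (h : ∀ᵐ z ∂(μ.prod ν), p z) :
    ∀ᵐ t ∂ν, ∀ᵐ x ∂μ, p (x, t) :=
  Measure.ae_ae_of_ae_prod (p := fun z => p z.swap)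
    (Measure.measurePreserving_swap.quasiMeasurePreserving.ae h)

/-- A square integrable function on a product is a square integrable curve in `L²`. -/
theorem exists_L2_curve [IsSeparable μ] {w : α × β → ℝ} (hw : MemLp w 2 (μ.prod ν)) :
    ∃ W : β → Lp ℝ 2 μ, MemLp W 2 ν ∧ ∀ᵐ t ∂ν, W t =ᵐ[μ] fun x => w (x, t) := by
  classical
  let W : β → Lp ℝ 2 μ := fun t =>
    if h : MemLp (fun x => w (x, t)) 2 μ then h.toLp _ else 0
  have hWeq : ∀ᵐ t ∂ν, W t =ᵐ[μ] fun x => w (x, t) := by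
    filter_upwards [hw.integrable_sq.prod_left_ae, hw.1.prodMk_right] with t ht1 ht2
    have h : MemLp (fun x => w (x, t)) 2 μ := (memLp_two_iff_integrable_sq ht2).2 ht1
    simp only [W, h, dif_pos]
    exact h.coeFn_toLp
  have hmeas : AEStronglyMeasurable W ν := by
    refine aestronglyMeasurable_of_forall_inner fun e => ?_
    have h1 : AEStronglyMeasurable (fun t => ∫ x, e x * w (x, t) ∂μ) ν :=
      ((Lp.aestronglyMeasurable e).comp_fst.mul hw.1).prod_swap.integral_prod_right'
    refine h1.congr ?_
    filter_upwards [hWeq] with t ht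
    rw [inner_L2_eq]
    exact integral_congr_ae (by filter_upwards [ht] with x hx; rw [hx])
  refine ⟨W, (memLp_two_iff_integrable_sq_norm hmeas).2 ?_, hWeq⟩
  refine hw.integrable_sq.integral_prod_right.congr ?_
  filter_upwards [hWeq] with t ht
  rw [norm_L2_sq]
  exact integral_congr_ae (by filter_upwards [ht] with x hx; rw [hx])

theorem integral_prod_eq_inner {w ζ : α × β → ℝ} (hw : MemLp w 2 (μ.prod ν))
    (hζ : MemLp ζ 2 (μ.prod ν)) {W Z : β → Lp ℝ 2 μ} (hW : ∀ᵐ t ∂ν, W t =ᵐ[μ] fun x => w (x, t))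
    (hZ : ∀ᵐ t ∂ν, Z t =ᵐ[μ] fun x => ζ (x, t)) :
    ∫ z, w z * ζ z ∂(μ.prod ν) = ∫ t, inner ℝ (W t) (Z t) ∂ν := by
  rw [integral_prod_symm (fun z => w z * ζ z) (hw.integrable_mul hζ)]
  refine integral_congr_ae ?_
  filter_upwards [hW, hZ] with t h1 h2
  rw [inner_L2_eq]
  exact integral_congr_ae (by filter_upwards [h1, h2] with x h3 h4; rw [h3, h4])

theorem memLp_of_L2_curve {w : α × β → ℝ} (hw : AEStronglyMeasurable w (μ.prod ν))
    {W : β → Lp ℝ 2 μ} (hWm : MemLp W 2 ν) (hW : ∀ᵐ t ∂ν, W t =ᵐ[μ] fun x => w (x, t)) :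
    MemLp w 2 (μ.prod ν) := by
  rw [memLp_two_iff_integrable_sq hw, integrable_prod_iff' (by fun_prop)]
  constructor
  · filter_upwards [hW] with t ht
    exact (Lp.memLp (W t)).integrable_sq.congr (by filter_upwards [ht] with x hx; rw [hx])
  · refine hWm.norm.integrable_sq.congr ?_
    filter_upwards [hW] with t ht
    rw [norm_L2_sq]
    exact integral_congr_ae (by
      filter_upwards [ht] with x hx
      rw [hx, Real.norm_of_nonneg (sq_nonneg _)])

end Curves

section Cylinder

variable {d : ℕ}

theorem restrict_Q (Ω : Set (EuclideanSpace ℝ (Fin d))) (T : ℝ) :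
    volume.restrict (Q Ω T) = (volume.restrict Ω).prod (volume.restrict (Ioc 0 T)) := by
  rw [Measure.prod_restrict]
  rfl

/-- An element of `L²(Ω)` orthogonal to all test functions vanishes. -/
theorem eq_zero_of_forall_test {Ω : Set (EuclideanSpace ℝ (Fin d))} (hΩ : IsOpen Ω)
    (f : Lp ℝ 2 (volume.restrict Ω)) (h : ∀ φ, IsTest Ω φ → ∫ x in Ω, f x * φ x = 0) : f = 0 := by
  rw [Lp.eq_zero_iff_ae_eq_zero, Filter.EventuallyEq, ae_restrict_iff' hΩ.measurableSet]
  refine hΩ.ae_eq_zero_of_integral_contDiff_smul_eq_zero ?_ fun φ h1 h2 h3 => ?_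
  · intro x hx
    obtain ⟨K, hK1, hK2, hK3⟩ := exists_compact_subset hΩ hx
    refine ⟨K, nhdsWithin_le_nhds (mem_interior_iff_mem_nhds.1 hK2), ?_⟩
    have h4 : MemLp f 2 (volume.restrict K) := (Lp.memLp f).mono_measure
      (Measure.restrict_mono hK3 le_rfl)
    have : IsFiniteMeasure (volume.restrict K) :=
      ⟨by rw [Measure.restrict_apply_univ]; exact hK1.measure_lt_top⟩
    exact h4.integrable (by norm_num)
  · rw [← h φ ⟨h1, h2, h3⟩, ← integral_indicator hΩ.measurableSet]
    refine integral_congr_ae (Eventually.of_forall fun x => ?_)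
    by_cases hx : x ∈ Ω
    · simp [hx, mul_comm]
    · simp [hx, image_eq_zero_of_notMem_tsupport fun h => hx (h3 h)]

end Cylinder

end EPH

namespace EPH

/-! ### Chain rule and Poincaré inequality in `H¹₀` -/

section SmulComp

variable {α E : Type*} [MeasurableSpace α] {μ : Measure α} [NormedAddCommGroup E]
  [InnerProductSpace ℝ E]

theorem norm_Lp_two_sq (f : Lp E 2 μ) : ‖f‖ ^ 2 = ∫ x, ‖f x‖ ^ 2 ∂μ := by
  rw [← real_inner_self_eq_norm_sq, L2.inner_def]
  simp only [real_inner_self_eq_norm_sq]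

theorem memLp_smulComp {γ : ℝ → ℝ} (hγ : Continuous γ) {K : ℝ} (hK : ∀ s, |γ s| ≤ K)
    (f : Lp ℝ 2 μ) (G : Lp E 2 μ) : MemLp (fun x => γ (f x) • G x) 2 μ := by
  refine (Lp.memLp G).of_le_mul (c := K)
    ((hγ.comp_aestronglyMeasurable (Lp.aestronglyMeasurable f)).smul (Lp.aestronglyMeasurable G))
    (Eventually.of_forall fun x => ?_)
  rw [norm_smul]
  exact mul_le_mul_of_nonneg_right (hK _) (norm_nonneg _)

/-- The product of `G` with the bounded function `γ ∘ f`. -/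
noncomputable def smulComp {γ : ℝ → ℝ} (hγ : Continuous γ) {K : ℝ} (hK : ∀ s, |γ s| ≤ K)
    (f : Lp ℝ 2 μ) (G : Lp E 2 μ) : Lp E 2 μ := (memLp_smulComp hγ hK f G).toLp _

variable {γ : ℝ → ℝ} (hγ : Continuous γ) {K : ℝ} (hK : ∀ s, |γ s| ≤ K)

theorem coeFn_smulComp (f : Lp ℝ 2 μ) (G : Lp E 2 μ) :
    smulComp hγ hK f G =ᵐ[μ] fun x => γ (f x) • G x := MemLp.coeFn_toLp _

theorem norm_smulComp_sub_le (f : Lp ℝ 2 μ) (G G' : Lp E 2 μ) :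
    ‖smulComp hγ hK f G - smulComp hγ hK f G'‖ ≤ K * ‖G - G'‖ := by
  refine Lp.norm_le_mul_norm_of_ae_le_mul ?_
  filter_upwards [coeFn_smulComp hγ hK f G, coeFn_smulComp hγ hK f G',
    Lp.coeFn_sub (smulComp hγ hK f G) (smulComp hγ hK f G'), Lp.coeFn_sub G G'] with x h1 h2 h3 h4
  rw [h3, h4, Pi.sub_apply, Pi.sub_apply, h1, h2, ← smul_sub, norm_smul]
  exact mul_le_mul_of_nonneg_right (hK _) (norm_nonneg _)

theorem norm_smulComp_le (f : Lp ℝ 2 μ) (G : Lp E 2 μ) : ‖smulComp hγ hK f G‖ ≤ K * ‖G‖ := by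
  refine Lp.norm_le_mul_norm_of_ae_le_mul ?_
  filter_upwards [coeFn_smulComp hγ hK f G] with x h1
  rw [h1, norm_smul]
  exact mul_le_mul_of_nonneg_right (hK _) (norm_nonneg _)

/-- Dominated convergence: since γ is bounded by K, (2K)²‖G‖² is a majorant. -/
theorem tendsto_smulComp_of_ae {f : Lp ℝ 2 μ} {F : ℕ → Lp ℝ 2 μ} (G : Lp E 2 μ)
    (h : ∀ᵐ x ∂μ, Tendsto (fun n => F n x) atTop (𝓝 (f x))) :
    Tendsto (fun n => smulComp hγ hK (F n) G) atTop (𝓝 (smulComp hγ hK f G)) := by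
  rw [tendsto_iff_norm_sub_tendsto_zero]
  have h1 : Tendsto (fun n => ‖smulComp hγ hK (F n) G - smulComp hγ hK f G‖ ^ 2) atTop (𝓝 0) := by
    have h2 : Tendsto (fun n => ∫ x, ‖(smulComp hγ hK (F n) G - smulComp hγ hK f G) x‖ ^ 2 ∂μ)
        atTop (𝓝 (∫ _, (0 : ℝ) ∂μ)) := by
      refine tendsto_integral_of_dominated_convergence (fun x => (2 * K) ^ 2 * ‖G x‖ ^ 2)
        (fun n => (Lp.aestronglyMeasurable _).norm.pow 2)
        ((Lp.memLp G).norm.integrable_sq.const_mul _) (fun n => ?_) ?_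
      · filter_upwards [coeFn_smulComp hγ hK (F n) G, coeFn_smulComp hγ hK f G,
          Lp.coeFn_sub (smulComp hγ hK (F n) G) (smulComp hγ hK f G)] with x h3 h4 h5
        rw [h5, Pi.sub_apply, h3, h4, ← sub_smul, norm_smul, mul_pow, norm_mul, norm_pow, norm_pow,
          norm_norm, norm_norm]
        gcongr
        rw [Real.norm_eq_abs]
        linarith [abs_sub (γ (F n x)) (γ (f x)), hK (F n x), hK (f x)]
      · have h3 : ∀ᵐ x ∂μ, ∀ n, (smulComp hγ hK (F n) G - smulComp hγ hK f G) x
            = (γ (F n x) - γ (f x)) • G x := by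
          rw [ae_all_iff]
          intro n
          filter_upwards [coeFn_smulComp hγ hK (F n) G, coeFn_smulComp hγ hK f G,
            Lp.coeFn_sub (smulComp hγ hK (F n) G) (smulComp hγ hK f G)] with x h3 h4 h5
          rw [h5, Pi.sub_apply, h3, h4, ← sub_smul]
        filter_upwards [h, h3] with x h4 h5
        simp only [h5]
        have h6 : Tendsto (fun n => γ (F n x) - γ (f x)) atTop (𝓝 0) := by
          simpa using ((hγ.tendsto _).comp h4).sub_const (γ (f x))
        simpa using ((h6.smul_const (G x)).norm.pow 2)
    simpa only [← norm_Lp_two_sq, integral_zero] using h2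
  simpa using h1.sqrt

/-- Convergence in L² yields a.e. convergence only along subsequences, so every subsequence is
refined further. The variation of G is absorbed by the bound K. -/
theorem continuous_smulComp :
    Continuous fun w : Lp ℝ 2 μ × Lp E 2 μ => smulComp hγ hK w.1 w.2 := by
  rw [continuous_iff_seqContinuous]
  intro u w hu
  refine Filter.tendsto_of_subseq_tendsto fun ns hns => ?_
  have h1 : Tendsto (fun n => (u (ns n)).1) atTop (𝓝 w.1) :=
    (continuous_fst.tendsto w).comp (hu.comp hns)
  obtain ⟨ms, hms, hae⟩ := (tendstoInMeasure_of_tendsto_Lp h1).exists_seq_tendsto_ae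
  refine ⟨ms, ?_⟩
  have h2 := tendsto_smulComp_of_ae hγ hK w.2 hae
  have h3 : Tendsto (fun n => (u (ns (ms n))).2 - w.2) atTop (𝓝 0) := by
    simpa using (((continuous_snd.tendsto w).comp
      (hu.comp (hns.comp hms.tendsto_atTop))).sub_const w.2)
  have h4 : Tendsto (fun n => smulComp hγ hK (u (ns (ms n))).1 (u (ns (ms n))).2
      - smulComp hγ hK (u (ns (ms n))).1 w.2) atTop (𝓝 0) := by
    refine squeeze_zero_norm (fun n => norm_smulComp_sub_le hγ hK _ _ _) ?_
    simpa using h3.norm.const_mul K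
  simpa using h4.add h2

end SmulComp

section H10

variable {d : ℕ} {Ω : Set (EuclideanSpace ℝ (Fin d))}

/-- The pairs `(φ, ∇φ)` of test functions `φ`. -/
def testPairs (Ω : Set (EuclideanSpace ℝ (Fin d))) : Set (Pairs Ω) :=
  {w : Pairs Ω | ∃ φ, IsTest Ω φ ∧
    (w.fst : EuclideanSpace ℝ (Fin d) → ℝ) =ᵐ[volume.restrict Ω] φ ∧
    (w.snd : EuclideanSpace ℝ (Fin d) → EuclideanSpace ℝ (Fin d))
      =ᵐ[volume.restrict Ω] gradient φ}

theorem IsTest.differentiable {φ : EuclideanSpace ℝ (Fin d) → ℝ} (h : IsTest Ω φ) :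
    Differentiable ℝ φ := h.1.differentiable (by simp)

theorem gradient_add {φ ψ : EuclideanSpace ℝ (Fin d) → ℝ} (hφ : Differentiable ℝ φ)
    (hψ : Differentiable ℝ ψ) : gradient (φ + ψ) = gradient φ + gradient ψ := by
  ext1 x
  simp only [gradient, Pi.add_apply]
  rw [fderiv_add (hφ x) (hψ x), map_add]

theorem gradient_smul {φ : EuclideanSpace ℝ (Fin d) → ℝ} (hφ : Differentiable ℝ φ) (c : ℝ) :
    gradient (c • φ) = c • gradient φ := by
  ext1 x
  simp only [gradient, Pi.smul_apply]
  rw [fderiv_const_smul (hφ x), map_smul]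

theorem gradient_comp {φ : EuclideanSpace ℝ (Fin d) → ℝ} (hφ : Differentiable ℝ φ) {β : ℝ → ℝ}
    (hβ : Differentiable ℝ β) : gradient (β ∘ φ) = fun x => deriv β (φ x) • gradient φ x := by
  ext1 x
  simp only [gradient]
  rw [((hβ (φ x)).hasDerivAt.comp_hasFDerivAt x (hφ x).hasFDerivAt).fderiv, map_smul]

/-- Because the test pairs already form a subspace, H¹₀ is simply their closure, and closed
conditions need checking only on test functions. -/
theorem span_testPairs_subset : (Submodule.span ℝ (testPairs Ω) : Set (Pairs Ω)) ⊆ testPairs Ω := by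
  intro w hw
  refine Submodule.span_induction (p := fun w _ => w ∈ testPairs Ω) (fun _ h => h) ?_ ?_ ?_ hw
  · refine ⟨0, ⟨contDiff_const, HasCompactSupport.zero, by simp⟩, ?_, ?_⟩
    · exact Lp.coeFn_zero _ _ _
    · refine (Lp.coeFn_zero _ _ _).trans (Eventually.of_forall fun x => ?_)
      simp [gradient]
  · rintro w z - - ⟨φ, h1, h2, h3⟩ ⟨ψ, h4, h5, h6⟩
    refine ⟨φ + ψ, ⟨h1.1.add h4.1, h1.2.1.add h4.2.1, (tsupport_add φ ψ).trans
      (union_subset h1.2.2 h4.2.2)⟩, (Lp.coeFn_add w.fst z.fst).trans (h2.add h5), ?_⟩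
    rw [gradient_add h1.differentiable h4.differentiable]
    exact (Lp.coeFn_add w.snd z.snd).trans (h3.add h6)
  · rintro c w - ⟨φ, h1, h2, h3⟩
    refine ⟨c • φ, ⟨h1.1.const_smul c, h1.2.1.smul_left (f := fun _ => c), (tsupport_smul_subset_right
      (fun _ => c) φ).trans h1.2.2⟩, (Lp.coeFn_smul c w.fst).trans (h2.const_smul c), ?_⟩
    rw [gradient_smul h1.differentiable]
    exact (Lp.coeFn_smul c w.snd).trans (h3.const_smul c)

theorem mem_H10_iff {w : Pairs Ω} : w ∈ H10 Ω ↔ w ∈ closure (testPairs Ω) := by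
  change w ∈ ((Submodule.span ℝ (testPairs Ω)).topologicalClosure : Set (Pairs Ω)) ↔ _
  rw [Submodule.topologicalClosure_coe,
    (span_testPairs_subset (Ω := Ω)).antisymm Submodule.subset_span]

/-- Composition with smooth functions acts continuously on `H¹₀`, with the usual chain rule. -/
theorem exists_comp_H10 {β : ℝ → ℝ} (hβ : ContDiff ℝ ∞ β) (h0 : β 0 = 0) {K : NNReal}
    (hK : ∀ s, |deriv β s| ≤ K) :
    ∃ N : H10 Ω → H10 Ω, Continuous N ∧ ∀ w : H10 Ω,
      ((N w : Pairs Ω).fst =ᵐ[volume.restrict Ω] fun x => β ((w : Pairs Ω).fst x)) ∧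
      ((N w : Pairs Ω).snd =ᵐ[volume.restrict Ω]
        fun x => deriv β ((w : Pairs Ω).fst x) • (w : Pairs Ω).snd x) ∧
      ‖N w‖ ≤ K * ‖w‖ := by
  have hβd : Differentiable ℝ β := hβ.differentiable (by simp)
  have hβ' : Continuous (deriv β) := hβ.continuous_deriv (by simp)
  have hL : LipschitzWith K β := lipschitzWith_of_nnnorm_deriv_le hβd fun s => hK s
  let N : Pairs Ω → Pairs Ω := fun w =>
    WithLp.toLp 2 (hL.compLp h0 w.fst, smulComp hβ' hK w.fst w.snd)
  have hN : Continuous N := by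
    refine (WithLp.prod_continuous_toLp 2 _ _).comp (Continuous.prodMk ?_ ?_)
    · exact (hL.continuous_compLp h0).comp (WithLp.continuous_fst 2 _ _)
    · exact (continuous_smulComp hβ' hK).comp
        ((WithLp.continuous_fst 2 _ _).prodMk (WithLp.continuous_snd 2 _ _))
  -- As β 0 = 0, composition with β does not enlarge supports; by continuity of N the closure H¹₀ is
  -- then preserved.
  have hmaps : MapsTo N (testPairs Ω) (testPairs Ω) := by
    rintro w ⟨φ, h1, h2, h3⟩
    refine ⟨β ∘ φ, ⟨hβ.comp h1.1, h1.2.1.comp_left h0, (tsupport_comp_subset h0 φ).trans h1.2.2⟩,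
      ?_, ?_⟩
    · filter_upwards [hL.coeFn_compLp h0 w.fst, h2] with x h4 h5
      exact h4.trans (congrArg β h5)
    · rw [gradient_comp h1.differentiable hβd]
      filter_upwards [coeFn_smulComp hβ' hK w.fst w.snd, h2, h3] with x h4 h5 h6
      rw [← h5, ← h6]
      exact h4
  have hmem : ∀ w ∈ H10 Ω, N w ∈ H10 Ω := fun w hw =>
    mem_H10_iff.2 (map_mem_closure hN (mem_H10_iff.1 hw) hmaps)
  refine ⟨fun w => ⟨N w, hmem w w.2⟩, ?_, fun w => ⟨hL.coeFn_compLp h0 _,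
    coeFn_smulComp hβ' hK _ _, ?_⟩⟩
  · exact (hN.comp continuous_subtype_val).subtype_mk _
  · have h1 := hL.norm_compLp_le h0 (w : Pairs Ω).fst
    have h2 := norm_smulComp_le hβ' hK (w : Pairs Ω).fst (w : Pairs Ω).snd
    have h3 : ‖N w‖ ^ 2 ≤ (K * ‖(w : Pairs Ω)‖) ^ 2 := by
      rw [mul_pow, WithLp.prod_norm_sq_eq_of_L2, WithLp.prod_norm_sq_eq_of_L2, mul_add, ← mul_pow,
        ← mul_pow]
      exact add_le_add (pow_le_pow_left₀ (norm_nonneg _) h1 2) (pow_le_pow_left₀ (norm_nonneg _) h2 2)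
    exact abs_le_of_sq_le_sq' h3 (by positivity) |>.2

/-- Integrating by parts against a coordinate ℓ gives ∫φ² = −∫2ℓφ ∂φ. Since |ℓ| ≤ R on Ω, Young's
inequality bounds this by ½∫φ² + 2R²∫|∇φ|², and absorbing the half produces 4R². -/
theorem IsTest.integral_sq_le (hd : 0 < d) {R : ℝ} (hR : ∀ x ∈ Ω, ‖x‖ ≤ R)
    {φ : EuclideanSpace ℝ (Fin d) → ℝ} (h : IsTest Ω φ) :
    ∫ x, φ x ^ 2 ≤ 4 * R ^ 2 * ∫ x, ‖gradient φ x‖ ^ 2 := by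
  obtain ⟨ℓ, e, hℓe, he, hℓ⟩ : ∃ (ℓ : EuclideanSpace ℝ (Fin d) →L[ℝ] ℝ)
      (e : EuclideanSpace ℝ (Fin d)), ℓ e = 1 ∧ ‖e‖ = 1 ∧ ∀ x, |ℓ x| ≤ ‖x‖ :=
    ⟨EuclideanSpace.proj ⟨0, hd⟩, EuclideanSpace.single ⟨0, hd⟩ 1, by simp, by simp,
      fun x => PiLp.norm_apply_le x _⟩
  have hφc := h.1.continuous
  have hφd := h.differentiable
  have hφ' : Continuous (fderiv ℝ φ) := h.1.continuous_fderiv (by simp)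
  have hsq : ∀ x, HasFDerivAt (fun x => φ x ^ 2) ((2 * φ x) • fderiv ℝ φ x) x := fun x => by
    simpa using (hφd x).hasFDerivAt.pow 2
  have hsupp : HasCompactSupport φ := h.2.1
  have hs2 : HasCompactSupport fun x => φ x ^ 2 := hsupp.mono fun x hx => by
    rw [Function.mem_support] at hx ⊢
    contrapose! hx
    simp [hx]
  have hi1 : Integrable fun x => φ x ^ 2 := (hφc.pow 2).integrable_of_hasCompactSupport hs2
  have hgc : Continuous (gradient φ) := (InnerProductSpace.toDual ℝ _).symm.continuous.comp hφ'
  have hgs : HasCompactSupport (gradient φ) :=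
    (hsupp.fderiv ℝ).comp_left (g := (InnerProductSpace.toDual ℝ _).symm) (map_zero _)
  have hi2 : Integrable fun x => ‖gradient φ x‖ ^ 2 :=
    (hgc.norm.pow 2).integrable_of_hasCompactSupport <| hgs.mono fun x hx => by
      rw [Function.mem_support] at hx ⊢
      contrapose! hx
      simp [hx]
  have hi3 : Integrable fun x => ℓ x * ((2 * φ x) • fderiv ℝ φ x) e := by
    refine Continuous.integrable_of_hasCompactSupport ?_ (HasCompactSupport.mul_left ?_)
    · exact ℓ.continuous.mul (((continuous_const.mul hφc).smul hφ').clm_apply continuous_const)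
    · refine hsupp.mono fun x hx => ?_
      rw [Function.mem_support] at hx ⊢
      contrapose! hx
      simp [hx]
  have hparts : ∫ x, ℓ x * ((2 * φ x) • fderiv ℝ φ x) e = -∫ x, φ x ^ 2 := by
    have h1 := integral_mul_fderiv_eq_neg_fderiv_mul_of_integrable (μ := volume) (f := fun x => ℓ x)
      (g := fun x => φ x ^ 2) (v := e) ?_ ?_ ?_ (fun x _ => ℓ.differentiableAt)
      (fun x _ => (hsq x).differentiableAt)
    · simpa only [(hsq _).fderiv, ContinuousLinearMap.fderiv, hℓe, one_mul] using h1
    · simpa only [ContinuousLinearMap.fderiv, hℓe, one_mul] using hi1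
    · simpa only [(hsq _).fderiv] using hi3
    · exact (ℓ.continuous.mul (hφc.pow 2)).integrable_of_hasCompactSupport hs2.mul_left
  have hbound : ∀ x, -(ℓ x * ((2 * φ x) • fderiv ℝ φ x) e)
      ≤ 1 / 2 * φ x ^ 2 + 2 * R ^ 2 * ‖gradient φ x‖ ^ 2 := by
    intro x
    by_cases hx : x ∈ Ω
    · have h1 : |ℓ x| ≤ R := (hℓ x).trans (hR x hx)
      have h2 : |fderiv ℝ φ x e| ≤ ‖gradient φ x‖ := by
        have h3 := (fderiv ℝ φ x).le_opNorm e
        rw [he, mul_one] at h3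
        simpa [gradient] using h3
      have h3 : |ℓ x * fderiv ℝ φ x e| ≤ R * ‖gradient φ x‖ := by
        rw [abs_mul]
        exact mul_le_mul h1 h2 (abs_nonneg _) ((abs_nonneg _).trans h1)
      have h4 : (ℓ x * fderiv ℝ φ x e) ^ 2 ≤ (R * ‖gradient φ x‖) ^ 2 := sq_le_sq' (by
        linarith [neg_abs_le (ℓ x * fderiv ℝ φ x e)]) ((le_abs_self _).trans h3)
      have h5 : (ℓ x * ((2 * φ x) • fderiv ℝ φ x) e) = 2 * φ x * (ℓ x * fderiv ℝ φ x e) := by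
        simp
        ring
      rw [h5]
      nlinarith [sq_nonneg (φ x + 2 * (ℓ x * fderiv ℝ φ x e))]
    · have h1 : φ x = 0 := image_eq_zero_of_notMem_tsupport fun h' => hx (h.2.2 h')
      simp only [h1, mul_zero, zero_smul]
      simp only [zero_apply]
      nlinarith [sq_nonneg (R * ‖gradient φ x‖)]
  have h1 : ∫ x, -(ℓ x * ((2 * φ x) • fderiv ℝ φ x) e) ≤
      ∫ x, (1 / 2 * φ x ^ 2 + 2 * R ^ 2 * ‖gradient φ x‖ ^ 2) :=
    integral_mono hi3.neg ((hi1.const_mul _).add (hi2.const_mul _)) hbound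
  rw [integral_neg, hparts, integral_add (hi1.const_mul _) (hi2.const_mul _), integral_const_mul,
    integral_const_mul] at h1
  linarith

/-- **Poincaré inequality.** -/
theorem exists_poincare (hd : 0 < d) (hΩ : Bornology.IsBounded Ω) :
    ∃ C : ℝ, ∀ w ∈ H10 Ω, ‖w.fst‖ ^ 2 ≤ C * ‖w.snd‖ ^ 2 := by
  obtain ⟨R, hR⟩ := hΩ.exists_norm_le
  refine ⟨4 * R ^ 2, fun w hw => ?_⟩
  have hcl : IsClosed {w : Pairs Ω | ‖w.fst‖ ^ 2 ≤ 4 * R ^ 2 * ‖w.snd‖ ^ 2} :=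
    isClosed_le ((WithLp.continuous_fst 2 _ _).norm.pow 2)
      (((WithLp.continuous_snd 2 _ _).norm.pow 2).const_mul _)
  refine closure_minimal ?_ hcl (mem_H10_iff.1 hw)
  rintro w ⟨φ, h1, h2, h3⟩
  have h4 : ‖w.fst‖ ^ 2 = ∫ x, φ x ^ 2 := by
    rw [norm_Lp_two_sq, ← setIntegral_eq_integral_of_forall_compl_eq_zero (s := Ω)
      (f := fun x => φ x ^ 2)]
    · exact integral_congr_ae (by filter_upwards [h2] with x hx; simp [hx])
    · intro x hx
      simp [image_eq_zero_of_notMem_tsupport fun h' => hx (h1.2.2 h')]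
  have h5 : ‖w.snd‖ ^ 2 = ∫ x, ‖gradient φ x‖ ^ 2 := by
    rw [norm_Lp_two_sq, ← setIntegral_eq_integral_of_forall_compl_eq_zero (s := Ω)
      (f := fun x => ‖gradient φ x‖ ^ 2)]
    · exact integral_congr_ae (by filter_upwards [h3] with x hx; simp [hx])
    · intro x hx
      have : fderiv ℝ φ x = 0 := by
        refine image_eq_zero_of_notMem_tsupport fun h' => hx (h1.2.2 (tsupport_fderiv_subset ℝ h'))
      simp [gradient, this]
  rw [mem_ofPred_eq, h4, h5]
  exact h1.integral_sq_le hd hR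

end H10

end EPH

namespace EPH

/-! ### Integral inequalities for weak solutions -/

variable {d : ℕ} {Ω : Set (EuclideanSpace ℝ (Fin d))} {T : ℝ}

/-- A function with a weak time derivative on the cylinder satisfies the fundamental theorem of
calculus in `L²(Ω)`. -/
theorem HasWeakTimeDeriv.inner_sub_eq (hΩo : IsOpen Ω) (hT : 0 < T)
    {v v' : EuclideanSpace ℝ (Fin d) × ℝ → ℝ} (h : HasWeakTimeDeriv Ω T v v')
    (hv : MemLp v 2 (volume.restrict (Q Ω T))) {V V' : ℝ → Lp ℝ 2 (volume.restrict Ω)}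
    (hVc : ContinuousOn V (Icc 0 T))
    (hV : ∀ᵐ t ∂(volume.restrict (Ioc 0 T)), V t =ᵐ[volume.restrict Ω] fun x => v (x, t))
    (hV'm : MemLp V' 2 (volume.restrict (Ioc 0 T)))
    (hV' : ∀ᵐ t ∂(volume.restrict (Ioc 0 T)), V' t =ᵐ[volume.restrict Ω] fun x => v' (x, t))
    (φ : Lp ℝ 2 (volume.restrict Ω)) :
    ∀ t ∈ Icc 0 T, inner ℝ (V t - V 0) φ = ∫ r in Ioc 0 t, inner ℝ (V' r) φ := by
  have hV'i : IntegrableOn V' (Ioc 0 T) := hV'm.integrable (by norm_num)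
  have h1 := sub_eq_integral_of_weakDeriv hT (y := fun t => inner ℝ (V t) φ)
    (f := fun t => inner ℝ (V' t) φ) (hVc.inner continuousOn_const)
    (hV'i.inner_const φ) ?_
  · intro t ht
    rw [inner_sub_left]
    exact h1 t ht
  intro η hη1 hη2 hη3
  have hηc : Continuous η := hη1.continuous
  have hη'c : Continuous (deriv η) := hη1.continuous_deriv (by simp)
  have hi1 : IntegrableOn (fun t => η t • V' t) (Ioc 0 T) := by
    obtain ⟨K, hK⟩ := hη2.exists_bound_of_continuous hηc
    exact hV'i.bdd_smul K hηc.aestronglyMeasurable (Eventually.of_forall hK)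
  have hi2 : IntegrableOn (fun t => deriv η t • V t) (Ioc 0 T) :=
    ((hη'c.continuousOn.smul hVc).integrableOn_Icc).mono_set Ioc_subset_Icc_self
  -- Products ψ(x)η(t) are admissible in the weak formulation, so this element of L²(Ω) is
  -- orthogonal to every test function ψ. Afterwards it may be paired with a nonsmooth φ.
  have hZ : (∫ t in Ioc 0 T, η t • V' t) + ∫ t in Ioc 0 T, deriv η t • V t = 0 := by
    refine eq_zero_of_forall_test hΩo _ fun ψ hψ => ?_
    have hψL : MemLp ψ 2 (volume.restrict Ω) :=
      (hψ.1.continuous.memLp_of_hasCompactSupport hψ.2.1).restrict Ω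
    have hψe := hψL.coeFn_toLp
    set ψL := hψL.toLp ψ with hψL_def
    have h2 : ∀ f : Lp ℝ 2 (volume.restrict Ω), ∫ x in Ω, f x * ψ x = inner ℝ ψL f := by
      intro f
      rw [real_inner_comm, inner_L2_eq]
      exact integral_congr_ae (by filter_upwards [hψe] with x hx; rw [hx])
    rw [h2, inner_add_right, ← integral_inner hi1, ← integral_inner hi2]
    have hψη : ContDiff ℝ ∞ fun z : EuclideanSpace ℝ (Fin d) × ℝ => ψ z.1 * η z.2 :=
      (hψ.1.comp contDiff_fst).mul (hη1.comp contDiff_snd)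
    have hsub : Function.support (fun z : EuclideanSpace ℝ (Fin d) × ℝ => ψ z.1 * η z.2)
        ⊆ tsupport ψ ×ˢ tsupport η := fun z hz =>
      ⟨subset_tsupport _ (left_ne_zero_of_mul hz), subset_tsupport _ (right_ne_zero_of_mul hz)⟩
    have hcs : HasCompactSupport fun z : EuclideanSpace ℝ (Fin d) × ℝ => ψ z.1 * η z.2 :=
      HasCompactSupport.of_support_subset_isCompact (hψ.2.1.isCompact.prod hη2.isCompact) hsub
    have h3 := h.2 _ hψη hcs ((closure_minimal hsub
      ((isClosed_tsupport _).prod (isClosed_tsupport _))).trans (prod_mono hψ.2.2 hη3))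
    have hfd : ∀ z : EuclideanSpace ℝ (Fin d) × ℝ,
        fderiv ℝ (fun z : EuclideanSpace ℝ (Fin d) × ℝ => ψ z.1 * η z.2) z (0, 1)
          = ψ z.1 * deriv η z.2 := by
      intro z
      have h4 : HasFDerivAt (fun z : EuclideanSpace ℝ (Fin d) × ℝ => ψ z.1)
          ((fderiv ℝ ψ z.1).comp (ContinuousLinearMap.fst ℝ _ ℝ)) z :=
        (hψ.differentiable z.1).hasFDerivAt.comp z hasFDerivAt_fst
      have h5 : HasFDerivAt (fun z : EuclideanSpace ℝ (Fin d) × ℝ => η z.2)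
          ((fderiv ℝ η z.2).comp (ContinuousLinearMap.snd ℝ _ ℝ)) z :=
        (hη1.differentiable (by simp) z.2).hasFDerivAt.comp z hasFDerivAt_snd
      refine (DFunLike.congr_fun (h4.mul h5).fderiv (0, 1)).trans ?_
      simp
    simp only [hfd] at h3
    rw [restrict_Q] at h3 hv
    have hv' := h.1
    rw [restrict_Q] at hv'
    have hζ1 : MemLp (fun z : EuclideanSpace ℝ (Fin d) × ℝ => ψ z.1 * η z.2) 2
        ((volume.restrict Ω).prod (volume.restrict (Ioc 0 T))) := by
      rw [← restrict_Q]
      exact (hψη.continuous.memLp_of_hasCompactSupport hcs).restrict _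
    have hcs2 : HasCompactSupport fun z : EuclideanSpace ℝ (Fin d) × ℝ => ψ z.1 * deriv η z.2 :=
      HasCompactSupport.of_support_subset_isCompact
        (hψ.2.1.isCompact.prod hη2.deriv.isCompact) fun z hz =>
      ⟨subset_tsupport _ (left_ne_zero_of_mul hz), subset_tsupport _ (right_ne_zero_of_mul hz)⟩
    have hζ2 : MemLp (fun z : EuclideanSpace ℝ (Fin d) × ℝ => ψ z.1 * deriv η z.2) 2
        ((volume.restrict Ω).prod (volume.restrict (Ioc 0 T))) := by
      rw [← restrict_Q]
      exact (((hψ.1.continuous.comp continuous_fst).mul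
        (hη'c.comp continuous_snd)).memLp_of_hasCompactSupport hcs2).restrict _
    rw [integral_prod_eq_inner hv hζ2 (Z := fun t => deriv η t • ψL) hV, integral_prod_eq_inner hv'
      hζ1 (Z := fun t => η t • ψL) hV'] at h3
    · simp only [inner_smul_right, real_inner_comm ψL] at h3 ⊢
      linarith
    · refine Eventually.of_forall fun t => ?_
      filter_upwards [Lp.coeFn_smul (η t) ψL, hψe] with x h6 h7
      rw [h6, Pi.smul_apply, h7, smul_eq_mul, mul_comm]
    · refine Eventually.of_forall fun t => ?_
      filter_upwards [Lp.coeFn_smul (deriv η t) ψL, hψe] with x h6 h7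
      rw [h6, Pi.smul_apply, h7, smul_eq_mul, mul_comm]
  have h2 : inner ℝ φ ((∫ t in Ioc 0 T, η t • V' t) + ∫ t in Ioc 0 T, deriv η t • V t) = 0 := by
    rw [hZ, inner_zero_right]
  rw [inner_add_right, ← integral_inner hi1, ← integral_inner hi2] at h2
  simp only [inner_smul_right, real_inner_comm φ] at h2 ⊢
  linarith

/-- The fundamental theorem of calculus for elements of `𝓦`. -/
theorem IsW.inner_sub_eq (hT : 0 < T) {w : EuclideanSpace ℝ (Fin d) × ℝ → ℝ} {W : ℝ → H10 Ω}
    {W' : ℝ → Hneg Ω} (h : IsW Ω T w W W') {c : ℝ → Lp ℝ 2 (volume.restrict Ω)}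
    (hc : ContinuousOn c (Icc 0 T))
    (hcW : ∀ᵐ t ∂(volume.restrict (Ioc 0 T)), c t = (W t : Pairs Ω).fst) (φ : H10 Ω) :
    ∀ t ∈ Icc 0 T, inner ℝ (c t - c 0) (φ : Pairs Ω).fst = ∫ r in Ioc 0 t, W' r φ := by
  have hi : IntegrableOn (fun t => W' t φ) (Ioc 0 T) :=
    integrable_dual_apply h.memLp' (memLp_const φ)
  have h1 := sub_eq_integral_of_weakDeriv hT (y := fun t => inner ℝ (c t) (φ : Pairs Ω).fst)
    (f := fun t => W' t φ) (hc.inner continuousOn_const) hi ?_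
  · intro t ht
    rw [inner_sub_left]
    exact h1 t ht
  intro η hη1 hη2 hη3
  rw [h.deriv_eq η hη1 hη2 hη3 φ]
  congr 1
  exact integral_congr_ae (by filter_upwards [hcW] with t ht; rw [ht])

theorem memLp_innerSL_comp {X : Type*} [NormedAddCommGroup X] [NormedSpace ℝ X]
    {H : Type*} [NormedAddCommGroup H] [InnerProductSpace ℝ H] (ι : X →L[ℝ] H)
    {α : Type*} [MeasurableSpace α] {μ : Measure α} {V : α → H} (hV : MemLp V 2 μ) :
    MemLp (fun a => (innerSL ℝ (V a)).comp ι) 2 μ :=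
  (((ContinuousLinearMap.compL ℝ X H ℝ).flip ι).comp (innerSL ℝ)).comp_memLp' hV

theorem memLp_innerSL_comp_sub {X : Type*} [NormedAddCommGroup X] [NormedSpace ℝ X]
    {H : Type*} [NormedAddCommGroup H] [InnerProductSpace ℝ H] (ι : X →L[ℝ] H)
    {α : Type*} [MeasurableSpace α] {μ : Measure α} {V : α → H} (hV : MemLp V 2 μ)
    {U : α → StrongDual ℝ X} (hU : MemLp U 2 μ) :
    MemLp (fun a => (innerSL ℝ (V a)).comp ι - U a) 2 μ :=
  MemLp.sub (E := StrongDual ℝ X) (memLp_innerSL_comp ι hV) hU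

end EPH

/-! ### Weak solutions as curves in L²(Ω), and chain-rule inequalities in time -/

namespace EPH

variable {d : ℕ} {Ω : Set (EuclideanSpace ℝ (Fin d))} {T : ℝ}

/-- The functions witnessing that `(S, p)` is a weak solution, together with the representatives
`c`, `r`, `V`, `V'` of `p`, `S - S₀`, `S + b(p)` and its time derivative as curves in `L²(Ω)`. -/
structure SolutionCurves (Ω : Set (EuclideanSpace ℝ (Fin d))) (T : ℝ) (b : ℝ → ℝ)
    (S₀ p₀ : EuclideanSpace ℝ (Fin d) → ℝ) (S p v' : EuclideanSpace ℝ (Fin d) × ℝ → ℝ)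
    (P R : ℝ → H10 Ω) (R' : ℝ → Hneg Ω) (c r V V' : ℝ → Lp ℝ 2 (volume.restrict Ω)) : Prop where
  memLp_S : MemLp S 2 (volume.restrict (Q Ω T))
  memLp_p : MemLp p 2 (volume.restrict (Q Ω T))
  memLp_v' : MemLp v' 2 (volume.restrict (Q Ω T))
  memLp_P : MemLp P 2 (volume.restrict (Ioc 0 T))
  memLp_R' : MemLp R' 2 (volume.restrict (Ioc 0 T))
  cont_c : ContinuousOn c (Icc 0 T)
  cont_V : ContinuousOn V (Icc 0 T)
  c_ae : ∀ᵐ t ∂(volume.restrict (Ioc 0 T)), c t =ᵐ[volume.restrict Ω] fun x => p (x, t)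
  P_ae : ∀ᵐ t ∂(volume.restrict (Ioc 0 T)),
    (P t : Pairs Ω).fst =ᵐ[volume.restrict Ω] fun x => p (x, t)
  V_ae : ∀ᵐ t ∂(volume.restrict (Ioc 0 T)),
    V t =ᵐ[volume.restrict Ω] fun x => S (x, t) + b (p (x, t))
  c_zero : c 0 =ᵐ[volume.restrict Ω] p₀
  V_zero : V 0 =ᵐ[volume.restrict Ω] fun x => S₀ x + b (p₀ x)
  V_eq : ∀ t, V t - V 0 =ᵐ[volume.restrict Ω]
    fun x => (r t - r 0) x + (b (c t x) - b (c 0 x))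
  memLp_V' : MemLp V' 2 (volume.restrict (Ioc 0 T))
  V'_ae : ∀ᵐ t ∂(volume.restrict (Ioc 0 T)), V' t =ᵐ[volume.restrict Ω] fun x => v' (x, t)
  inner_V : ∀ φ, ∀ t ∈ Icc 0 T, inner ℝ (V t - V 0) φ = ∫ s in Ioc 0 t, inner ℝ (V' s) φ
  inner_r : ∀ φ : H10 Ω, ∀ t ∈ Icc 0 T,
    inner ℝ (r t - r 0) (φ : Pairs Ω).fst = ∫ s in Ioc 0 t, R' s φ

theorem ScanningFunction.exists_lipschitz {pci pcd b : ℝ → ℝ} (hb : ScanningFunction pci pcd b) :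
    ∃ B : NNReal, 0 < B ∧ LipschitzWith B b := by
  obtain ⟨B, hB⟩ := hb.deriv_bdd
  refine ⟨Real.toNNReal (max B 1), Real.toNNReal_pos.2 (zero_lt_one.trans_le (le_max_right B 1)),
    lipschitzWith_of_nnnorm_deriv_le (hb.contDiff.differentiable one_ne_zero) fun q => ?_⟩
  rw [← NNReal.coe_le_coe, coe_nnnorm, Real.norm_of_nonneg hb.mono.deriv_nonneg,
    Real.coe_toNNReal _ (zero_le_one.trans (le_max_right B 1))]
  exact (hB q).trans (le_max_left _ _)

/-- The curve V is assembled as r + S₀ + b(c) from the continuous representatives of S − S₀ and p.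
Lipschitz continuity of b makes it continuous, and its initial value is read off from those of r and
c. -/
theorem exists_solutionCurves (hΩo : IsOpen Ω) [IsFiniteMeasure (volume.restrict Ω)] (hT : 0 < T)
    {pci pcd b : ℝ → ℝ} (hb : ScanningFunction pci pcd b)
    {S₀ p₀ : EuclideanSpace ℝ (Fin d) → ℝ} (hS₀ : MemLp S₀ 2 (volume.restrict Ω))
    {S p v' : EuclideanSpace ℝ (Fin d) × ℝ → ℝ} {P R : ℝ → H10 Ω} {P' R' : ℝ → Hneg Ω}
    (hP : IsW Ω T p P P') (hR : IsW Ω T (fun z => S z - S₀ z.1) R R')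
    (hP0 : HasInitial Ω T P p₀) (hR0 : HasInitial Ω T R 0)
    (hv : HasWeakTimeDeriv Ω T (fun z => S z + b (p z)) v') :
    ∃ c r V V' : ℝ → Lp ℝ 2 (volume.restrict Ω),
      SolutionCurves Ω T b S₀ p₀ S p v' P R R' c r V V' := by
  obtain ⟨c, hc1, hc2, hc3⟩ := hP0
  obtain ⟨r, hr1, hr2, hr3⟩ := hR0
  obtain ⟨B, -, hB⟩ := hb.exists_lipschitz
  have hv'1 := hv.1
  rw [restrict_Q] at hv'1
  obtain ⟨V', hV'1, hV'2⟩ := exists_L2_curve hv'1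
  have hfst : ∀ {W : ℝ → H10 Ω}, MemLp W 2 (volume.restrict (Ioc 0 T)) →
      MemLp (fun t => (W t : Pairs Ω).fst) 2 (volume.restrict (Ioc 0 T)) := fun hW =>
    ((WithLp.fstL 2 ℝ _ _).comp (H10 Ω).subtypeL).comp_memLp' hW
  have hpQ : MemLp p 2 (volume.restrict (Q Ω T)) := by
    have := hP.meas
    rw [restrict_Q] at this ⊢
    exact memLp_of_L2_curve this (hfst hP.memLp) hP.repr
  have hS₀Q : MemLp (fun z : EuclideanSpace ℝ (Fin d) × ℝ => S₀ z.1) 2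
      (volume.restrict (Q Ω T)) := by
    rw [restrict_Q]
    exact hS₀.comp_fst _
  have hSQ : MemLp S 2 (volume.restrict (Q Ω T)) := by
    have h1 : MemLp (fun z => S z - S₀ z.1) 2 (volume.restrict (Q Ω T)) := by
      have := hR.meas
      rw [restrict_Q] at this ⊢
      exact memLp_of_L2_curve this (hfst hR.memLp) hR.repr
    convert h1.add hS₀Q using 1
    ext z
    simp
  have hbp : MemLp (fun z => b (p z)) 2 (volume.restrict (Q Ω T)) :=
    hB.comp_memLp hb.zero hpQ
  let V : ℝ → Lp ℝ 2 (volume.restrict Ω) := fun t => r t + hS₀.toLp S₀ + hB.compLp hb.zero (c t)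
  have hVc : ContinuousOn V (Icc 0 T) := (hr1.add continuousOn_const).add
    ((hB.continuous_compLp hb.zero).comp_continuousOn hc1)
  have hVe : ∀ t, V t =ᵐ[volume.restrict Ω] fun x => r t x + S₀ x + b (c t x) := by
    intro t
    filter_upwards [Lp.coeFn_add (r t + hS₀.toLp S₀) (hB.compLp hb.zero (c t)),
      Lp.coeFn_add (r t) (hS₀.toLp S₀), hS₀.coeFn_toLp, hB.coeFn_compLp hb.zero (c t)]
      with x h1 h2 h3 h4
    rw [h1, Pi.add_apply, h2, Pi.add_apply, h3, h4]
    rfl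
  have hVae : ∀ᵐ t ∂(volume.restrict (Ioc 0 T)),
      V t =ᵐ[volume.restrict Ω] fun x => S (x, t) + b (p (x, t)) := by
    filter_upwards [hc2, hr2, hP.repr, hR.repr] with t h1 h2 h3 h4
    filter_upwards [hVe t, h3, h4] with x h5 h6 h7
    rw [h5, h1, h2, h6, h7]
    ring
  refine ⟨c, r, V, V', hSQ, hpQ, hv.1, hP.memLp, hR.memLp', hc1, hVc, ?_, hP.repr, hVae, hc3, ?_, ?_,
    hV'1, hV'2, hv.inner_sub_eq hΩo hT (hSQ.add hbp) hVc hVae hV'1 hV'2,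
    hR.inner_sub_eq hT hr1 hr2⟩
  · filter_upwards [hc2, hP.repr] with t h1 h2
    rw [h1]
    exact h2
  · filter_upwards [hVe 0, hr3, hc3] with x h1 h2 h3
    rw [h1, h2, h3]
    simp
  · intro t
    filter_upwards [hVe t, hVe 0, Lp.coeFn_sub (V t) (V 0), Lp.coeFn_sub (r t) (r 0)]
      with x h1 h2 h3 h4
    rw [h3, Pi.sub_apply, h1, h2, h4, Pi.sub_apply]
    ring

namespace SolutionCurves

variable {b : ℝ → ℝ} {S₀ p₀ : EuclideanSpace ℝ (Fin d) → ℝ}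
  {S p v' : EuclideanSpace ℝ (Fin d) × ℝ → ℝ} {P R : ℝ → H10 Ω} {R' : ℝ → Hneg Ω}
  {c r V V' : ℝ → Lp ℝ 2 (volume.restrict Ω)}

/-- Testing the time derivative of `v = S + b(p)` with a bounded monotone function `θ(v)`. -/
theorem sub_le_integral_monotone (h : SolutionCurves Ω T b S₀ p₀ S p v' P R R' c r V V')
    [IsFiniteMeasure (volume.restrict Ω)] (hT : 0 < T) (hbc : Continuous b)
    {θ : ℝ → ℝ} (hθ : Monotone θ) {K : ℝ} (hK : ∀ s, |θ s| ≤ K) (a m : ℝ)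
    (hm : ∀ᵐ t ∂(volume.restrict (Ioc 0 T)),
      m ≤ ∫ x in Ω, ∫ s in a..(S (x, t) + b (p (x, t))), θ s) :
    m - ∫ x in Ω, (∫ s in a..(S₀ x + b (p₀ x)), θ s)
      ≤ ∫ z in Q Ω T, v' z * θ (S z + b (p z)) := by
  have hK0 : 0 ≤ K := (abs_nonneg _).trans (hK 0)
  have hii : ∀ x y : ℝ, IntervalIntegrable θ volume x y := fun x y => hθ.intervalIntegrable
  have hΘc : Continuous fun y => ∫ s in a..y, θ s := intervalIntegral.continuous_primitive hii a
  have hΘb : ∀ y, |∫ s in a..y, θ s| ≤ K * |y - a| := fun y =>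
    intervalIntegral.norm_integral_le_of_norm_le_const (f := θ) fun s _ => hK s
  -- The primitive of a monotone function is convex with subgradient θ x at x, even where θ jumps.
  have hsub : ∀ x y : ℝ, (∫ s in a..x, θ s) - (∫ s in a..y, θ s) ≤ (x - y) * θ x := by
    intro x y
    rw [intervalIntegral.integral_interval_sub_left (hii _ _) (hii _ _)]
    rcases le_total y x with hxy | hxy
    · have := intervalIntegral.integral_mono_on (μ := volume) hxy (hii _ _) (g := fun _ => θ x)
        (by simp) fun s hs => hθ hs.2
      simpa using this
    · have := intervalIntegral.integral_mono_on (μ := volume) hxy (f := fun _ => θ x)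
        (by simp) (hii _ _) fun s hs => hθ hs.1
      rw [intervalIntegral.integral_symm]
      simp only [intervalIntegral.integral_const, smul_eq_mul] at this
      linarith
  have hθm : ∀ f : Lp ℝ 2 (volume.restrict Ω), MemLp (fun x => θ (f x)) 2 (volume.restrict Ω) :=
    fun f => MemLp.of_bound (hθ.measurable.comp_aemeasurable
      (Lp.aestronglyMeasurable f).aemeasurable).aestronglyMeasurable K
      (Eventually.of_forall fun x => hK _)
  have hΘi : ∀ f : Lp ℝ 2 (volume.restrict Ω),
      IntegrableOn (fun x => ∫ s in a..f x, θ s) Ω := by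
    intro f
    have h1 : IntegrableOn (fun x => K * |f x - a|) Ω :=
      ((((Lp.memLp f).integrable (by norm_num)).sub (integrable_const a)).abs).const_mul K
    exact h1.mono' (hΘc.comp_aestronglyMeasurable (Lp.aestronglyMeasurable f))
      (Eventually.of_forall fun x => hΘb _)
  have hvm : AEStronglyMeasurable (fun z => S z + b (p z)) (volume.restrict (Q Ω T)) :=
    h.memLp_S.1.add (hbc.comp_aestronglyMeasurable h.memLp_p.1)
  have hfin : IsFiniteMeasure (volume.restrict (Q Ω T)) := by rw [restrict_Q]; infer_instance
  have hθQ : MemLp (fun z => θ (S z + b (p z))) 2 (volume.restrict (Q Ω T)) :=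
    MemLp.of_bound (hθ.measurable.comp_aemeasurable hvm.aemeasurable).aestronglyMeasurable K
      (Eventually.of_forall fun x => hK _)
  have hv'Q := h.memLp_v'
  rw [restrict_Q] at hθQ hv'Q
  obtain ⟨W, hW1, hW2⟩ := exists_L2_curve hθQ
  rw [restrict_Q, integral_prod_eq_inner hv'Q hθQ h.V'_ae hW2]
  have key := sub_le_integral_of_subgradient (X := Lp ℝ 2 (volume.restrict Ω)) hT
    (ContinuousLinearMap.id ℝ _) h.cont_V
    (memLp_innerSL_comp (ContinuousLinearMap.id ℝ _) h.memLp_V') (fun φ t ht => h.inner_V φ t ht)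
    hW1 (q := fun t => (hθm (V t)).toLp _)
    (K := ↑(measureUnivNNReal (volume.restrict Ω)) ^ (2 : ENNReal).toReal⁻¹ * K) (fun t _ => ?_) ?_
    (J := fun t => ∫ x in Ω, ∫ s in a..V t x, θ s) (fun s _ t _ => ?_) (m := m) ?_
  · convert key using 2
    swap
    · rfl
    exact integral_congr_ae (by filter_upwards [h.V_zero] with x hx; rw [hx])
  · refine Lp.norm_le_of_ae_bound hK0 ?_
    filter_upwards [(hθm (V t)).coeFn_toLp] with x hx
    rw [hx]
    exact hK _
  · filter_upwards [hW2, h.V_ae] with t h1 h2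
    refine Lp.ext ?_
    filter_upwards [h1, h2, (hθm (V t)).coeFn_toLp] with x h3 h4 h5
    rw [h5, h4]
    exact h3
  · rw [← integral_sub (hΘi _) (hΘi _), inner_L2_eq]
    refine integral_mono_ae ((hΘi _).sub (hΘi _)) (integrable_L2_mul _ _) ?_
    filter_upwards [(hθm (V t)).coeFn_toLp, Lp.coeFn_sub (V t) (V s)] with x h1 h2
    rw [h1, h2]
    exact hsub _ _
  · filter_upwards [hm, h.V_ae] with t h1 h2
    refine h1.trans_eq (integral_congr_ae ?_)
    filter_upwards [h2] with x h3
    rw [h3]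

set_option maxHeartbeats 1600000 in
/-- Testing the time derivative of `b(p)` with a monotone function `β(p)`. -/
theorem neg_integral_le (h : SolutionCurves Ω T b S₀ p₀ S p v' P R R' c r V V')
    [IsFiniteMeasure (volume.restrict Ω)] (hT : 0 < T) {B : NNReal} (hB : LipschitzWith B b)
    (hb0 : b 0 = 0) {β : ℝ → ℝ} {K : NNReal} (hβ : LipschitzWith K β) (hβ0 : β 0 = 0)
    {W : ℝ → H10 Ω} (hW : MemLp W 2 (volume.restrict (Ioc 0 T)))
    (hWβ : ∀ᵐ t ∂(volume.restrict (Ioc 0 T)),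
      (W t : Pairs Ω).fst =ᵐ[volume.restrict Ω] fun x => β (p (x, t)))
    {G : ℝ → ℝ} (hG : Continuous G) (hG0 : ∀ q, 0 ≤ G q) {a : ℝ} (ha : G a = 0)
    (hsub : ∀ q q', G q - G q' ≤ (b q - b q') * β q) :
    -∫ x in Ω, G (p₀ x) ≤ (∫ z in Q Ω T, v' z * β (p z)) - ∫ t in Ioc 0 T, R' t (W t) := by
  obtain ⟨ι, hι⟩ : ∃ ι : H10 Ω →L[ℝ] Lp ℝ 2 (volume.restrict Ω),
      ∀ w : H10 Ω, ι w = (w : Pairs Ω).fst :=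
    ⟨(WithLp.fstL 2 ℝ _ _).comp (H10 Ω).subtypeL, fun _ => rfl⟩
  obtain ⟨M, hM⟩ := isCompact_Icc.exists_bound_of_continuousOn h.cont_c
  have hGi : ∀ f : Lp ℝ 2 (volume.restrict Ω), IntegrableOn (fun x => G (f x)) Ω := by
    intro f
    have h1 : MemLp (fun x => b (f x) - b a) 2 (volume.restrict Ω) :=
      (hB.comp_memLp hb0 (Lp.memLp f)).sub (memLp_const _)
    refine (h1.integrable_mul (hβ.comp_memLp hβ0 (Lp.memLp f))).mono'
      (hG.comp_aestronglyMeasurable (Lp.aestronglyMeasurable f)) (Eventually.of_forall fun x => ?_)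
    rw [Real.norm_of_nonneg (hG0 _)]
    have := hsub (f x) a
    rw [ha, sub_zero] at this
    exact this
  -- ∂ₜb(p) = ∂ₜv − ∂ₜS is available only as a functional on H¹₀, so the abstract inequality is used
  -- with X = H¹₀ and y = b(c).
  have hU := memLp_innerSL_comp_sub ι h.memLp_V' h.memLp_R'
  have hR'i := integrable_dual_apply h.memLp_R' hW
  have hV'i := integrable_dual_apply (memLp_innerSL_comp ι h.memLp_V') hW
  have key := sub_le_integral_of_subgradient hT ι
    (y := fun t => hB.compLp hb0 (c t)) ((hB.continuous_compLp hb0).comp_continuousOn h.cont_c)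
    hU (fun φ t ht => ?_) hW (q := fun t => hβ.compLp hβ0 (c t)) (K := K * M) (fun t ht => ?_) ?_
    (J := fun t => ∫ x in Ω, G (c t x)) (fun s _ t _ => ?_) (m := 0)
    (Eventually.of_forall fun t => integral_nonneg fun x => hG0 _)
  · have h1 : ∫ x in Ω, G (c 0 x) = ∫ x in Ω, G (p₀ x) :=
      integral_congr_ae (by filter_upwards [h.c_zero] with x hx; rw [hx])
    have h2 : ∫ z in Q Ω T, v' z * β (p z) = ∫ t in Ioc 0 T, inner ℝ (V' t) (ι (W t)) := by
      have h3 := h.memLp_v'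
      have h4 := hβ.comp_memLp hβ0 h.memLp_p
      rw [restrict_Q] at h3 h4 ⊢
      exact integral_prod_eq_inner h3 h4 h.V'_ae (by
        filter_upwards [hWβ] with t ht
        rw [hι]
        exact ht)
    have h5 : (∫ t in Ioc 0 T, inner ℝ (V' t) (ι (W t))) - ∫ t in Ioc 0 T, R' t (W t)
        = ∫ t in Ioc 0 T, ((innerSL ℝ (V' t)).comp ι - R' t) (W t) :=
      (integral_sub hV'i hR'i).symm
    rw [h2, h5, ← h1, ← zero_sub]
    exact key
  · have h1 : IntegrableOn (fun s => inner ℝ (V' s) (ι φ)) (Ioc 0 t) :=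
      ((h.memLp_V'.integrable (by norm_num)).mono_measure
        (Measure.restrict_mono (Ioc_subset_Ioc_right ht.2) le_rfl)).inner_const _
    have h2 : IntegrableOn (fun s => R' s φ) (Ioc 0 t) :=
      (integrable_dual_apply h.memLp_R' (memLp_const φ)).mono_measure
        (Measure.restrict_mono (Ioc_subset_Ioc_right ht.2) le_rfl)
    have h3 : ∫ s in Ioc 0 t, ((innerSL ℝ (V' s)).comp ι - R' s) φ
        = (∫ s in Ioc 0 t, inner ℝ (V' s) (ι φ)) - ∫ s in Ioc 0 t, R' s φ := by
      rw [← integral_sub h1 h2]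
      exact integral_congr_ae (Eventually.of_forall fun s => rfl)
    have h9 : hB.compLp hb0 (c t) - hB.compLp hb0 (c 0) = (V t - V 0) - (r t - r 0) := by
      refine Lp.ext ?_
      filter_upwards [h.V_eq t, Lp.coeFn_sub (V t - V 0) (r t - r 0),
        Lp.coeFn_sub (hB.compLp hb0 (c t)) (hB.compLp hb0 (c 0)), hB.coeFn_compLp hb0 (c t),
        hB.coeFn_compLp hb0 (c 0)] with x h4 h5 h6 h7 h8
      rw [h5, h6, Pi.sub_apply, Pi.sub_apply, h4, h7, h8]
      simp only [Function.comp_apply]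
      ring
    have h10 := h.inner_r φ t ht
    rw [← hι] at h10
    have h11 : inner ℝ ((V t - V 0) - (r t - r 0)) (ι φ)
        = (∫ s in Ioc 0 t, inner ℝ (V' s) (ι φ)) - ∫ s in Ioc 0 t, R' s φ := by
      rw [inner_sub_left, h.inner_V (ι φ) t ht, h10]
    exact (congrArg (fun z => inner ℝ z (ι φ)) h9).trans (h11.trans h3.symm)
  · exact (hβ.norm_compLp_le hβ0 _).trans (by gcongr; exact hM t ht)
  · filter_upwards [hWβ, h.c_ae] with t h1 h2
    rw [hι]
    refine Lp.ext ?_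
    filter_upwards [h1, h2, hβ.coeFn_compLp hβ0 (c t)] with x h3 h4 h5
    rw [h5, Function.comp_apply, h4]
    exact h3
  · rw [← integral_sub (hGi _) (hGi _), inner_L2_eq]
    refine integral_mono_ae ((hGi _).sub (hGi _)) (integrable_L2_mul _ _) ?_
    filter_upwards [hβ.coeFn_compLp hβ0 (c t), hB.coeFn_compLp hb0 (c t),
      hB.coeFn_compLp hb0 (c s), Lp.coeFn_sub (hB.compLp hb0 (c t)) (hB.compLp hb0 (c s))]
      with x h1 h2 h3 h4
    rw [h1, h4, Pi.sub_apply, h2, h3]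
    exact hsub _ _

end SolutionCurves

end EPH

namespace EPH

/-! ### The regularised hysteresis relation -/

theorem posPart_nonneg (x : ℝ) : 0 ≤ posPart x := le_max_right _ _

theorem posPart_of_nonneg {x : ℝ} (hx : 0 ≤ x) : posPart x = x := max_eq_left hx

theorem posPart_of_nonpos {x : ℝ} (hx : x ≤ 0) : posPart x = 0 := max_eq_right hx

theorem continuous_posPart : Continuous posPart := continuous_id.max continuous_const

theorem posPart_le_abs (x : ℝ) : posPart x ≤ |x| := max_le (le_abs_self x) (abs_nonneg x)

/-- As the curves are ordered, at most one of the two positive parts is nonzero. -/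
theorem Phi_eq {pci pcd b : ℝ → ℝ} (hpc : CapillaryCurves pci pcd)
    (hb : ScanningFunction pci pcd b) (τ u v : ℝ) :
    Phi pci pcd b τ u v = 1 / τ * (posPart (rho pci b v - u) - posPart (u - rho pcd b v)) := by
  have h := rho_i_le_rho_d hpc hb v
  unfold Phi
  split_ifs with h1 h2
  · rw [posPart_of_nonpos (by linarith), posPart_of_nonneg (by linarith : 0 ≤ u - rho pcd b v)]
    ring
  · rw [posPart_of_nonneg (by linarith), posPart_of_nonpos (by linarith : u - rho pcd b v ≤ 0)]
    ring
  · rw [posPart_of_nonpos (by linarith), posPart_of_nonpos (by linarith : u - rho pcd b v ≤ 0)]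
    ring

/-- The pressure on the curve `u = ρ(v)`, truncated at the level `M`. -/
noncomputable def curveP (pc b : ℝ → ℝ) (M v : ℝ) : ℝ :=
  Function.invFunOn b (Ici (pc 1)) (min (b M) (rho pc b v))

namespace IsScanCurve

variable {pc b : ℝ → ℝ}

theorem exists_b_eq (h : IsScanCurve pc b) {M u : ℝ} (hM : pc 1 ≤ M) (hu : u ∈ Icc (Um pc b) (b M)) :
    ∃ q ∈ Ici (pc 1), b q = u := by
  obtain ⟨q, hq, hqu⟩ := intermediate_value_Icc hM h.contDiff_b.continuous.continuousOn hu
  exact ⟨q, hq.1, hqu⟩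

theorem exists_b_eq_min (h : IsScanCurve pc b) {M : ℝ} (hM : pc 1 ≤ M) (v : ℝ) :
    ∃ q ∈ Ici (pc 1), b q = min (b M) (rho pc b v) :=
  h.exists_b_eq hM ⟨le_min (h.mono hM) (h.le_rho v), min_le_left _ _⟩

theorem b_curveP (h : IsScanCurve pc b) {M : ℝ} (hM : pc 1 ≤ M) (v : ℝ) :
    b (curveP pc b M v) = min (b M) (rho pc b v) := Function.invFunOn_eq (h.exists_b_eq_min hM v)

theorem le_curveP (h : IsScanCurve pc b) {M : ℝ} (hM : pc 1 ≤ M) (v : ℝ) :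
    pc 1 ≤ curveP pc b M v := Function.invFunOn_mem (h.exists_b_eq_min hM v)

theorem curveP_le_of_rho_le (h : IsScanCurve pc b) {M : ℝ} (hM : pc 1 ≤ M) {v q : ℝ}
    (hq : pc 1 ≤ q) (hv : min (b M) (rho pc b v) ≤ b q) : curveP pc b M v ≤ q := by
  rw [← h.b_curveP hM] at hv
  exact (h.b_strictMono.le_iff_le (h.le_curveP hM v) hq).1 hv

theorem curveP_le (h : IsScanCurve pc b) {M : ℝ} (hM : pc 1 ≤ M) (v : ℝ) : curveP pc b M v ≤ M :=
  h.curveP_le_of_rho_le hM hM (min_le_left _ _)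

theorem curveP_antitone (h : IsScanCurve pc b) {M : ℝ} (hM : pc 1 ≤ M) :
    Antitone (curveP pc b M) := fun v _ hvw =>
  h.curveP_le_of_rho_le hM (h.le_curveP hM v)
    ((min_le_min le_rfl (h.rho_antitone hvw)).trans_eq (h.b_curveP hM v).symm)

theorem rho_lt_UM (h : IsScanCurve pc b) {v : ℝ} (hv : UM b < v) : rho pc b v < UM b := by
  rcases le_or_gt (VM pc b) v with h1 | h1
  · rw [h.rho_of_ge h1]
    exact h.Um_lt_UM
  · obtain ⟨s, -, -, h2⟩ := h.exists_of_UM_lt hv h1.le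
    rw [h2]
    exact h.b_lt_UM _

end IsScanCurve

/-- Where the truncation is inactive, b(`curveP`) = ρ^(i)(v) and the Lipschitz bound controls both
squares. Where it is active, the term with D keeps its sign, but below the imbibition curve only an
error B·I|p| remains, which is removed later by M → ∞. -/
theorem dissipation_le {pci pcd b : ℝ → ℝ} (hpc : CapillaryCurves pci pcd)
    (hb : ScanningFunction pci pcd b) {B : NNReal} (hB : LipschitzWith B b)
    {M : ℝ} (hM : pci 1 ≤ M) (hM0 : 0 ≤ M) (p v : ℝ) :
    {v | rho pci b v ≤ b M}.indicator
        (fun v => posPart (b p - rho pcd b v) ^ 2 + posPart (rho pci b v - b p) ^ 2) v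
      - {v | rho pci b v ≤ b M}ᶜ.indicator
        (fun v => B * (posPart (rho pci b v - b p) * |p|)) v
      ≤ -(B * ((posPart (rho pci b v - b p) - posPart (b p - rho pcd b v))
        * (p - curveP pci b M v))) := by
  have hi := hpc.isScanCurve_i hb
  have hid := rho_i_le_rho_d hpc hb v
  have hw := hi.b_curveP hM v
  have hB0 : (0 : ℝ) ≤ B := B.2
  have hLip : ∀ x y : ℝ, y ≤ x → b x - b y ≤ B * (x - y) := by
    intro x y hxy
    have := hB.dist_le_mul x y
    rw [Real.dist_eq, Real.dist_eq, abs_of_nonneg (by linarith : 0 ≤ x - y)] at this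
    exact (le_abs_self _).trans this
  generalize hw' : curveP pci b M v = w at hw ⊢
  rcases le_or_gt (b p) (rho pcd b v) with h1 | h1
  · rw [posPart_of_nonpos (by linarith : b p - rho pcd b v ≤ 0)]
    rcases le_or_gt (rho pci b v) (b p) with h2 | h2
    · simp only [indicator, posPart_of_nonpos (by linarith : rho pci b v - b p ≤ 0),
        posPart_of_nonpos (by linarith : b p - rho pcd b v ≤ 0)]
      simp
    · have hI := posPart_of_nonneg (by linarith : 0 ≤ rho pci b v - b p)
      have hI0 : 0 < rho pci b v - b p := by linarith
      by_cases h3 : rho pci b v ≤ b M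
      · rw [indicator_of_mem (by exact h3), indicator_of_notMem (by simpa using h3)]
        rw [posPart_of_nonpos (by linarith : b p - rho pcd b v ≤ 0), hI]
        rw [min_eq_right h3] at hw
        have h4 : p ≤ w := by
          by_contra h5
          linarith [hi.mono (not_le.1 h5).le]
        have h5 := hLip w p h4
        rw [hw] at h5
        nlinarith
      · rw [indicator_of_notMem (by exact h3), indicator_of_mem (by exact h3)]
        rw [hI]
        rw [min_eq_left (not_le.1 h3).le] at hw
        -- The truncated pressure is M itself, and M ≥ 0 gives p − M ≤ |p|.
        have h4 : w = M := hi.b_strictMono.injOn (hw' ▸ hi.le_curveP hM v) hM hw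
        rw [h4]
        have h5 : -(rho pci b v - b p) * |p| ≤ -((rho pci b v - b p) * (p - M)) := by
          nlinarith [le_abs_self p]
        nlinarith
  · have hD := posPart_of_nonneg (by linarith : 0 ≤ b p - rho pcd b v)
    have hI := posPart_of_nonpos (by linarith : rho pci b v - b p ≤ 0)
    have h4 : w ≤ p := by
      by_contra h5
      have := hi.mono (not_le.1 h5).le
      rw [hw] at this
      linarith [min_le_right (b M) (rho pci b v)]
    have h5 := hLip p w h4
    rw [hw] at h5
    have h6 := min_le_right (b M) (rho pci b v)
    have h7 : (b p - rho pcd b v) ^ 2 ≤ B * ((b p - rho pcd b v) * (p - w)) := by nlinarith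
    by_cases h3 : rho pci b v ≤ b M
    · rw [indicator_of_mem (by exact h3), indicator_of_notMem (by simpa using h3), hI, hD]
      nlinarith
    · rw [indicator_of_notMem (by exact h3), indicator_of_mem (by exact h3), hI, hD]
      nlinarith [sq_nonneg (b p - rho pcd b v)]

/-- The energy density `∫ β b'` associated with testing `∂ₜ b(p)` with `β(p)`. -/
noncomputable def energy (b β : ℝ → ℝ) (a q : ℝ) : ℝ := ∫ s in a..q, β s * deriv b s

section Energy

variable {b β : ℝ → ℝ}

theorem intervalIntegrable_energy (hb : ContDiff ℝ 1 b) (hβ : Continuous β) (x y : ℝ) :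
    IntervalIntegrable (fun s => β s * deriv b s) volume x y :=
  (hβ.mul (hb.continuous_deriv le_rfl)).intervalIntegrable x y

theorem continuous_energy (hb : ContDiff ℝ 1 b) (hβ : Continuous β) (a : ℝ) :
    Continuous (energy b β a) :=
  intervalIntegral.continuous_primitive (fun x y => intervalIntegrable_energy hb hβ x y) a

/-- Compare β s with β q under the nonnegative weight b'. The energy thus behaves as a convex
function of b(p) with subgradient β(p), without b being invertible. -/
theorem energy_sub_le (hb : ContDiff ℝ 1 b) (hbm : Monotone b) (hβ : Continuous β)
    (hβm : Monotone β) (a q q' : ℝ) :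
    energy b β a q - energy b β a q' ≤ (b q - b q') * β q := by
  have h1 : ∀ x y : ℝ, ∫ s in x..y, deriv b s = b y - b x := fun x y =>
    intervalIntegral.integral_deriv_eq_sub
      (fun s _ => hb.differentiable one_ne_zero s)
      ((hb.continuous_deriv le_rfl).intervalIntegrable x y)
  have h2 : ∀ x y : ℝ, IntervalIntegrable (fun s => β q * deriv b s) volume x y := fun x y =>
    (continuous_const.mul (hb.continuous_deriv le_rfl)).intervalIntegrable x y
  have hb' : ∀ s, 0 ≤ deriv b s := fun s => hbm.deriv_nonneg
  unfold energy
  rw [intervalIntegral.integral_interval_sub_left (intervalIntegrable_energy hb hβ _ _)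
    (intervalIntegrable_energy hb hβ _ _)]
  rcases le_total q' q with h | h
  · have h3 := intervalIntegral.integral_mono_on (μ := volume) h
      (intervalIntegrable_energy hb hβ q' q) (h2 q' q)
      fun s hs => mul_le_mul_of_nonneg_right (hβm hs.2) (hb' s)
    rw [intervalIntegral.integral_const_mul, h1] at h3
    linarith
  · have h3 := intervalIntegral.integral_mono_on (μ := volume) h (h2 q q')
      (intervalIntegrable_energy hb hβ q q')
      fun s hs => mul_le_mul_of_nonneg_right (hβm hs.1) (hb' s)
    rw [intervalIntegral.integral_const_mul, h1] at h3
    rw [intervalIntegral.integral_symm]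
    linarith

theorem energy_self (a : ℝ) : energy b β a a = 0 := intervalIntegral.integral_same

theorem energy_nonneg (hb : ContDiff ℝ 1 b) (hbm : Monotone b) (hβ : Continuous β)
    (hβm : Monotone β) {a : ℝ} (ha : β a = 0) (q : ℝ) : 0 ≤ energy b β a q := by
  have h := energy_sub_le hb hbm hβ hβm a a q
  rw [energy_self, ha] at h
  linarith

end Energy

end EPH

namespace EPH

/-! ### Estimates for weak solutions -/

variable {d : ℕ}

/-- If f is not integrable its integral is 0 by convention and C ≥ 0 suffices, so later uses need no
integrability check. -/
theorem integral_le_of_ae_le {α : Type*} [MeasurableSpace α] {μ : Measure α} [IsFiniteMeasure μ]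
    {f : α → ℝ} {C : ℝ} (hC : 0 ≤ C) (hf : ∀ᵐ x ∂μ, f x ≤ C) : ∫ x, f x ∂μ ≤ C * μ.real univ := by
  by_cases hi : Integrable f μ
  · have := integral_mono_ae hi (integrable_const C) hf
    rwa [integral_const, smul_eq_mul, mul_comm] at this
  · rw [integral_undef hi]
    exact mul_nonneg hC measureReal_nonneg

theorem le_integral_of_ae_le {α : Type*} [MeasurableSpace α] {μ : Measure α} [IsFiniteMeasure μ]
    {f : α → ℝ} {C : ℝ} (hC : 0 ≤ C) (hf : ∀ᵐ x ∂μ, -C ≤ f x) :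
    -(C * μ.real univ) ≤ ∫ x, f x ∂μ := by
  have h := integral_le_of_ae_le (f := fun x => -f x) hC (by
    filter_upwards [hf] with x hx
    linarith)
  rw [integral_neg] at h
  linarith

/-- A weak solution together with all witnesses. -/
structure SolutionData (Ω : Set (EuclideanSpace ℝ (Fin d))) (T : ℝ) (pci pcd b k : ℝ → ℝ)
    (g : EuclideanSpace ℝ (Fin d)) (S₀ p₀ : EuclideanSpace ℝ (Fin d) → ℝ) (τ : ℝ)
    (S p v' : EuclideanSpace ℝ (Fin d) × ℝ → ℝ) (P R : ℝ → H10 Ω) (R' : ℝ → Hneg Ω)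
    (c r V V' : ℝ → Lp ℝ 2 (volume.restrict Ω)) : Prop where
  curves : SolutionCurves Ω T b S₀ p₀ S p v' P R R' c r V V'
  S_mem : ∀ᵐ z ∂(volume.restrict (Q Ω T)), S z ∈ Icc (0 : ℝ) 1
  eq_flux : ∀ φ : ℝ → H10 Ω, MemLp φ 2 (volume.restrict (Ioc 0 T)) →
    ∫ t in Ioc 0 T, R' t (φ t) = ∫ t in Ioc 0 T, ∫ x in Ω,
      inner ℝ (k (S (x, t)) • ((P t : Pairs Ω).snd x - g)) ((φ t : Pairs Ω).snd x)
  eq_hyst : ∀ ξ : EuclideanSpace ℝ (Fin d) × ℝ → ℝ, MemLp ξ 2 (volume.restrict (Q Ω T)) →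
    ∫ z in Q Ω T, v' z * ξ z
      = ∫ z in Q Ω T, Phi pci pcd b τ (b (p z)) (S z + b (p z)) * ξ z

variable {Ω : Set (EuclideanSpace ℝ (Fin d))} {T : ℝ} {pci pcd b k : ℝ → ℝ}
  {g : EuclideanSpace ℝ (Fin d)} {S₀ p₀ : EuclideanSpace ℝ (Fin d) → ℝ} {τ : ℝ}
  {S p v' : EuclideanSpace ℝ (Fin d) × ℝ → ℝ} {P R : ℝ → H10 Ω} {R' : ℝ → Hneg Ω}
  {c r V V' : ℝ → Lp ℝ 2 (volume.restrict Ω)}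

theorem IsWeakSolution.exists_data (hΩo : IsOpen Ω) [IsFiniteMeasure (volume.restrict Ω)]
    (hT : 0 < T) (hb : ScanningFunction pci pcd b) (h₀ : InitialData Ω pci pcd S₀ p₀)
    (h : IsWeakSolution Ω T pci pcd b k g S₀ p₀ τ S p) :
    ∃ v' P R R' c r V V',
      SolutionData Ω T pci pcd b k g S₀ p₀ τ S p v' P R R' c r V V' := by
  obtain ⟨P, R, P', R', v', h1, h2, h3, h4, h5, h6, h7, h8⟩ := h
  obtain ⟨c, r, V, V', h9⟩ := exists_solutionCurves hΩo hT hb h₀.memH1.1 h1 h2 h4 h5 h6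
  exact ⟨v', P, R, R', c, r, V, V', h9, h3, h7, h8⟩

/-- The distance of `u = b(p)` above the drainage curve. -/
noncomputable def overD (pcd b : ℝ → ℝ) (S p : EuclideanSpace ℝ (Fin d) × ℝ → ℝ)
    (z : EuclideanSpace ℝ (Fin d) × ℝ) : ℝ := posPart (b (p z) - rho pcd b (S z + b (p z)))

/-- The distance of `u = b(p)` below the imbibition curve. -/
noncomputable def underI (pci b : ℝ → ℝ) (S p : EuclideanSpace ℝ (Fin d) × ℝ → ℝ)
    (z : EuclideanSpace ℝ (Fin d) × ℝ) : ℝ := posPart (rho pci b (S z + b (p z)) - b (p z))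

theorem memLp_overD {μ : Measure (EuclideanSpace ℝ (Fin d) × ℝ)} [IsFiniteMeasure μ]
    (hpc : CapillaryCurves pci pcd) (hb : ScanningFunction pci pcd b) (hS : MemLp S 2 μ)
    (hp : MemLp p 2 μ) : MemLp (overD pcd b S p) 2 μ ∧ MemLp (underI pci b S p) 2 μ := by
  obtain ⟨B, -, hB⟩ := hb.exists_lipschitz
  have hi := hpc.isScanCurve_i hb
  have hd := hpc.isScanCurve_d hb
  have hbp : MemLp (fun z => b (p z)) 2 μ := hB.comp_memLp hb.zero hp
  have hv : AEStronglyMeasurable (fun z => S z + b (p z)) μ := hS.1.add hbp.1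
  have key : ∀ pc : ℝ → ℝ, IsScanCurve pc b →
      MemLp (fun z => rho pc b (S z + b (p z))) 2 μ := fun pc h =>
    MemLp.of_bound (h.rho_continuous.comp_aestronglyMeasurable hv) (max |UM b| |Um pc b|)
      (Eventually.of_forall fun z => by
        rw [Real.norm_eq_abs, max_comm]
        exact abs_le_max_abs_abs (h.le_rho _) (h.rho_le _))
  constructor
  · refine (hbp.sub (key pcd hd)).mono
      (continuous_posPart.comp_aestronglyMeasurable (hbp.sub (key pcd hd)).1)
      (Eventually.of_forall fun z => ?_)
    rw [overD, Real.norm_of_nonneg (posPart_nonneg _)]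
    exact posPart_le_abs _
  · refine ((key pci hi).sub hbp).mono
      (continuous_posPart.comp_aestronglyMeasurable ((key pci hi).sub hbp).1)
      (Eventually.of_forall fun z => ?_)
    rw [underI, Real.norm_of_nonneg (posPart_nonneg _)]
    exact posPart_le_abs _

/-- Since S₀ ≥ ε, the initial v lies to the right of the imbibition point with saturation min ε 1.
That point is the base of the entropy. -/
theorem InitialData.exists_lower (hpc : CapillaryCurves pci pcd) (hb : ScanningFunction pci pcd b)
    (h₀ : InitialData Ω pci pcd S₀ p₀) :
    ∃ s ∈ Ioc (0 : ℝ) 1, ∀ᵐ x ∂(volume.restrict Ω),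
      s + b (pci s) ≤ S₀ x + b (p₀ x) ∧ pci 1 ≤ p₀ x ∧ S₀ x ≤ 1 := by
  have hi := hpc.isScanCurve_i hb
  obtain ⟨ε, hε, h⟩ := h₀.bounds
  have hs : min ε 1 ∈ Ioc (0 : ℝ) 1 := ⟨lt_min hε one_pos, min_le_right _ _⟩
  refine ⟨min ε 1, hs, ?_⟩
  filter_upwards [h, h₀.between] with x h1 h2
  have h3 : S₀ x ∈ Ioc (0 : ℝ) 1 := ⟨hε.trans_le h1.1, by linarith⟩
  have h4 := hi.add_strictMono.monotoneOn hs h3 ((min_le_left _ _).trans h1.1)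
  exact ⟨by linarith [hb.mono h2.1], (hi.pc_one_le h3).trans h2.1, h3.2⟩

namespace SolutionData

/-- Both sides are square integrable, so their difference is an admissible test function and the
integral of its square vanishes. -/
theorem v'_ae (h : SolutionData Ω T pci pcd b k g S₀ p₀ τ S p v' P R R' c r V V')
    [IsFiniteMeasure (volume.restrict Ω)] (hpc : CapillaryCurves pci pcd)
    (hb : ScanningFunction pci pcd b) :
    ∀ᵐ z ∂(volume.restrict (Q Ω T)),
      v' z = 1 / τ * (underI pci b S p z - overD pcd b S p z) := by
  have hfin : IsFiniteMeasure (volume.restrict (Q Ω T)) := by rw [restrict_Q]; infer_instance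
  obtain ⟨hD, hI⟩ := memLp_overD hpc hb h.curves.memLp_S h.curves.memLp_p
  have hΦ : MemLp (fun z => 1 / τ * (underI pci b S p z - overD pcd b S p z)) 2
      (volume.restrict (Q Ω T)) := (hI.sub hD).const_mul _
  have hξ := h.curves.memLp_v'.sub hΦ
  have h1 := h.eq_hyst _ hξ
  simp only [Phi_eq hpc hb] at h1
  have h2 : ∫ z in Q Ω T, (v' z - 1 / τ * (underI pci b S p z - overD pcd b S p z)) ^ 2 = 0 := by
    have h3 := integral_sub (h.curves.memLp_v'.integrable_mul hξ) (hΦ.integrable_mul hξ)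
    have h4 : (∫ z in Q Ω T, (v' * (v' - fun z => 1 / τ * (underI pci b S p z
        - overD pcd b S p z))) z) - ∫ z in Q Ω T, ((fun z => 1 / τ * (underI pci b S p z
        - overD pcd b S p z)) * (v' - fun z => 1 / τ * (underI pci b S p z
        - overD pcd b S p z))) z = 0 := sub_eq_zero.2 h1
    rw [h4] at h3
    rw [← h3]
    refine integral_congr_ae (Eventually.of_forall fun z => ?_)
    simp only [Pi.mul_apply, Pi.sub_apply]
    ring
  have h5 : IntegrableOn (fun z => (v' z - 1 / τ * (underI pci b S p z - overD pcd b S p z)) ^ 2)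
      (Q Ω T) := hξ.integrable_sq
  rw [integral_eq_zero_iff_of_nonneg (fun z => sq_nonneg _) h5] at h2
  filter_upwards [h2] with z hz
  exact sub_eq_zero.1 (pow_eq_zero_iff two_ne_zero |>.1 hz)

/-- Test with θ(v), where θ is −1 on v ≤ U_M and 0 beyond. Its primitive is nonnegative and vanishes
on the initial data, so ∫∂ₜv θ(v) ≥ 0. Yet on {v ≤ U_M} both ρ equal U_M > b(p), so ∂ₜv > 0 and the
integrand is negative; hence this set is null. -/
theorem UM_lt (h : SolutionData Ω T pci pcd b k g S₀ p₀ τ S p v' P R R' c r V V')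
    [IsFiniteMeasure (volume.restrict Ω)] (hT : 0 < T) (hτ : 0 < τ) (hpc : CapillaryCurves pci pcd)
    (hb : ScanningFunction pci pcd b) (h₀ : InitialData Ω pci pcd S₀ p₀) :
    ∀ᵐ z ∂(volume.restrict (Q Ω T)), UM b < S z + b (p z) := by
  have hi := hpc.isScanCurve_i hb
  have hfin : IsFiniteMeasure (volume.restrict (Q Ω T)) := by rw [restrict_Q]; infer_instance
  obtain ⟨s₀, hs₀, hini⟩ := h₀.exists_lower hpc hb
  let θ : ℝ → ℝ := fun v => if v ≤ UM b then -1 else 0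
  have hθ : Monotone θ := by
    intro x y hxy
    simp only [θ]
    split_ifs with h1 h2
    · exact le_rfl
    · norm_num
    · exact absurd (hxy.trans (by assumption)) h1
    · exact le_rfl
  have hθK : ∀ s, |θ s| ≤ 1 := fun s => by
    simp only [θ]
    split_ifs <;> simp
  have hΘ1 : ∀ y, UM b ≤ y → ∫ s in (UM b)..y, θ s = 0 := fun y hy => by
    rw [intervalIntegral.integral_of_le hy]
    exact setIntegral_eq_zero_of_forall_eq_zero fun s hs => by simp [θ, hs.1]
  have hΘ0 : ∀ y, 0 ≤ ∫ s in (UM b)..y, θ s := fun y => by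
    rcases le_total (UM b) y with hy | hy
    · exact (hΘ1 y hy).ge
    · rw [intervalIntegral.integral_symm, ← intervalIntegral.integral_neg]
      refine intervalIntegral.integral_nonneg hy fun s _ => ?_
      simp only [θ]
      split_ifs <;> simp
  have h1 := h.curves.sub_le_integral_monotone hT hb.contDiff.continuous hθ hθK (UM b) 0
    (Eventually.of_forall fun t => integral_nonneg fun x => hΘ0 _)
  have h2 : ∫ x in Ω, (∫ s in (UM b)..(S₀ x + b (p₀ x)), θ s) = 0 := by
    refine integral_eq_zero_of_ae ?_
    filter_upwards [hini] with x hx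
    exact hΘ1 _ ((hi.UM_lt_add hs₀).le.trans hx.1)
  rw [h2, sub_zero] at h1
  have hpt : ∀ᵐ z ∂(volume.restrict (Q Ω T)), v' z * θ (S z + b (p z)) ≤ 0 ∧
      (S z + b (p z) ≤ UM b → v' z * θ (S z + b (p z)) ≠ 0) := by
    filter_upwards [h.v'_ae hpc hb] with z hz
    by_cases hv : S z + b (p z) ≤ UM b
    · have h3 : 0 < v' z := by
        rw [hz, underI, overD, IsScanCurve.rho_of_le _ hv, IsScanCurve.rho_of_le _ hv,
          posPart_of_nonneg (by linarith [hi.b_lt_UM (p z)]),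
          posPart_of_nonpos (by linarith [hi.b_lt_UM (p z)])]
        have := hi.b_lt_UM (p z)
        have : 0 < UM b - b (p z) - 0 := by linarith
        positivity
      have h4 : θ (S z + b (p z)) = -1 := by simp [θ, hv]
      rw [h4]
      exact ⟨by linarith, fun _ => by linarith⟩
    · have h4 : θ (S z + b (p z)) = 0 := by simp [θ, hv]
      rw [h4, mul_zero]
      exact ⟨le_rfl, fun h5 => absurd h5 hv⟩
  have hint : IntegrableOn (fun z => v' z * θ (S z + b (p z))) (Q Ω T) := by
    refine (h.curves.memLp_v'.integrable (by norm_num)).mul_bdd (c := 1)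
      (hθ.measurable.comp_aemeasurable (h.curves.memLp_S.1.add
        (hb.contDiff.continuous.comp_aestronglyMeasurable
          h.curves.memLp_p.1)).aemeasurable).aestronglyMeasurable
      (Eventually.of_forall fun z => hθK _)
  have h3 : ∫ z in Q Ω T, -(v' z * θ (S z + b (p z))) = 0 := by
    refine le_antisymm ?_ (integral_nonneg_of_ae ?_)
    · rw [integral_neg]
      linarith
    · filter_upwards [hpt] with z hz
      simp only [Pi.zero_apply]
      linarith [hz.1]
  have hint' : IntegrableOn (fun z => -(v' z * θ (S z + b (p z)))) (Q Ω T) := hint.neg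
  rw [integral_eq_zero_iff_of_nonneg_ae ?_ hint'] at h3
  · filter_upwards [h3, hpt] with z h4 h5
    by_contra h6
    simp only [Pi.zero_apply, neg_eq_zero] at h4
    exact h5.2 (not_lt.1 h6) h4
  · filter_upwards [hpt] with z hz
    simp only [Pi.zero_apply]
    linarith [hz.1]

end SolutionData

end EPH

/-! ### Energy and entropy bounds, and the truncated dissipation inequality -/

namespace EPH

variable {d : ℕ} {Ω : Set (EuclideanSpace ℝ (Fin d))} {T : ℝ} {pci pcd b k : ℝ → ℝ}
  {g : EuclideanSpace ℝ (Fin d)} {S₀ p₀ : EuclideanSpace ℝ (Fin d) → ℝ} {τ : ℝ}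
  {S p v' : EuclideanSpace ℝ (Fin d) × ℝ → ℝ} {P R : ℝ → H10 Ω} {R' : ℝ → Hneg Ω}
  {c r V V' : ℝ → Lp ℝ 2 (volume.restrict Ω)}

theorem Permeability.lt_one (hk : Permeability k) : k 0 < k 1 :=
  (hk.mid (1 / 2) ⟨by norm_num, by norm_num⟩).1.trans (hk.mid (1 / 2) ⟨by norm_num, by norm_num⟩).2

theorem Permeability.mem_Icc (hk : Permeability k) (s : ℝ) : k s ∈ Icc 0 (k 1) := by
  have h01 := hk.lt_one
  have h0 := hk.nonneg
  rcases le_or_gt s 0 with h | h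
  · rw [hk.eq_left s h]
    exact ⟨h0, h01.le⟩
  · rcases le_or_gt 1 s with h' | h'
    · rw [hk.eq_right s h']
      exact ⟨h0.trans h01.le, le_rfl⟩
    · have := hk.mid s ⟨h, h'⟩
      exact ⟨h0.trans this.1.le, this.2.le⟩

theorem neg_le_inner_flux (hk : Permeability k) (s : ℝ) (g G : EuclideanSpace ℝ (Fin d)) :
    -(k 1 * ‖g‖ ^ 2) ≤ inner ℝ (k s • (G - g)) G := by
  obtain ⟨h1, h2⟩ := hk.mem_Icc s
  rw [real_inner_smul_left, inner_sub_left, real_inner_self_eq_norm_sq]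
  have h3 := real_inner_le_norm g G
  have h4 : -‖g‖ ^ 2 ≤ ‖G‖ ^ 2 - inner ℝ g G := by
    nlinarith [sq_nonneg (‖G‖ - ‖g‖), sq_nonneg ‖G‖, norm_nonneg g]
  nlinarith [sq_nonneg ‖g‖]

/-- Bounds for the entropy `-∫ curveP`, uniform in the truncation level. -/
theorem IsScanCurve.entropy_bounds {pc : ℝ → ℝ} (h : IsScanCurve pc b) {M s : ℝ} (hM : pc 1 ≤ M)
    (hs : s ∈ Ioc (0 : ℝ) 1) {y : ℝ} (hy1 : UM b < y) (hy2 : y ≤ 1 + UM b) :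
    -(|pc 1| + |pc s|) ≤ ∫ w in (s + b (pc s))..y, -curveP pc b M w ∧
    (s + b (pc s) ≤ y →
      ∫ w in (s + b (pc s))..y, -curveP pc b M w ≤ |pc 1| + |pc s|) := by
  have ha1 := h.UM_lt_add hs
  have ha2 := h.b_lt_UM (pc s)
  have hii : ∀ x y : ℝ, IntervalIntegrable (fun w => -curveP pc b M w) volume x y := fun x y =>
    (h.curveP_antitone hM).neg.intervalIntegrable
  have hup : ∀ x y : ℝ, x ≤ y → ∫ w in x..y, -curveP pc b M w ≤ (y - x) * (-pc 1) := by
    intro x y hxy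
    have := intervalIntegral.integral_mono_on (μ := volume) hxy (hii x y) (g := fun _ => -pc 1)
      (by simp) fun w _ => neg_le_neg (h.le_curveP hM w)
    simpa using this
  have hlow : ∀ y : ℝ, s + b (pc s) ≤ y →
      (y - (s + b (pc s))) * (-pc s) ≤ ∫ w in (s + b (pc s))..y, -curveP pc b M w := by
    intro y hy
    have := intervalIntegral.integral_mono_on (μ := volume) hy (f := fun _ => -pc s)
      (by simp) (hii _ _) fun w hw => neg_le_neg (h.curveP_le_of_rho_le hM (h.pc_one_le hs)
        ((min_le_right _ _).trans ((h.rho_antitone hw.1).trans_eq (h.rho_add_of_mem hs))))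
    simpa using this
  have hp1 := neg_abs_le (pc 1)
  have hp2 := neg_abs_le (pc s)
  have hp3 := le_abs_self (pc 1)
  have hp4 := le_abs_self (pc s)
  have hs2 := hs.2
  have key : ∀ t q : ℝ, 0 ≤ t → t ≤ 1 → |t * -q| ≤ |q| := fun t q h0 h1 => by
    rw [abs_mul, abs_neg, abs_of_nonneg h0]
    exact mul_le_of_le_one_left (abs_nonneg q) h1
  constructor
  -- Both y and the base point lie in (U_M, 1 + U_M], so lengths are at most 1. To the right of the
  -- base point `curveP` is at most `pc s`. To the left it may be as large as M, but there only its
  -- lower bound `pc 1` is needed, so M does not enter.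
  · rcases le_total (s + b (pc s)) y with hy | hy
    · have h1 := hlow y hy
      have h2 := key (y - (s + b (pc s))) (pc s) (by linarith) (by linarith)
      linarith [(abs_le.1 h2).1, abs_nonneg (pc 1)]
    · have h1 := hup _ _ hy
      have h2 := key (s + b (pc s) - y) (pc 1) (by linarith) (by linarith)
      rw [intervalIntegral.integral_symm]
      linarith [(abs_le.1 h2).2, abs_nonneg (pc s)]
  · intro hy
    have h1 := hup _ _ hy
    have h2 := key (y - (s + b (pc s))) (pc 1) (by linarith) (by linarith)
    linarith [(abs_le.1 h2).2, abs_nonneg (pc s)]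

namespace SolutionData

variable [IsFiniteMeasure (volume.restrict Ω)]

/-- The choice β = id makes p itself the test function in the flux equation, where the quadratic
term dominates gravity up to k(1)|g|². -/
theorem neg_le_integral_mul (h : SolutionData Ω T pci pcd b k g S₀ p₀ τ S p v' P R R' c r V V')
    (hT : 0 < T) (hk : Permeability k) (hb : ScanningFunction pci pcd b) :
    -((∫ x in Ω, energy b id 0 (p₀ x)) + k 1 * ‖g‖ ^ 2 * (volume.restrict Ω).real univ
        * (volume.restrict (Ioc 0 T)).real univ)
      ≤ ∫ z in Q Ω T, v' z * p z := by
  obtain ⟨B, -, hB⟩ := hb.exists_lipschitz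
  have h1 := h.curves.neg_integral_le hT hB hb.zero (β := id) (K := 1) LipschitzWith.id rfl
    h.curves.memLp_P h.curves.P_ae (continuous_energy hb.contDiff continuous_id 0)
    (energy_nonneg hb.contDiff hb.mono continuous_id monotone_id rfl)
    (energy_self 0) (energy_sub_le hb.contDiff hb.mono continuous_id monotone_id 0)
  have hC : 0 ≤ k 1 * ‖g‖ ^ 2 := mul_nonneg (hk.nonneg.trans hk.lt_one.le) (sq_nonneg _)
  have h2 := le_integral_of_ae_le (μ := volume.restrict (Ioc 0 T))
    (f := fun t => ∫ x in Ω,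
      inner ℝ (k (S (x, t)) • ((P t : Pairs Ω).snd x - g)) ((P t : Pairs Ω).snd x))
    (mul_nonneg hC measureReal_nonneg) (Eventually.of_forall fun t =>
      le_integral_of_ae_le (μ := volume.restrict Ω) hC
        (Eventually.of_forall fun x => neg_le_inner_flux hk _ _ _))
  rw [← h.eq_flux P h.curves.memLp_P] at h2
  simp only [id] at h1
  linarith

/-- The increasing function −`curveP` has a convex primitive, the entropy. It is bounded below at
later times, using U_M < v ≤ 1 + U_M, and above initially, by the same constant: hence the factor 2.
-/
theorem integral_mul_curveP_le
    (h : SolutionData Ω T pci pcd b k g S₀ p₀ τ S p v' P R R' c r V V')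
    (hT : 0 < T) (hτ : 0 < τ) (hpc : CapillaryCurves pci pcd) (hb : ScanningFunction pci pcd b)
    (h₀ : InitialData Ω pci pcd S₀ p₀) {s : ℝ} (hs : s ∈ Ioc (0 : ℝ) 1)
    (hini : ∀ᵐ x ∂(volume.restrict Ω),
      s + b (pci s) ≤ S₀ x + b (p₀ x) ∧ pci 1 ≤ p₀ x ∧ S₀ x ≤ 1)
    {M : ℝ} (hM : pci 1 ≤ M) :
    ∫ z in Q Ω T, v' z * curveP pci b M (S z + b (p z))
      ≤ 2 * ((|pci 1| + |pci s|) * (volume.restrict Ω).real univ) := by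
  have hi := hpc.isScanCurve_i hb
  have hA : 0 ≤ |pci 1| + |pci s| := by positivity
  have h1 := h.curves.sub_le_integral_monotone hT hb.contDiff.continuous
    (θ := fun w => -curveP pci b M w) (hi.curveP_antitone hM).neg (K := max |M| |pci 1|)
    (fun w => by
      rw [abs_neg, max_comm]
      exact abs_le_max_abs_abs (hi.le_curveP hM w) (hi.curveP_le hM w))
    (s + b (pci s)) (-((|pci 1| + |pci s|) * (volume.restrict Ω).real univ)) (by
      have h2 := h.UM_lt hT hτ hpc hb h₀
      have h3 := h.S_mem
      rw [restrict_Q] at h2 h3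
      filter_upwards [ae_prod_right h2, ae_prod_right h3] with t h4 h5
      refine le_integral_of_ae_le hA ?_
      filter_upwards [h4, h5] with x h6 h7
      exact (hi.entropy_bounds hM hs h6 (by linarith [h7.2, hi.b_lt_UM (p (x, t))])).1)
  have h2 : ∫ x in Ω, (∫ w in (s + b (pci s))..(S₀ x + b (p₀ x)), -curveP pci b M w)
      ≤ (|pci 1| + |pci s|) * (volume.restrict Ω).real univ := by
    refine integral_le_of_ae_le hA ?_
    filter_upwards [hini] with x hx
    exact (hi.entropy_bounds hM hs ((hi.UM_lt_add hs).trans_le hx.1)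
      (by linarith [hx.2.2, hi.b_lt_UM (p₀ x)])).2 hx.1
  simp only [mul_neg, integral_neg] at h1 h2
  linarith

/-- The dissipation inequality for a fixed truncation level. -/
theorem integral_truncated_le
    (h : SolutionData Ω T pci pcd b k g S₀ p₀ τ S p v' P R R' c r V V')
    (hT : 0 < T) (hτ : 0 < τ) (hpc : CapillaryCurves pci pcd) (hk : Permeability k)
    (hb : ScanningFunction pci pcd b)
    (h₀ : InitialData Ω pci pcd S₀ p₀) {s : ℝ} (hs : s ∈ Ioc (0 : ℝ) 1)
    (hini : ∀ᵐ x ∂(volume.restrict Ω),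
      s + b (pci s) ≤ S₀ x + b (p₀ x) ∧ pci 1 ≤ p₀ x ∧ S₀ x ≤ 1)
    (B : NNReal) {M : ℝ} (hM : pci 1 ≤ M)
    {F : EuclideanSpace ℝ (Fin d) × ℝ → ℝ} (hF : IntegrableOn F (Q Ω T))
    (hFle : ∀ z, F z ≤ -(B * ((underI pci b S p z - overD pcd b S p z)
      * (p z - curveP pci b M (S z + b (p z)))))) :
    ∫ z in Q Ω T, F z ≤ B * ((∫ x in Ω, energy b id 0 (p₀ x))
      + k 1 * ‖g‖ ^ 2 * (volume.restrict Ω).real univ * (volume.restrict (Ioc 0 T)).real univ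
      + 2 * ((|pci 1| + |pci s|) * (volume.restrict Ω).real univ)) * τ := by
  have hi := hpc.isScanCurve_i hb
  have hfin : IsFiniteMeasure (volume.restrict (Q Ω T)) := by rw [restrict_Q]; infer_instance
  have h1 := h.neg_le_integral_mul hT hk hb
  have h2 := h.integral_mul_curveP_le hT hτ hpc hb h₀ hs hini hM
  have hi1 : IntegrableOn (fun z => v' z * p z) (Q Ω T) :=
    h.curves.memLp_v'.integrable_mul h.curves.memLp_p
  have hi2 : IntegrableOn (fun z => v' z * curveP pci b M (S z + b (p z))) (Q Ω T) := by
    refine (h.curves.memLp_v'.integrable (by norm_num)).mul_bdd (c := max |M| |pci 1|)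
      ((hi.curveP_antitone hM).measurable.comp_aemeasurable (h.curves.memLp_S.1.add
        (hb.contDiff.continuous.comp_aestronglyMeasurable
          h.curves.memLp_p.1)).aemeasurable).aestronglyMeasurable
      (Eventually.of_forall fun z => ?_)
    rw [Real.norm_eq_abs, max_comm]
    exact abs_le_max_abs_abs (hi.le_curveP hM _) (hi.curveP_le hM _)
  have h3 : ∫ z in Q Ω T, F z ≤ ∫ z in Q Ω T,
      (B * τ) * (v' z * curveP pci b M (S z + b (p z)) - v' z * p z) := by
    refine integral_mono_ae hF ((hi2.sub hi1).const_mul _) ?_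
    filter_upwards [h.v'_ae hpc hb] with z hz
    refine (hFle z).trans_eq ?_
    have : underI pci b S p z - overD pcd b S p z = τ * v' z := by
      rw [hz]
      field_simp
    rw [this]
    ring
  rw [integral_const_mul, integral_sub hi2 hi1] at h3
  refine h3.trans ?_
  have hBτ : 0 ≤ (B : ℝ) * τ := mul_nonneg B.2 hτ.le
  nlinarith

end SolutionData

end EPH

/-! ### Removal of the truncation, and convergence as τ → 0 -/

namespace EPH

variable {d : ℕ} {Ω : Set (EuclideanSpace ℝ (Fin d))} {T : ℝ} {pci pcd b k : ℝ → ℝ}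
  {g : EuclideanSpace ℝ (Fin d)} {S₀ p₀ : EuclideanSpace ℝ (Fin d) → ℝ} {τ : ℝ}
  {S p v' : EuclideanSpace ℝ (Fin d) × ℝ → ℝ} {P R : ℝ → H10 Ω} {R' : ℝ → Hneg Ω}
  {c r V V' : ℝ → Lp ℝ 2 (volume.restrict Ω)}

/-- Removing the truncation in the dissipation inequality. -/
theorem SolutionData.integral_sq_le [IsFiniteMeasure (volume.restrict Ω)]
    (h : SolutionData Ω T pci pcd b k g S₀ p₀ τ S p v' P R R' c r V V')
    (hT : 0 < T) (hτ : 0 < τ) (hpc : CapillaryCurves pci pcd) (hk : Permeability k)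
    (hb : ScanningFunction pci pcd b)
    (h₀ : InitialData Ω pci pcd S₀ p₀) {s : ℝ} (hs : s ∈ Ioc (0 : ℝ) 1)
    (hini : ∀ᵐ x ∂(volume.restrict Ω),
      s + b (pci s) ≤ S₀ x + b (p₀ x) ∧ pci 1 ≤ p₀ x ∧ S₀ x ≤ 1)
    {B : NNReal} (hB : LipschitzWith B b) :
    ∫ z in Q Ω T, overD pcd b S p z ^ 2 + underI pci b S p z ^ 2
      ≤ B * ((∫ x in Ω, energy b id 0 (p₀ x))
      + k 1 * ‖g‖ ^ 2 * (volume.restrict Ω).real univ * (volume.restrict (Ioc 0 T)).real univ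
      + 2 * ((|pci 1| + |pci s|) * (volume.restrict Ω).real univ)) * τ := by
  have hi := hpc.isScanCurve_i hb
  have hfin : IsFiniteMeasure (volume.restrict (Q Ω T)) := by rw [restrict_Q]; infer_instance
  obtain ⟨hD, hI⟩ := memLp_overD hpc hb h.curves.memLp_S h.curves.memLp_p
  have hDI : IntegrableOn (fun z => overD pcd b S p z ^ 2 + underI pci b S p z ^ 2) (Q Ω T) :=
    hD.integrable_sq.add hI.integrable_sq
  have hIp : IntegrableOn (fun z => B * (underI pci b S p z * |p z|)) (Q Ω T) :=
    (hI.integrable_mul h.curves.memLp_p.abs).const_mul _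
  have hvm : AEMeasurable (fun z => rho pci b (S z + b (p z))) (volume.restrict (Q Ω T)) :=
    hi.rho_continuous.measurable.comp_aemeasurable (h.curves.memLp_S.1.add
      (hb.contDiff.continuous.comp_aestronglyMeasurable h.curves.memLp_p.1)).aemeasurable
  have hA : ∀ M : ℝ, NullMeasurableSet {z | rho pci b (S z + b (p z)) ≤ b M}
      (volume.restrict (Q Ω T)) := fun M => nullMeasurableSet_le hvm aemeasurable_const
  obtain ⟨F, hF⟩ : ∃ F : ℝ → EuclideanSpace ℝ (Fin d) × ℝ → ℝ, ∀ M z, F M z =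
      {z | rho pci b (S z + b (p z)) ≤ b M}.indicator
        (fun z => overD pcd b S p z ^ 2 + underI pci b S p z ^ 2) z
      - {z | rho pci b (S z + b (p z)) ≤ b M}ᶜ.indicator
        (fun z => B * (underI pci b S p z * |p z|)) z := ⟨_, fun _ _ => rfl⟩
  have hFi : ∀ M, IntegrableOn (F M) (Q Ω T) := fun M => by
    rw [show F M = _ from funext (hF M)]
    exact (hDI.indicator₀ (hA M)).sub (hIp.indicator₀ (hA M).compl)
  have hlim : Tendsto (fun M => ∫ z in Q Ω T, F M z) atTop
      (𝓝 (∫ z in Q Ω T, overD pcd b S p z ^ 2 + underI pci b S p z ^ 2)) := by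
    refine tendsto_integral_filter_of_dominated_convergence
      (fun z => (overD pcd b S p z ^ 2 + underI pci b S p z ^ 2)
        + B * (underI pci b S p z * |p z|))
      (Eventually.of_forall fun M => (hFi M).1) (Eventually.of_forall fun M =>
        Eventually.of_forall fun z => ?_) (Integrable.add hDI hIp) ?_
    · have h1 : 0 ≤ overD pcd b S p z ^ 2 + underI pci b S p z ^ 2 := by positivity
      have h2 : 0 ≤ B * (underI pci b S p z * |p z|) :=
        mul_nonneg B.2 (mul_nonneg (posPart_nonneg _) (abs_nonneg _))
      rw [hF, Real.norm_eq_abs]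
      by_cases hz : rho pci b (S z + b (p z)) ≤ b M
      · rw [indicator_of_mem (by exact hz), indicator_of_notMem (by simpa using hz), sub_zero,
          abs_of_nonneg h1]
        linarith
      · rw [indicator_of_notMem (by exact hz), indicator_of_mem (by exact hz), zero_sub, abs_neg,
          abs_of_nonneg h2]
        linarith
    -- As v > U_M, the value ρ^(i)(v) is below U_M = lim b, so at each such point the truncation is
    -- inactive for large M.
    · filter_upwards [h.UM_lt hT hτ hpc hb h₀] with z hz
      refine tendsto_const_nhds.congr' ?_
      filter_upwards [hi.tendsto_b.eventually (lt_mem_nhds (hi.rho_lt_UM hz))] with M hM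
      rw [hF, indicator_of_mem (by exact hM.le), indicator_of_notMem (by simpa using hM.le),
        sub_zero]
  refine le_of_tendsto hlim ?_
  filter_upwards [eventually_ge_atTop (pci 1), eventually_ge_atTop 0] with M hM hM0
  refine h.integral_truncated_le hT hτ hpc hk hb h₀ hs hini B hM (hFi M) fun z => ?_
  rw [hF]
  exact dissipation_le hpc hb hB hM hM0 (p z) (S z + b (p z))

theorem integral_Q_eq [IsFiniteMeasure (volume.restrict Ω)]
    {f : EuclideanSpace ℝ (Fin d) × ℝ → ℝ} (hf : IntegrableOn f (Q Ω T)) :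
    ∫ z in Q Ω T, f z = ∫ t in Ioc 0 T, ∫ x in Ω, f (x, t) := by
  rw [IntegrableOn, restrict_Q] at hf
  rw [restrict_Q, integral_prod_symm f hf]

/-- The distances of a weak solution to the hysteresis region are of order `τ^(1/2)`. -/
theorem exists_integral_sq_le (hΩo : IsOpen Ω) [IsFiniteMeasure (volume.restrict Ω)]
    (hT : 0 < T) (hpc : CapillaryCurves pci pcd) (hk : Permeability k)
    (hb : ScanningFunction pci pcd b) (h₀ : InitialData Ω pci pcd S₀ p₀) :
    ∃ C > 0, ∀ τ > 0, ∀ S p : EuclideanSpace ℝ (Fin d) × ℝ → ℝ,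
      IsWeakSolution Ω T pci pcd b k g S₀ p₀ τ S p →
      MemLp (overD pcd b S p) 2 (volume.restrict (Q Ω T)) ∧
      MemLp (underI pci b S p) 2 (volume.restrict (Q Ω T)) ∧
      (∫ z in Q Ω T, overD pcd b S p z ^ 2) + (∫ z in Q Ω T, underI pci b S p z ^ 2) < C * τ := by
  obtain ⟨s, hs, hini⟩ := h₀.exists_lower hpc hb
  obtain ⟨B, -, hB⟩ := hb.exists_lipschitz
  -- The absolute value plus one makes the constant positive and the inequality strict.
  refine ⟨|B * ((∫ x in Ω, energy b id 0 (p₀ x))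
      + k 1 * ‖g‖ ^ 2 * (volume.restrict Ω).real univ * (volume.restrict (Ioc 0 T)).real univ
      + 2 * ((|pci 1| + |pci s|) * (volume.restrict Ω).real univ))| + 1, by positivity,
    fun τ hτ S p hsol => ?_⟩
  have hfin : IsFiniteMeasure (volume.restrict (Q Ω T)) := by rw [restrict_Q]; infer_instance
  obtain ⟨v', P, R, R', c, r, V, V', h⟩ := hsol.exists_data hΩo hT hb h₀
  obtain ⟨hD, hI⟩ := memLp_overD hpc hb h.curves.memLp_S h.curves.memLp_p
  refine ⟨hD, hI, ?_⟩
  rw [← integral_add hD.integrable_sq hI.integrable_sq]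
  refine (h.integral_sq_le hT hτ hpc hk hb h₀ hs hini hB).trans_lt ?_
  refine mul_lt_mul_of_pos_right ?_ hτ
  exact (le_abs_self _).trans_lt (lt_add_one _)

/-- The distances to the hysteresis region tend to zero in measure as `τ → 0`. -/
theorem tendstoInMeasure_overD (hΩo : IsOpen Ω) [IsFiniteMeasure (volume.restrict Ω)]
    (hT : 0 < T) (hpc : CapillaryCurves pci pcd) (hk : Permeability k)
    (hb : ScanningFunction pci pcd b) (h₀ : InitialData Ω pci pcd S₀ p₀)
    {τ : ℕ → ℝ} {S p : ℕ → EuclideanSpace ℝ (Fin d) × ℝ → ℝ} (hτ : ∀ n, 0 < τ n)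
    (hτ0 : Tendsto τ atTop (𝓝 0))
    (h : ∀ n, IsWeakSolution Ω T pci pcd b k g S₀ p₀ (τ n) (S n) (p n)) :
    TendstoInMeasure (volume.restrict (Q Ω T)) (fun n => overD pcd b (S n) (p n)) atTop 0 ∧
    TendstoInMeasure (volume.restrict (Q Ω T)) (fun n => underI pci b (S n) (p n)) atTop 0 := by
  obtain ⟨C, hC, hest⟩ := exists_integral_sq_le (g := g) hΩo hT hpc hk hb h₀
  have key : ∀ f : ℕ → EuclideanSpace ℝ (Fin d) × ℝ → ℝ,
      (∀ n, MemLp (f n) 2 (volume.restrict (Q Ω T))) →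
      (∀ n, ∫ z in Q Ω T, f n z ^ 2 ≤ C * τ n) →
      TendstoInMeasure (volume.restrict (Q Ω T)) f atTop 0 := by
    intro f hf hle
    refine tendstoInMeasure_of_tendsto_eLpNorm two_ne_zero (fun n => (hf n).1)
      aestronglyMeasurable_zero ?_
    have h1 : ∀ n, eLpNorm (f n - 0) 2 (volume.restrict (Q Ω T))
        = ENNReal.ofReal ((∫ z in Q Ω T, f n z ^ 2) ^ (2 : ℝ)⁻¹) := fun n => by
      rw [sub_zero, (hf n).eLpNorm_eq_integral_rpow_norm two_ne_zero (by norm_num)]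
      simp
    simp only [h1]
    have h2 : Tendsto (fun n => ∫ z in Q Ω T, f n z ^ 2) atTop (𝓝 0) :=
      squeeze_zero (fun n => integral_nonneg fun z => sq_nonneg _) hle
        (by simpa using hτ0.const_mul C)
    have h3 := ENNReal.tendsto_ofReal (h2.rpow_const (p := (2 : ℝ)⁻¹) (Or.inr (by norm_num)))
    simpa using h3
  have hn := fun n => hest (τ n) (hτ n) _ _ (h n)
  have h1 : ∀ n, 0 ≤ ∫ z in Q Ω T, overD pcd b (S n) (p n) z ^ 2 := fun n =>
    integral_nonneg fun z => sq_nonneg _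
  have h2 : ∀ n, 0 ≤ ∫ z in Q Ω T, underI pci b (S n) (p n) z ^ 2 := fun n =>
    integral_nonneg fun z => sq_nonneg _
  exact ⟨key _ (fun n => (hn n).1) fun n => by linarith [(hn n).2.2, h2 n],
    key _ (fun n => (hn n).2.1) fun n => by linarith [(hn n).2.2, h1 n]⟩

/-- A subsequence along which four sequences converge almost everywhere. -/
theorem exists_subseq_tendsto_ae {α : Type*} [MeasurableSpace α] {μ : Measure α}
    {f₁ f₂ f₃ f₄ : ℕ → α → ℝ} {l₁ l₂ l₃ l₄ : α → ℝ} (h₁ : TendstoInMeasure μ f₁ atTop l₁)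
    (h₂ : TendstoInMeasure μ f₂ atTop l₂) (h₃ : TendstoInMeasure μ f₃ atTop l₃)
    (h₄ : TendstoInMeasure μ f₄ atTop l₄) :
    ∃ ns : ℕ → ℕ, Tendsto ns atTop atTop ∧ ∀ᵐ x ∂μ,
      Tendsto (fun n => f₁ (ns n) x) atTop (𝓝 (l₁ x)) ∧
      Tendsto (fun n => f₂ (ns n) x) atTop (𝓝 (l₂ x)) ∧
      Tendsto (fun n => f₃ (ns n) x) atTop (𝓝 (l₃ x)) ∧
      Tendsto (fun n => f₄ (ns n) x) atTop (𝓝 (l₄ x)) := by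
  have hsub : ∀ {f : ℕ → α → ℝ} {l : α → ℝ} {ns : ℕ → ℕ}, TendstoInMeasure μ f atTop l →
      Tendsto ns atTop atTop → TendstoInMeasure μ (fun n => f (ns n)) atTop l :=
    fun hf hns ε hε => (hf ε hε).comp hns
  obtain ⟨n₁, hn₁, a₁⟩ := h₁.exists_seq_tendsto_ae
  have t₁ := hn₁.tendsto_atTop
  obtain ⟨n₂, hn₂, a₂⟩ := (hsub h₂ t₁).exists_seq_tendsto_ae
  have t₂ := hn₂.tendsto_atTop
  obtain ⟨n₃, hn₃, a₃⟩ := (hsub h₃ (t₁.comp t₂)).exists_seq_tendsto_ae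
  have t₃ := hn₃.tendsto_atTop
  obtain ⟨n₄, hn₄, a₄⟩ := (hsub h₄ ((t₁.comp t₂).comp t₃)).exists_seq_tendsto_ae
  have t₄ := hn₄.tendsto_atTop
  refine ⟨((n₁ ∘ n₂) ∘ n₃) ∘ n₄, ((t₁.comp t₂).comp t₃).comp t₄, ?_⟩
  filter_upwards [a₁, a₂, a₃, a₄] with x b₁ b₂ b₃ b₄
  exact ⟨b₁.comp ((t₂.comp t₃).comp t₄), b₂.comp (t₃.comp t₄), b₃.comp t₄, b₄⟩

/-- The hysteresis relation at a point of convergence. -/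
theorem rho_le_of_tendsto (hpc : CapillaryCurves pci pcd) (hb : ScanningFunction pci pcd b)
    {u v : ℕ → ℝ} {u' w : ℝ} (hu : Tendsto u atTop (𝓝 u')) (hv : Tendsto v atTop (𝓝 w))
    (hD : Tendsto (fun n => posPart (u n - rho pcd b (v n))) atTop (𝓝 0))
    (hI : Tendsto (fun n => posPart (rho pci b (v n) - u n)) atTop (𝓝 0)) :
    rho pci b w ≤ u' ∧ u' ≤ rho pcd b w := by
  have key : ∀ x : ℝ, posPart x = 0 → x ≤ 0 := fun x hx => hx ▸ le_max_left x 0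
  have hi := ((hpc.isScanCurve_i hb).rho_continuous.tendsto w).comp hv
  have hd := ((hpc.isScanCurve_d hb).rho_continuous.tendsto w).comp hv
  have h1 := tendsto_nhds_unique ((continuous_posPart.tendsto _).comp (hu.sub hd)) hD
  have h2 := tendsto_nhds_unique ((continuous_posPart.tendsto _).comp (hi.sub hu)) hI
  exact ⟨by linarith [key _ h2], by linarith [key _ h1]⟩

end EPH

namespace EPH

/-! ### The lower bound for the pressure in the absence of gravity -/

theorem exists_smoothTransition_deriv_le :
    ∃ L : NNReal, ∀ x, |deriv Real.smoothTransition x| ≤ L := by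
  obtain ⟨C, hC⟩ := isCompact_Icc.exists_bound_of_continuousOn (s := Icc (0 : ℝ) 1)
    ((Real.smoothTransition.contDiff (n := 1)).continuous_deriv le_rfl).continuousOn
  refine ⟨Real.toNNReal C, fun x => ?_⟩
  rcases le_or_gt x 0 with h | h
  · rw [smoothTransition_deriv_of_nonpos h, abs_zero]
    exact NNReal.coe_nonneg _
  · rcases le_or_gt 1 x with h' | h'
    · rw [smoothTransition_deriv_of_one_le h', abs_zero]
      exact NNReal.coe_nonneg _
    · exact (hC x ⟨h.le, h'.le⟩).trans (Real.le_coe_toNNReal C)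

/-- A smooth nondecreasing function vanishing exactly on `[m, ∞)`. -/
noncomputable def cutoff (m s : ℝ) : ℝ := -Real.smoothTransition (m - s)

theorem cutoff_hasDerivAt (m s : ℝ) :
    HasDerivAt (cutoff m) (deriv Real.smoothTransition (m - s)) s := by
  have h := (smoothTransition_hasDerivAt (m - s)).comp s ((hasDerivAt_id s).const_sub m)
  exact h.neg.congr_deriv (by ring)

theorem cutoff_contDiff (m : ℝ) : ContDiff ℝ ∞ (cutoff m) :=
  (Real.smoothTransition.contDiff.comp (contDiff_const.sub contDiff_id)).neg

theorem cutoff_monotone (m : ℝ) : Monotone (cutoff m) := fun _ _ h =>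
  neg_le_neg (Real.smoothTransition.monotone (sub_le_sub_left h m))

theorem cutoff_of_le {m s : ℝ} (h : m ≤ s) : cutoff m s = 0 := by
  rw [cutoff, Real.smoothTransition.zero_of_nonpos (sub_nonpos.2 h), neg_zero]

theorem cutoff_neg {m s : ℝ} (h : s < m) : cutoff m s < 0 :=
  neg_lt_zero.2 (Real.smoothTransition.pos_of_pos (sub_pos.2 h))

variable {d : ℕ} {Ω : Set (EuclideanSpace ℝ (Fin d))} {T : ℝ} {pci pcd b k : ℝ → ℝ}
  {g : EuclideanSpace ℝ (Fin d)} {S₀ p₀ : EuclideanSpace ℝ (Fin d) → ℝ} {τ : ℝ}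
  {S p v' : EuclideanSpace ℝ (Fin d) × ℝ → ℝ} {P R : ℝ → H10 Ω} {R' : ℝ → Hneg Ω}
  {c r V V' : ℝ → Lp ℝ 2 (volume.restrict Ω)}

/-- A function in `H¹₀` on a bounded set cannot be bounded below by a positive constant. -/
theorem nonpos_of_memH10 (hd : 0 < d) (hΩ : Bornology.IsBounded Ω) (hμ : volume.restrict Ω ≠ 0)
    {f : EuclideanSpace ℝ (Fin d) → ℝ} (hf : MemH10 Ω f) {m : ℝ}
    (hm : ∀ᵐ x ∂(volume.restrict Ω), m ≤ f x) : m ≤ 0 := by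
  by_contra! hm0
  obtain ⟨w, hw, hwf⟩ := hf
  obtain ⟨L, hL⟩ := exists_smoothTransition_deriv_le
  have hder : ∀ s, deriv (fun s => Real.smoothTransition (m⁻¹ * s)) s
      = m⁻¹ * deriv Real.smoothTransition (m⁻¹ * s) := fun s => by
    have h := (smoothTransition_hasDerivAt (m⁻¹ * s)).comp s ((hasDerivAt_id s).const_mul m⁻¹)
    exact h.deriv.trans (by ring)
  -- A smooth step rising from 0 at 0 to 1 at m turns f into an H¹₀ function equal to 1 with
  -- vanishing gradient, which contradicts Poincaré on a set of positive measure.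
  obtain ⟨N, -, hN⟩ := exists_comp_H10 (Ω := Ω)
    (β := fun s => Real.smoothTransition (m⁻¹ * s)) (K := Real.toNNReal m⁻¹ * L)
    (Real.smoothTransition.contDiff.comp (contDiff_const.mul contDiff_id)) (by simp)
    fun s => by
      rw [hder, abs_mul, abs_of_pos (inv_pos.2 hm0), NNReal.coe_mul,
        Real.coe_toNNReal _ (inv_pos.2 hm0).le]
      exact mul_le_mul_of_nonneg_left (hL _) (inv_pos.2 hm0).le
  obtain ⟨h1, h2, -⟩ := hN ⟨w, hw⟩
  obtain ⟨C, hC⟩ := exists_poincare hd hΩ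
  have h3 := hC _ (N ⟨w, hw⟩).2
  have hge : ∀ᵐ x ∂(volume.restrict Ω), 1 ≤ m⁻¹ * w.fst x := by
    filter_upwards [hm, hwf] with x h4 h5
    rw [h5, ← inv_mul_cancel₀ hm0.ne']
    exact mul_le_mul_of_nonneg_left h4 (inv_pos.2 hm0).le
  have h4 : (N ⟨w, hw⟩ : Pairs Ω).snd = 0 := by
    rw [Lp.eq_zero_iff_ae_eq_zero]
    filter_upwards [h2, hge] with x h5 h6
    rw [h5, hder, smoothTransition_deriv_of_one_le h6]
    simp
  rw [h4, norm_zero] at h3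
  have h5 : (N ⟨w, hw⟩ : Pairs Ω).fst = 0 := by
    rw [← norm_eq_zero]
    nlinarith [norm_nonneg (N ⟨w, hw⟩ : Pairs Ω).fst]
  rw [Lp.eq_zero_iff_ae_eq_zero] at h5
  have h6 : ∀ᵐ x ∂(volume.restrict Ω), False := by
    filter_upwards [h1, h5, hge] with x h7 h8 h9
    rw [h8, Real.smoothTransition.one_of_one_le h9] at h7
    simp at h7
  rw [eventually_false_iff_eq_bot, ae_eq_bot] at h6
  exact hμ h6

/-- Measurability in t comes from the inner product of two L²-valued curves, so no joint
measurability of the integrand is needed. -/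
theorem ae_inner_eq_zero {α β E : Type*} [MeasurableSpace α] [MeasurableSpace β] {μ : Measure α}
    {ν : Measure β} [NormedAddCommGroup E] [InnerProductSpace ℝ E] {A D : β → Lp E 2 μ}
    (hA : MemLp A 2 ν) (hD : MemLp D 2 ν)
    (hpos : ∀ᵐ t ∂ν, ∀ᵐ x ∂μ, 0 ≤ (inner ℝ (A t x) (D t x) : ℝ))
    (hle : ∫ t, ∫ x, inner ℝ (A t x) (D t x) ∂μ ∂ν ≤ 0) :
    ∀ᵐ t ∂ν, ∀ᵐ x ∂μ, (inner ℝ (A t x) (D t x) : ℝ) = 0 := by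
  have hnn : ∀ᵐ t ∂ν, 0 ≤ ∫ x, (inner ℝ (A t x) (D t x) : ℝ) ∂μ := by
    filter_upwards [hpos] with t ht
    exact integral_nonneg_of_ae ht
  have hint : Integrable (fun t => ∫ x, (inner ℝ (A t x) (D t x) : ℝ) ∂μ) ν := by
    refine Integrable.mono' (hA.norm.integrable_mul hD.norm)
      ((hA.1.inner hD.1).congr (Eventually.of_forall fun t => L2.inner_def _ _))
      (Eventually.of_forall fun t => ?_)
    rw [← L2.inner_def]
    exact norm_inner_le_norm _ _
  have h0 := le_antisymm hle (integral_nonneg_of_ae hnn)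
  rw [integral_eq_zero_iff_of_nonneg_ae hnn hint] at h0
  filter_upwards [h0, hpos] with t h1 h2
  have h3 := (integral_eq_zero_iff_of_nonneg_ae h2 (L2.integrable_inner (A t) (D t))).1 h1
  exact h3

namespace SolutionData

theorem exists_flux_curve (h : SolutionData Ω T pci pcd b k 0 S₀ p₀ τ S p v' P R R' c r V V')
    (hk : Permeability k) :
    ∃ A : ℝ → Lp (EuclideanSpace ℝ (Fin d)) 2 (volume.restrict Ω),
      MemLp A 2 (volume.restrict (Ioc 0 T)) ∧ ∀ᵐ t ∂(volume.restrict (Ioc 0 T)),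
        A t =ᵐ[volume.restrict Ω] fun x => k (S (x, t)) • (P t : Pairs Ω).snd x := by
  have hS := h.curves.memLp_S
  rw [restrict_Q] at hS
  obtain ⟨s, hs1, hs2⟩ := exists_L2_curve hS
  have hkK : ∀ s, |k s| ≤ k 1 := fun s => by
    rw [abs_of_nonneg (hk.mem_Icc s).1]
    exact (hk.mem_Icc s).2
  have hP : MemLp (fun t => (P t : Pairs Ω).snd) 2 (volume.restrict (Ioc 0 T)) :=
    ((WithLp.sndL 2 ℝ _ _).comp (H10 Ω).subtypeL).comp_memLp' h.curves.memLp_P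
  refine ⟨fun t => smulComp hk.contDiff.continuous hkK (s t) (P t : Pairs Ω).snd,
    hP.of_le_mul (c := k 1) ((continuous_smulComp hk.contDiff.continuous hkK).comp_aestronglyMeasurable
      (hs1.1.prodMk hP.1)) (Eventually.of_forall fun t => norm_smulComp_le _ _ _ _), ?_⟩
  filter_upwards [hs2] with t ht
  filter_upwards [ht, coeFn_smulComp hk.contDiff.continuous hkK (s t) (P t : Pairs Ω).snd]
    with x h1 h2
  rw [h2, h1]

theorem integral_dual_eq (h : SolutionData Ω T pci pcd b k 0 S₀ p₀ τ S p v' P R R' c r V V')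
    {A : ℝ → Lp (EuclideanSpace ℝ (Fin d)) 2 (volume.restrict Ω)}
    (hA : ∀ᵐ t ∂(volume.restrict (Ioc 0 T)),
        A t =ᵐ[volume.restrict Ω] fun x => k (S (x, t)) • (P t : Pairs Ω).snd x)
    {W : ℝ → H10 Ω} (hW : MemLp W 2 (volume.restrict (Ioc 0 T))) :
    ∫ t in Ioc 0 T, R' t (W t)
      = ∫ t in Ioc 0 T, ∫ x in Ω, inner ℝ (A t x) ((W t : Pairs Ω).snd x) := by
  rw [h.eq_flux W hW]
  refine integral_congr_ae ?_
  filter_upwards [hA] with t ht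
  refine integral_congr_ae ?_
  filter_upwards [ht] with x hx
  rw [hx, sub_zero]

/-- Below the common end pressure b(p) ≤ U_m ≤ ρ^(d), so D = 0 and ∂ₜv ≥ 0 while the cutoff is
negative. If the product vanishes then I = 0, and S < 1 would give b(p) ≥ b(`pci S`) > U_m. -/
theorem mul_cutoff_nonpos [IsFiniteMeasure (volume.restrict Ω)]
    (h : SolutionData Ω T pci pcd b k g S₀ p₀ τ S p v' P R R' c r V V')
    (hτ : 0 < τ) (hpc : CapillaryCurves pci pcd) (hb : ScanningFunction pci pcd b) :
    ∀ᵐ z ∂(volume.restrict (Q Ω T)), v' z * cutoff (pci 1) (p z) ≤ 0 ∧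
      (p z < pci 1 → v' z * cutoff (pci 1) (p z) = 0 → S z = 1) := by
  have hi := hpc.isScanCurve_i hb
  have hd := hpc.isScanCurve_d hb
  filter_upwards [h.v'_ae hpc hb, h.S_mem] with z hz hS
  rcases le_or_gt (pci 1) (p z) with hp | hp
  · rw [cutoff_of_le hp, mul_zero]
    exact ⟨le_rfl, fun h1 => absurd h1 hp.not_gt⟩
  · have hbp : b (p z) ≤ b (pci 1) := hb.mono hp.le
    have hD : overD pcd b S p z = 0 := by
      refine posPart_of_nonpos ?_
      have h1 := hd.le_rho (S z + b (p z))
      rw [Um, ← hpc.eq_one] at h1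
      linarith
    rw [hD, sub_zero] at hz
    have hI : 0 ≤ underI pci b S p z := posPart_nonneg _
    have hc := cutoff_neg hp
    have hv : 0 ≤ v' z := by
      rw [hz]
      positivity
    refine ⟨mul_nonpos_of_nonneg_of_nonpos hv hc.le, fun _ h0 => ?_⟩
    have hv0 : v' z = 0 := (mul_eq_zero.1 h0).resolve_right hc.ne
    rw [hz] at hv0
    have hI0 : underI pci b S p z = 0 :=
      (mul_eq_zero.1 hv0).resolve_left (one_div_pos.2 hτ).ne'
    have hrho : rho pci b (S z + b (p z)) ≤ b (p z) := by
      have : rho pci b (S z + b (p z)) - b (p z) ≤ 0 := hI0 ▸ le_max_left _ _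
      linarith
    have hS0 := hi.saturation_pos hS.1 hrho
    by_contra hS1
    have hS2 : S z ∈ Ioo (0 : ℝ) 1 := ⟨hS0, lt_of_le_of_ne hS.2 hS1⟩
    have h1 := hi.b_pc_le_of_rho_le ⟨hS0, hS.2⟩ hrho
    exact absurd (h1.trans hbp) (not_le.2 (hi.Um_lt_b (hi.pc_one_lt hS2)))

end SolutionData

end EPH

/-! ### Minimum principle without gravity, and return to the variables (S, p) -/

namespace EPH

variable {d : ℕ} {Ω : Set (EuclideanSpace ℝ (Fin d))} {T : ℝ} {pci pcd b k : ℝ → ℝ}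
  {g : EuclideanSpace ℝ (Fin d)} {S₀ p₀ : EuclideanSpace ℝ (Fin d) → ℝ} {τ : ℝ}
  {S p v' : EuclideanSpace ℝ (Fin d) × ℝ → ℝ} {P R : ℝ → H10 Ω} {R' : ℝ → Hneg Ω}
  {c r V V' : ℝ → Lp ℝ 2 (volume.restrict Ω)}

theorem energy_cutoff_of_le {m q : ℝ} (hq : m ≤ q) : energy b (cutoff m) m q = 0 := by
  rw [energy, intervalIntegral.integral_of_le hq]
  exact setIntegral_eq_zero_of_forall_eq_zero fun s hs => by rw [cutoff_of_le hs.1.le, zero_mul]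

/-- Without gravity the pressure of a weak solution stays above the common end value of the
capillary curves. -/
theorem SolutionData.pc_one_le [IsFiniteMeasure (volume.restrict Ω)]
    (h : SolutionData Ω T pci pcd b k 0 S₀ p₀ τ S p v' P R R' c r V V')
    (hd : 0 < d) (hΩb : Bornology.IsBounded Ω) (hT : 0 < T) (hτ : 0 < τ)
    (hpc : CapillaryCurves pci pcd) (hk : Permeability k) (hb : ScanningFunction pci pcd b)
    (hm : pci 1 ≤ 0) (hp₀ : ∀ᵐ x ∂(volume.restrict Ω), pci 1 ≤ p₀ x) :
    ∀ᵐ z ∂(volume.restrict (Q Ω T)), pci 1 ≤ p z := by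
  obtain ⟨B, -, hB⟩ := hb.exists_lipschitz
  obtain ⟨L, hL⟩ := exists_smoothTransition_deriv_le
  have hβ := cutoff_contDiff (pci 1)
  have hder : ∀ s, deriv (cutoff (pci 1)) s = deriv Real.smoothTransition (pci 1 - s) :=
    fun s => (cutoff_hasDerivAt (pci 1) s).deriv
  have hL' : ∀ s, |deriv (cutoff (pci 1)) s| ≤ L := fun s => by
    rw [hder]
    exact hL _
  have hLip : LipschitzWith L (cutoff (pci 1)) :=
    lipschitzWith_of_nnnorm_deriv_le (hβ.differentiable (by simp)) hL'
  obtain ⟨N, hNc, hN⟩ := exists_comp_H10 (Ω := Ω) hβ (cutoff_of_le hm) hL'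
  obtain ⟨W, hWN⟩ : ∃ W : ℝ → H10 Ω, ∀ t, W t = N (P t) := ⟨_, fun _ => rfl⟩
  have hW : MemLp W 2 (volume.restrict (Ioc 0 T)) := by
    rw [show W = fun t => N (P t) from funext hWN]
    exact h.curves.memLp_P.of_le_mul (hNc.comp_aestronglyMeasurable h.curves.memLp_P.1)
      (Eventually.of_forall fun t => (hN (P t)).2.2)
  have hWβ : ∀ᵐ t ∂(volume.restrict (Ioc 0 T)),
      (W t : Pairs Ω).fst =ᵐ[volume.restrict Ω] fun x => cutoff (pci 1) (p (x, t)) := by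
    filter_upwards [h.curves.P_ae] with t ht
    rw [hWN]
    filter_upwards [(hN (P t)).1, ht] with x h1 h2
    rw [h1, h2]
  have hWsnd : ∀ᵐ t ∂(volume.restrict (Ioc 0 T)), (W t : Pairs Ω).snd =ᵐ[volume.restrict Ω]
      fun x => deriv Real.smoothTransition (pci 1 - p (x, t)) • (P t : Pairs Ω).snd x := by
    filter_upwards [h.curves.P_ae] with t ht
    rw [hWN]
    filter_upwards [(hN (P t)).2.1, ht] with x h1 h2
    rw [h1, h2, hder]
  have h1 := h.curves.neg_integral_le hT hB hb.zero hLip (cutoff_of_le hm) hW hWβ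
    (continuous_energy hb.contDiff hβ.continuous (pci 1))
    (energy_nonneg hb.contDiff hb.mono hβ.continuous (cutoff_monotone _) (cutoff_of_le le_rfl))
    (energy_self (pci 1)) (energy_sub_le hb.contDiff hb.mono hβ.continuous (cutoff_monotone _) _)
  have h2 : ∫ x in Ω, energy b (cutoff (pci 1)) (pci 1) (p₀ x) = 0 := by
    refine integral_eq_zero_of_ae ?_
    filter_upwards [hp₀] with x hx
    exact energy_cutoff_of_le hx
  rw [h2, neg_zero] at h1
  have hpt := h.mul_cutoff_nonpos hτ hpc hb
  have h3 : ∫ z in Q Ω T, v' z * cutoff (pci 1) (p z) ≤ 0 :=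
    integral_nonpos_of_ae (by filter_upwards [hpt] with z hz; exact hz.1)
  obtain ⟨A, hA1, hA2⟩ := h.exists_flux_curve hk
  have hdual := h.integral_dual_eq hA2 hW
  have hinner : ∀ᵐ t ∂(volume.restrict (Ioc 0 T)), ∀ᵐ x ∂(volume.restrict Ω),
      (inner ℝ (A t x) ((W t : Pairs Ω).snd x) : ℝ) = k (S (x, t))
        * (deriv Real.smoothTransition (pci 1 - p (x, t)) * ‖(P t : Pairs Ω).snd x‖ ^ 2) := by
    filter_upwards [hA2, hWsnd] with t h4 h5
    filter_upwards [h4, h5] with x h6 h7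
    rw [h6, h7, real_inner_smul_left, real_inner_smul_right, real_inner_self_eq_norm_sq]
  have hpos : ∀ᵐ t ∂(volume.restrict (Ioc 0 T)), ∀ᵐ x ∂(volume.restrict Ω),
      0 ≤ (inner ℝ (A t x) ((W t : Pairs Ω).snd x) : ℝ) := by
    filter_upwards [hinner] with t h4
    filter_upwards [h4] with x h5
    rw [h5]
    exact mul_nonneg (hk.mem_Icc _).1 (mul_nonneg (smoothTransition_deriv_nonneg _) (sq_nonneg _))
  have hWs : MemLp (fun t => (W t : Pairs Ω).snd) 2 (volume.restrict (Ioc 0 T)) :=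
    ((WithLp.sndL 2 ℝ _ _).comp (H10 Ω).subtypeL).comp_memLp' hW
  -- The initial energy is zero, so 0 ≤ ∫∂ₜS W ≤ ∫∂ₜv cutoff(p) ≤ 0: both the flux integrand and ∂ₜv
  -- cutoff(p) vanish.
  have hzero := ae_inner_eq_zero hA1 hWs hpos (by rw [← hdual]; linarith)
  have h4 : 0 ≤ ∫ t in Ioc 0 T, R' t (W t) := by
    rw [hdual]
    refine integral_nonneg_of_ae ?_
    filter_upwards [hpos] with t ht
    exact integral_nonneg_of_ae ht
  have hβQ := hLip.comp_memLp (cutoff_of_le hm) h.curves.memLp_p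
  have h5 : ∀ᵐ z ∂(volume.restrict (Q Ω T)), p z < pci 1 → S z = 1 := by
    have h6 : ∫ z in Q Ω T, -(v' z * cutoff (pci 1) (p z)) = 0 := by
      rw [integral_neg]
      linarith
    have h7 : IntegrableOn (fun z => -(v' z * cutoff (pci 1) (p z))) (Q Ω T) :=
      (h.curves.memLp_v'.integrable_mul hβQ).neg
    rw [integral_eq_zero_iff_of_nonneg_ae (by
      filter_upwards [hpt] with z hz
      exact neg_nonneg.2 hz.1) h7] at h6
    filter_upwards [h6, hpt] with z h8 h9 h10
    exact h9.2 h10 (neg_eq_zero.1 h8)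
  rw [restrict_Q] at h5 hβQ ⊢
  obtain ⟨C, hC⟩ := exists_poincare hd hΩb
  -- Where p < `pci 1` one has S = 1, so k(S) = k 1 > 0 even when k 0 = 0. The gradient of cutoff(p)
  -- therefore vanishes, and Poincaré applies.
  have hW0 : ∀ᵐ t ∂(volume.restrict (Ioc 0 T)), (W t : Pairs Ω).fst = 0 := by
    filter_upwards [hzero, hinner, hWsnd, ae_prod_right h5] with t h6 h7 h8 h9
    have h10 : (W t : Pairs Ω).snd = 0 := by
      rw [Lp.eq_zero_iff_ae_eq_zero]
      filter_upwards [h6, h7, h8, h9] with x h11 h12 h13 h14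
      rw [h13, Pi.zero_apply]
      rcases le_or_gt (pci 1) (p (x, t)) with h15 | h15
      · rw [smoothTransition_deriv_of_nonpos (by linarith), zero_smul]
      · rw [h12, h14 h15] at h11
        have h16 : k 1 ≠ 0 := (hk.nonneg.trans_lt hk.lt_one).ne'
        rcases mul_eq_zero.1 ((mul_eq_zero.1 h11).resolve_left h16) with h17 | h17
        · rw [h17, zero_smul]
        · rw [norm_eq_zero.1 (pow_eq_zero_iff two_ne_zero |>.1 h17), smul_zero]
    have h11 := hC _ (W t).2
    rw [h10, norm_zero] at h11
    rw [← norm_eq_zero]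
    nlinarith [norm_nonneg (W t : Pairs Ω).fst]
  have h6 := integral_prod_eq_inner hβQ hβQ (W := fun t => (W t : Pairs Ω).fst)
    (Z := fun t => (W t : Pairs Ω).fst) hWβ hWβ
  have h7 : ∫ t in Ioc 0 T, (inner ℝ (W t : Pairs Ω).fst (W t : Pairs Ω).fst : ℝ) = 0 := by
    refine integral_eq_zero_of_ae ?_
    filter_upwards [hW0] with t ht
    rw [ht, inner_zero_left, Pi.zero_apply]
  rw [h7, integral_eq_zero_iff_of_nonneg (fun z => mul_self_nonneg _)
    (hβQ.integrable_mul hβQ)] at h6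
  filter_upwards [h6] with z hz
  by_contra! hlt
  exact (cutoff_neg hlt).ne (mul_self_eq_zero.1 hz)

/-- Since p₀ ≥ `pci 1` and p₀ is in H¹₀, the end pressure is nonpositive unless Ω is null. Only then
does the cutoff vanish at 0 and preserve H¹₀. -/
theorem IsWeakSolution.pc_one_le (hd : 0 < d) (hΩo : IsOpen Ω) (hΩb : Bornology.IsBounded Ω)
    [IsFiniteMeasure (volume.restrict Ω)] (hT : 0 < T) (hτ : 0 < τ)
    (hpc : CapillaryCurves pci pcd) (hk : Permeability k) (hb : ScanningFunction pci pcd b)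
    (h₀ : InitialData Ω pci pcd S₀ p₀)
    (h : IsWeakSolution Ω T pci pcd b k 0 S₀ p₀ τ S p) :
    ∀ᵐ z ∂(volume.restrict (Q Ω T)), pci 1 ≤ p z := by
  by_cases hμ : volume.restrict Ω = 0
  · rw [restrict_Q, hμ, Measure.zero_prod]
    simp
  · obtain ⟨s, -, hs⟩ := h₀.exists_lower hpc hb
    have hp₀ : ∀ᵐ x ∂(volume.restrict Ω), pci 1 ≤ p₀ x := by
      filter_upwards [hs] with x hx
      exact hx.2.1
    obtain ⟨v', P, R, R', c, r, V, V', hdata⟩ := h.exists_data hΩo hT hb h₀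
    exact hdata.pc_one_le hd hΩb hT hτ hpc hk hb (nonpos_of_memH10 hd hΩb hμ h₀.memH10 hp₀) hp₀

/-- The hysteresis relation in terms of the saturation and the pressure. -/
theorem capillary_bounds_of_rho_le (hpc : CapillaryCurves pci pcd)
    (hb : ScanningFunction pci pcd b) {s q : ℝ} (hs : s ∈ Icc (0 : ℝ) 1)
    (hi : rho pci b (s + b q) ≤ b q) (hd : b q ≤ rho pcd b (s + b q)) :
    0 < s ∧ s ≤ 1 ∧ q ≤ pcd s ∧ (s < 1 → pci s ≤ q) ∧ (s = 1 → b q = b (pci 1)) := by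
  have Hi := hpc.isScanCurve_i hb
  have Hd := hpc.isScanCurve_d hb
  have h0 := Hi.saturation_pos hs.1 hi
  have h1 := Hd.le_pc_of_le_rho ⟨h0, hs.2⟩ hd
  refine ⟨h0, hs.2, h1, fun h => Hi.pc_le_of_rho_le ⟨h0, h⟩ hi, ?_⟩
  rintro rfl
  refine le_antisymm ?_ (Hi.b_pc_le_of_rho_le ⟨h0, le_rfl⟩ hi)
  rw [hpc.eq_one]
  exact hb.mono h1

end EPH


/-! ### The proposition -/

theorem mainTheorem4 {d : ℕ} (hd : 0 < d) (Ω : Set (EuclideanSpace ℝ (Fin d)))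
    (hΩo : IsOpen Ω) (hΩb : Bornology.IsBounded Ω) (T : ℝ) (hT : 0 < T)
    (pci pcd b k : ℝ → ℝ) (g : EuclideanSpace ℝ (Fin d))
    (S₀ p₀ : EuclideanSpace ℝ (Fin d) → ℝ)
    (hpc : EPH.CapillaryCurves pci pcd) (hk : EPH.Permeability k)
    (hb : EPH.ScanningFunction pci pcd b) (h₀ : EPH.InitialData Ω pci pcd S₀ p₀)
    (hcase : 0 < k 0 ∨ (g = 0 ∧ k 0 = 0)) :
    -- the estimate, with a constant independent of `τ`
    (∃ C > 0, ∀ τ > 0, ∀ S p : EuclideanSpace ℝ (Fin d) × ℝ → ℝ,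
      EPH.IsWeakSolution Ω T pci pcd b k g S₀ p₀ τ S p →
      MemLp (fun z => EPH.posPart (b (p z) - EPH.rho pcd b (S z + b (p z)))) 2
        (volume.restrict (EPH.Q Ω T)) ∧
      MemLp (fun z => EPH.posPart (EPH.rho pci b (S z + b (p z)) - b (p z))) 2
        (volume.restrict (EPH.Q Ω T)) ∧
      (∫ t in Ioc 0 T, ∫ x in Ω,
          EPH.posPart (b (p (x, t)) - EPH.rho pcd b (S (x, t) + b (p (x, t)))) ^ 2)
        + (∫ t in Ioc 0 T, ∫ x in Ω,
          EPH.posPart (EPH.rho pci b (S (x, t) + b (p (x, t))) - b (p (x, t))) ^ 2)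
        < C * τ) ∧
    -- limits as `τ → 0`
    (∀ (τ : ℕ → ℝ) (S p : ℕ → EuclideanSpace ℝ (Fin d) × ℝ → ℝ),
      (∀ n, 0 < τ n) → Tendsto τ atTop (𝓝 0) →
      (∀ n, EPH.IsWeakSolution Ω T pci pcd b k g S₀ p₀ (τ n) (S n) (p n)) →
      -- in the variables `u = b(p)`, `v = S + b(p)`
      (∀ u v : EuclideanSpace ℝ (Fin d) × ℝ → ℝ,
        TendstoInMeasure (volume.restrict (EPH.Q Ω T)) (fun n z => b (p n z)) atTop u →
        TendstoInMeasure (volume.restrict (EPH.Q Ω T)) (fun n z => S n z + b (p n z)) atTop v →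
        ∀ᵐ z ∂(volume.restrict (EPH.Q Ω T)),
          EPH.rho pci b (v z) ≤ u z ∧ u z ≤ EPH.rho pcd b (v z)) ∧
      -- in the variables `S`, `p`
      (∀ Slim plim : EuclideanSpace ℝ (Fin d) × ℝ → ℝ,
        TendstoInMeasure (volume.restrict (EPH.Q Ω T)) S atTop Slim →
        TendstoInMeasure (volume.restrict (EPH.Q Ω T)) p atTop plim →
        ∀ᵐ z ∂(volume.restrict (EPH.Q Ω T)),
          0 < Slim z ∧ Slim z ≤ 1 ∧
          plim z ≤ pcd (Slim z) ∧
          (Slim z < 1 → pci (Slim z) ≤ plim z) ∧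
          (Slim z = 1 → b (plim z) = b (pci 1)) ∧
          (g = 0 → pci (Slim z) ≤ plim z))) := by
  have hfin : IsFiniteMeasure (volume.restrict Ω) :=
    ⟨by rw [Measure.restrict_apply_univ]; exact hΩb.measure_lt_top⟩
  refine ⟨?_, fun τ S p hτ hτ0 hsol => ⟨fun u v hu hv => ?_, fun Slim plim hS hp => ?_⟩⟩
  · obtain ⟨C, hC, h⟩ := EPH.exists_integral_sq_le (g := g) hΩo hT hpc hk hb h₀
    refine ⟨C, hC, fun τ hτ S p hsol => ?_⟩
    obtain ⟨hD, hI, hlt⟩ := h τ hτ S p hsol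
    rw [EPH.integral_Q_eq hD.integrable_sq, EPH.integral_Q_eq hI.integrable_sq] at hlt
    exact ⟨hD, hI, hlt⟩
  · obtain ⟨hD, hI⟩ := EPH.tendstoInMeasure_overD hΩo hT hpc hk hb h₀ hτ hτ0 hsol
    obtain ⟨ns, hns, hae⟩ := EPH.exists_subseq_tendsto_ae hu hv hD hI
    filter_upwards [hae] with z hz
    exact EPH.rho_le_of_tendsto hpc hb hz.1 hz.2.1 hz.2.2.1 hz.2.2.2
  · obtain ⟨hD, hI⟩ := EPH.tendstoInMeasure_overD hΩo hT hpc hk hb h₀ hτ hτ0 hsol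
    obtain ⟨ns, hns, hae⟩ := EPH.exists_subseq_tendsto_ae hS hp hD hI
    have hSmem : ∀ᵐ z ∂(volume.restrict (EPH.Q Ω T)), ∀ n, S n z ∈ Icc (0 : ℝ) 1 :=
      ae_all_iff.2 fun n => by
        obtain ⟨P, R, P', R', v', -, -, h, -⟩ := hsol n
        exact h
    have hple : g = 0 → ∀ᵐ z ∂(volume.restrict (EPH.Q Ω T)), ∀ n, pci 1 ≤ p n z := by
      rintro rfl
      exact ae_all_iff.2 fun n => (hsol n).pc_one_le hd hΩo hΩb hT (hτ n) hpc hk hb h₀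
    filter_upwards [hae, hSmem, Filter.eventually_imp_distrib_left.2 hple]
      with z ⟨h1, h2, h3, h4⟩ h5 h6
    have hbp := (hb.contDiff.continuous.tendsto (plim z)).comp h2
    have hSl : Slim z ∈ Icc (0 : ℝ) 1 :=
      isClosed_Icc.mem_of_tendsto h1 (Eventually.of_forall fun n => h5 (ns n))
    obtain ⟨h7, h8⟩ := EPH.rho_le_of_tendsto hpc hb hbp (h1.add hbp) h3 h4
    obtain ⟨h9, h10, h11, h12, h13⟩ := EPH.capillary_bounds_of_rho_le hpc hb hSl h7 h8
    refine ⟨h9, h10, h11, h12, h13, fun hg => ?_⟩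
    rcases h10.lt_or_eq with h14 | h14
    · exact h12 h14
    -- At S = 1 the hysteresis relation gives no lower bound for p; it comes from the minimum
    -- principle for each p_n, passed to the limit.
    · rw [h14]
      exact ge_of_tendsto h2 (Eventually.of_forall fun n => h6 hg (ns n))
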